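/- **Setting.** Let $\mathcal X,\mathcal V$ be finite sets (contexts, actions), $N\ge 2$, and let $\pi_1,\dots,\pi_N$ be experts, i.e. conditional distributions $\pi_i(\cdot|x)$ on $\mathcal V$, $x\in\mathcal X$. There are $E$ episodes of $T$ rounds. Episode $e$ has a context distribution $p_e$ on $\mathcal X$ and reward distributions $q_e(\cdot|x,v)$ on $[0,1]$. In each round of episode $e$ the agent picks an expert $i$; then $X\sim p_e$, $V\sim\pi_i(\cdot|X)$, $Y\sim q_e(\cdot|X,V)$ are drawn afresh. Put $\mu_{i,e}=\sum_x p_e(x)\sum_v\pi_i(v|x)\int y\,q_e(dy|x,v)$ and $\mu_e^*=\max_i\mu_{i,e}$. Before the first episode every expert is sampled in contexts drawn from a distribution $p_{prior}$ on $\mathcal X$. Known to the agent are numbers $p_X,p_V,\gamma>0$ with $p_X\le p_e(x),p_{prior}(x)$, $p_V\le\pi_i(v|x)$, $\gamma\le\mu_{i,e}$ for all $e,i,x,v$, and a number $M\ge 1+\log\big(1+\sum_x p_e(x)\sum_v\pi_i(v|x)f_1(\pi_i(v|x)/\pi_j(v|x))\big)$ for all $e,i,j$, where $f_1(r)=re^{r-1}-1$.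 Let $C=\frac{32M}{\gamma(1-p_V)}$; let $w(x)$, for $x\ge0$, be the $y\in[0,2)$ with $y/\log(2/y)=x$ (where the left side is $0$ at $y=0$); and let $\xi=\frac{2(\sqrt{1+p_V^4\gamma^2/4}-1)}{p_V\gamma}$, the positive solution of $\frac{\xi}{p_V}\big(\frac1{p_V-\xi}+\frac1{p_V+\xi}\big)=\frac{\gamma p_V}{2}$. **ED-UCB.** Given estimates $\hat\pi_i$ of the experts, put $\underline r_{ij}=\frac{\hat\pi_i}{\hat\pi_j}-\frac{\xi}{p_V(p_V-\xi)}$, $\overline r_{ij}=\frac{\hat\pi_i}{\hat\pi_j}+\frac{\xi}{p_V(p_V+\xi)}$ (functions of $(v|x)$) and $\underline M_{ij}=1+\log\big(1+p_X\sum_{x,v}(\hat\pi_i(v|x)-\xi)f_1(\underline r_{ij}(v|x))\big)$. After $t\ge1$ rounds of an episode, with experts $k_s$ and observations $X_s,V_s,Y_s$ ($s\le t$), put $Z_i(t)=\sum_{s\le t}\underline M_{ik_s}^{-1}$, $\epsilon_i(t)=C\,w\big(\sqrt{t\log t}/Z_i(t)\big)$, $\alpha_{ij}(t)=2\log\big(2/\epsilon_i(t)\big)\underline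 M_{ij}$ (infinite if $\epsilon_i(t)=0$), $$\tilde Y_i(t)=\frac1{Z_i(t)}\sum_{s\le t}\frac{Y_s}{\underline M_{ik_s}}\,\underline r_{ik_s}(V_s|X_s)\,\mathbf 1\{\overline r_{ik_s}(V_s|X_s)\le\alpha_{ik_s}(t)\},$$ $$e_i(t)=\max_{x,v,j}\big(\overline r_{ij}(v|x)-\underline r_{ij}(v|x)\mathbf 1\{\overline r_{ij}(v|x)\le\alpha_{ij}(t)\}\big),$$ $U_i(t)=\tilde Y_i(t)+\frac32\epsilon_i(t)+e_i(t)$, and $U_i(0)=\infty$. In round $t+1$ an expert maximizing $U_i(t)$ is played; ties are broken arbitrarily, without looking at the context of that round. **Bootstrapped agent.** With $n=\frac{2|\mathcal V|\log(2T)}{\xi^2}$ and $A=\Big\lceil\frac{2n}{p_X}+\frac{\log(|\mathcal X|NT\sqrt E)}{2p_X^2}\Big\rceil$, every expert is first sampled $A$ times independently ($X\sim p_{prior}$, $V\sim\pi_i(\cdot|X)$); $\hat\pi_i(v|x)$ is the resulting empirical conditional frequency ($0$ if $x$ was not seen with expert $i$). In each episode a fresh instance of ED-UCB with these $\hat\pi_i$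 is run for $T$ rounds. The regret is $R(E,T)=\mathbb E\sum_{e=1}^E\sum_{t=1}^T(\mu_e^*-\mu_{k_{t,e},e})$. **Constants.** Let $0=\Delta_{1,e}\le\Delta_{2,e}\le\dots\le\Delta_{N,e}$ be the gaps $\mu_e^*-\mu_{i,e}$ in increasing order. Let $T_{clip}\ge1$ be the least time from which on $\overline r_{ij}(v|x)\le\alpha_{ij}(t)$ for all $i,j,x,v$, for all conditional distributions $\hat\pi$ with $\|\hat\pi_i(\cdot|x)-\pi_i(\cdot|x)\|_\infty\le\xi$ for all $i,x$ and all sequences of plays. Let $\tau_1=\min\{t\ge2:C\,w(\sqrt{\log t/t})\le\gamma\}$, $T_1=\max\{\tau_1,T_{clip}\}$, and for $k\ge2$ $$\tau_{k,e}=\min\Big\{t\ge2:\frac t{\log t}\ge\frac{9C^2M^2\log^2\big(\frac{6C}{\Delta_{k,e}-\gamma p_V}\big)}{(\Delta_{k,e}-\gamma p_V)^2}\Big\},\qquad T_{k,e}=\max\{T_1,\tau_{k,e}\}.$$ Put $R(\mathbf\Delta_e)=\frac{\pi^2}3\sum_{k=2}^N\Delta_{k,e}+T_{N,e}\Delta_{N,e}+\sum_{k=2}^{N-1}(T_{k,e}-T_{k+1,e})\Delta_{k,e}$.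 **Theorem.** If $\Delta_{2,e}>\gamma p_V$ and $T\ge T_{2,e}$ for every episode $e$, then $$R(E,T)\le\sqrt E+E+\Big(\sum_{e=1}^E R(\mathbf\Delta_e)\Big)\Big(1+\frac1{T^2\sqrt E}\Big),$$ and the right-hand side is $\tilde O\big(E(N+1)+\frac{N\sqrt E}{T^2}\big)$, the hidden constant depending only on the times $T_{2,e}$: for every $c\ge\max_e T_{2,e}$ it is at most $\big(2+\frac{\pi^2}3+c\big)\big(E(N+1)+\frac{N\sqrt E}{T^2}\big)$. -/

import Mathlib

open MeasureTheory

noncomputable section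

namespace EDUCB

/-! ### Elementary functions -/

/-- `f₁(x) = x exp (x - 1) - 1`. -/
def f₁ (x : ℝ) : ℝ := x * Real.exp (x - 1) - 1

/-- `w(x)` is the `y ∈ [0, 2)` with `y / log (2 / y) = x`: the map `y ↦ y / log (2 / y)` is a
strictly increasing bijection from `[0, 2)` onto `[0, ∞)` (with value `0` at `y = 0`). -/
def w (x : ℝ) : ℝ :=
  Function.invFunOn (fun y : ℝ => y / Real.log (2 / y)) (Set.Ico 0 2) x

/-! ### Policies, mean rewards and divergences -/

/-- A family of `N` conditional distributions over actions given contexts. -/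
def IsPolicyFamily {X V : Type*} [Fintype V] {N : ℕ} (π : Fin N → X → V → ℝ) : Prop :=
  ∀ i x, (∀ v, 0 ≤ π i x v) ∧ ∑ v, π i x v = 1

/-- Mean of the reward under the joint law `p(x) π(v|x) q(dy|x,v)`. -/
def meanReward {X V : Type*} [Fintype X] [Fintype V]
    (p : X → ℝ) (π : X → V → ℝ) (q : X → V → Measure ℝ) : ℝ :=
  ∑ x, p x * ∑ v, π x v * ∫ y, y ∂(q x v)

/-- The log-divergence
`1 + log (1 + ∑ₓ p(x) ∑ᵥ π(v|x) f₁(π(v|x) / π'(v|x)))` of two policies. -/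
def logDivergence {X V : Type*} [Fintype X] [Fintype V]
    (p : X → ℝ) (π π' : X → V → ℝ) : ℝ :=
  1 + Real.log (1 + ∑ x, p x * ∑ v, π x v * f₁ (π x v / π' x v))

/-! ### The environment -/

/-- The numbers known to the agent: lower bounds `pX`, `pV`, `γ` for the context probabilities,
the action probabilities and the mean rewards, and an upper bound `M` for the log-divergences. -/
structure Params where
  pX : ℝ
  pV : ℝ
  γ : ℝ
  M : ℝ

/-- The accuracy `ξ`: the positive solution of
`(ξ / pV) (1 / (pV - ξ) + 1 / (pV + ξ)) = γ pV / 2`. -/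
def Params.ξ (q : Params) : ℝ :=
  2 * (Real.sqrt (1 + q.pV ^ 4 * q.γ ^ 2 / 4) - 1) / (q.pV * q.γ)

/-- The constant `C = 32 M / (γ (1 - pV))` of the algorithm. -/
def Params.C (q : Params) : ℝ := 32 * q.M / (q.γ * (1 - q.pV))

/-- An episodic bandit problem with `N` stochastic experts and `E` episodes, over finite sets `X`
of contexts and `V` of actions. -/
structure EpisodicBandit (X V : Type*) [Fintype X] [Fintype V] (N E : ℕ) extends Params where
  /-- `policy i x v` is `πᵢ(v|x)`. -/
  policy : Fin N → X → V → ℝ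
  policy_isPolicy : IsPolicyFamily policy
  /-- Context distribution of each episode. -/
  ctxDist : Fin E → X → ℝ
  ctxDist_sum : ∀ e, ∑ x, ctxDist e x = 1
  /-- Context distribution under which the bootstrap samples are drawn. -/
  priorDist : X → ℝ
  priorDist_sum : ∑ x, priorDist x = 1
  /-- Reward distribution of each episode, given the context and the action. -/
  rewardDist : Fin E → X → V → Measure ℝ
  rewardDist_prob : ∀ e x v, IsProbabilityMeasure (rewardDist e x v)
  rewardDist_mem : ∀ e x v, ∀ᵐ y ∂(rewardDist e x v), y ∈ Set.Icc (0 : ℝ) 1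
  pX_pos : 0 < pX
  pX_le_ctx : ∀ e x, pX ≤ ctxDist e x
  pX_le_prior : ∀ x, pX ≤ priorDist x
  pV_pos : 0 < pV
  pV_le : ∀ i x v, pV ≤ policy i x v
  γ_pos : 0 < γ
  γ_le : ∀ e i, γ ≤ meanReward (ctxDist e) (policy i) (rewardDist e)
  le_M : ∀ e i j, logDivergence (ctxDist e) (policy i) (policy j) ≤ M

/-! ### The algorithm ED-UCB

`est i x v` is the estimate of `πᵢ(v|x)`. In a given episode, `k s`, `x s`, `v s`, `y s` are the
expert, the context, the action and the reward of round `s = 1, 2, …`. -/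

section Algorithm

variable {X V : Type*} [Fintype X] [Fintype V] {N : ℕ}

/-- Lower confidence value of the importance sampling ratio. -/
def ratioLow (q : Params) (est : Fin N → X → V → ℝ) (i j : Fin N) (x : X) (v : V) : ℝ :=
  est i x v / est j x v - q.ξ / (q.pV * (q.pV - q.ξ))

/-- Upper confidence value of the importance sampling ratio. -/
def ratioUp (q : Params) (est : Fin N → X → V → ℝ) (i j : Fin N) (x : X) (v : V) : ℝ :=
  est i x v / est j x v + q.ξ / (q.pV * (q.pV + q.ξ))

/-- The divergence estimate. -/
def divLow (q : Params) (est : Fin N → X → V → ℝ) (i j : Fin N) : ℝ :=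
  q.pX * ∑ x, ∑ v, (est i x v - q.ξ) * f₁ (ratioLow q est i j x v)

/-- The log-divergence estimate. -/
def MLow (q : Params) (est : Fin N → X → V → ℝ) (i j : Fin N) : ℝ :=
  1 + Real.log (1 + divLow q est i j)

/-- The normalizing factor after `t` rounds. -/
def Z (q : Params) (est : Fin N → X → V → ℝ) (k : ℕ → Fin N) (i : Fin N) (t : ℕ) : ℝ :=
  ∑ s ∈ Finset.Icc 1 t, (MLow q est i (k s))⁻¹

/-- The bias level `εᵢ(t)`. -/
def eps (q : Params) (est : Fin N → X → V → ℝ) (k : ℕ → Fin N) (i : Fin N) (t : ℕ) : ℝ :=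
  q.C * w (Real.sqrt (t * Real.log t) / Z q est k i t)

/-- The sample `(x, v)` of expert `j` is kept (not clipped) in the estimate for expert `i` with
bias level `ε`; for `ε = 0` (which occurs after the first round) the level `2 log (2 / ε)` is
infinite. -/
def Kept (q : Params) (est : Fin N → X → V → ℝ) (ε : ℝ) (i j : Fin N) (x : X) (v : V) : Prop :=
  ε = 0 ∨ ratioUp q est i j x v ≤ 2 * Real.log (2 / ε) * MLow q est i j

open Classical in
/-- The clipped importance sampling estimate of the mean of expert `i` after `t` rounds. -/
def estimate (q : Params) (est : Fin N → X → V → ℝ) (k : ℕ → Fin N) (x : ℕ → X) (v : ℕ → V)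
    (y : ℕ → ℝ) (i : Fin N) (t : ℕ) : ℝ :=
  (Z q est k i t)⁻¹ * ∑ s ∈ Finset.Icc 1 t,
    y s / MLow q est i (k s) * ratioLow q est i (k s) (x s) (v s) *
      (if Kept q est (eps q est k i t) i (k s) (x s) (v s) then 1 else 0)

open Classical in
/-- The maximal estimation error `eᵢ(t)`. -/
def maxError (q : Params) (est : Fin N → X → V → ℝ) (k : ℕ → Fin N) (i : Fin N) (t : ℕ) : ℝ :=
  ⨆ z : X × V × Fin N, (ratioUp q est i z.2.2 z.1 z.2.1 - ratioLow q est i z.2.2 z.1 z.2.1 *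
      (if Kept q est (eps q est k i t) i z.2.2 z.1 z.2.1 then 1 else 0))

/-- The index of expert `i` after `t` rounds, infinite for `t = 0`. -/
def ucb (q : Params) (est : Fin N → X → V → ℝ) (k : ℕ → Fin N) (x : ℕ → X) (v : ℕ → V)
    (y : ℕ → ℝ) (i : Fin N) (t : ℕ) : EReal :=
  if t = 0 then ⊤ else
    ((estimate q est k x v y i t + 3 / 2 * eps q est k i t + maxError q est k i t : ℝ) : EReal)

end Algorithm

namespace EpisodicBandit

variable {X V : Type*} [Fintype X] [Fintype V] {N E : ℕ}

/-! ### Gaps, burn-in times and the single-episode bound -/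

/-- Mean reward of expert `i` in episode `e`. -/
def mean (B : EpisodicBandit X V N E) (e : Fin E) (i : Fin N) : ℝ :=
  meanReward (B.ctxDist e) (B.policy i) (B.rewardDist e)

/-- Mean reward of the best expert of episode `e`. -/
def bestMean (B : EpisodicBandit X V N E) (e : Fin E) : ℝ := ⨆ i, B.mean e i

/-- Suboptimality gap of expert `i` in episode `e`. -/
def expertGap (B : EpisodicBandit X V N E) (e : Fin E) (i : Fin N) : ℝ :=
  B.bestMean e - B.mean e i

/-- `B.gap e k`, for `1 ≤ k ≤ N`, is the gap of the `k`-th best expert of episode `e`: the gaps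
are listed in increasing order, so `B.gap e 1 = 0`. -/
def gap (B : EpisodicBandit X V N E) (e : Fin E) (k : ℕ) : ℝ :=
  if h : k - 1 < N then B.expertGap e (Tuple.sort (B.expertGap e) ⟨k - 1, h⟩) else 0

/-- The first time from which on no sample is clipped, for any estimates of the experts that are
accurate up to `ξ` and any sequence of plays. -/
def Tclip (B : EpisodicBandit X V N E) : ℕ :=
  sInf {t : ℕ | 1 ≤ t ∧ ∀ t', t ≤ t' → ∀ est : Fin N → X → V → ℝ, IsPolicyFamily est →
    (∀ i x v, |B.policy i x v - est i x v| ≤ B.ξ) →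
    ∀ (k : ℕ → Fin N) (i j : Fin N) (x : X) (v : V),
      Kept B.toParams est (eps B.toParams est k i t') i j x v}

/-- `τ₁`; round `1`, where `log t = 0`, is left out. -/
def tauBest (B : EpisodicBandit X V N E) : ℕ :=
  sInf {t : ℕ | 2 ≤ t ∧ B.C * w (Real.sqrt (Real.log t / t)) ≤ B.γ}

/-- `τₖ` in episode `e`, for `k ≥ 2`; round `1`, where `log t = 0`, is left out. -/
def tau (B : EpisodicBandit X V N E) (e : Fin E) (k : ℕ) : ℕ :=
  sInf {t : ℕ | 2 ≤ t ∧
    9 * B.C ^ 2 * B.M ^ 2 * Real.log (6 * B.C / (B.gap e k - B.γ * B.pV)) ^ 2 /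
      (B.gap e k - B.γ * B.pV) ^ 2 ≤ t / Real.log t}

/-- `Tₖ` in episode `e`: `T₁ = max {τ₁, Tclip}` and `Tₖ = max {T₁, τₖ}` for `k ≥ 2`. -/
def burnIn (B : EpisodicBandit X V N E) (e : Fin E) (k : ℕ) : ℕ :=
  if k ≤ 1 then max B.tauBest B.Tclip else max (max B.tauBest B.Tclip) (B.tau e k)

/-- The single-episode regret bound `R(Δₑ)`. -/
def regretBound (B : EpisodicBandit X V N E) (e : Fin E) : ℝ :=
  Real.pi ^ 2 / 3 * ∑ k ∈ Finset.Icc 2 N, B.gap e k + B.burnIn e N * B.gap e N +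
    ∑ k ∈ Finset.Icc 2 (N - 1), ((B.burnIn e k : ℝ) - B.burnIn e (k + 1)) * B.gap e k

/-! ### Bootstrapping -/

/-- `n = 2 |V| log (2 T) / ξ²`. -/
def samplesPerContext (B : EpisodicBandit X V N E) (T : ℕ) : ℝ :=
  2 * Fintype.card V * Real.log (2 * T) / B.ξ ^ 2

/-- `A = 2 n / pX + log (|X| N T √E) / (2 pX²)`, rounded up: the number of bootstrap samples of
each expert. -/
def numSamples (B : EpisodicBandit X V N E) (T : ℕ) : ℕ :=
  ⌈2 * B.samplesPerContext T / B.pX +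
    Real.log (Fintype.card X * N * T * Real.sqrt E) / (2 * B.pX ^ 2)⌉₊

end EpisodicBandit

open Classical in
/-- The empirical policies of the samples `(sx i a, sv i a)`, `a < A`, of the experts `i`
(`0` for a context that was never seen with the expert). -/
def empirical {X V : Type*} {N A : ℕ} (sx : Fin N → Fin A → X) (sv : Fin N → Fin A → V)
    (i : Fin N) (x : X) (v : V) : ℝ :=
  ((Finset.univ.filter fun a => sx i a = x ∧ sv i a = v).card : ℝ) /
    ((Finset.univ.filter fun a => sx i a = x).card : ℝ)

/-- A run of the bootstrapped agent on a probability space: every expert is first sampled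
`B.numSamples T` times; then, in each episode, a fresh instance of ED-UCB with the empirical
policies is played for rounds `1, …, T`. Ties between maximal indices are broken in an arbitrary
(possibly randomized) way that does not look at the present round's context. -/
structure BootstrappedRun {X V : Type*} [Fintype X] [Fintype V] {N E : ℕ}
    (B : EpisodicBandit X V N E) (T : ℕ) {Ω : Type*} [MeasurableSpace Ω] (P : Measure Ω) where
  /-- Context and action of each bootstrap sample. -/
  bootCtx : Fin N → Fin (B.numSamples T) → Ω → X
  bootAct : Fin N → Fin (B.numSamples T) → Ω → V
  /-- Expert, context, action and reward of round `t` of episode `e`. -/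
  expert : Fin E → ℕ → Ω → Fin N
  ctx : Fin E → ℕ → Ω → X
  act : Fin E → ℕ → Ω → V
  reward : Fin E → ℕ → Ω → ℝ
  measurable_bootCtx : ∀ i a, Measurable[_, ⊤] (bootCtx i a)
  measurable_bootAct : ∀ i a, Measurable[_, ⊤] (bootAct i a)
  measurable_expert : ∀ e t, Measurable[_, ⊤] (expert e t)
  measurable_ctx : ∀ e t, Measurable[_, ⊤] (ctx e t)
  measurable_act : ∀ e t, Measurable[_, ⊤] (act e t)
  measurable_reward : ∀ e t, Measurable (reward e t)
  /-- The bootstrap samples are independent, those of expert `i` with law `p(x) πᵢ(v|x)`, where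
  `p` is the prior context distribution. -/
  boot_law : ∀ (x : Fin N → Fin (B.numSamples T) → X) (v : Fin N → Fin (B.numSamples T) → V),
    P {ω | ∀ i a, bootCtx i a ω = x i a ∧ bootAct i a ω = v i a} =
      ENNReal.ofReal (∏ i, ∏ a, B.priorDist (x i a) * B.policy i (x i a) (v i a))
  /-- Given the past (all bootstrap samples and all earlier rounds) and the chosen expert `j`,
  the context, action and reward of a round of episode `e` have the law
  `pₑ(x) πⱼ(v|x) qₑ(dy|x,v)`. -/
  round_law : ∀ (e : Fin E), ∀ t ∈ Finset.Icc 1 T, ∀ F : Set Ω,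
    MeasurableSet[(⨆ i, ⨆ a, (MeasurableSpace.comap (bootCtx i a) ⊤ ⊔
        MeasurableSpace.comap (bootAct i a) ⊤)) ⊔
      ⨆ e' : Fin E, ⨆ s : ℕ, ⨆ _ : 1 ≤ s ∧ ((e' < e ∧ s ≤ T) ∨ (e' = e ∧ s < t)),
        (MeasurableSpace.comap (expert e' s) ⊤ ⊔ MeasurableSpace.comap (ctx e' s) ⊤ ⊔
          MeasurableSpace.comap (act e' s) ⊤ ⊔
          MeasurableSpace.comap (reward e' s) inferInstance)] F →
    ∀ (j : Fin N) (x : X) (v : V) (S : Set ℝ), MeasurableSet S →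
      P (F ∩ {ω | expert e t ω = j ∧ ctx e t ω = x ∧ act e t ω = v ∧ reward e t ω ∈ S}) =
        P (F ∩ {ω | expert e t ω = j}) *
          (ENNReal.ofReal (B.ctxDist e x * B.policy j x v) * B.rewardDist e x v S)
  /-- In each round an expert with maximal current index is played. -/
  play_argmax : ∀ (e : Fin E) (t : ℕ), t < T → ∀ᵐ ω ∂P, ∀ i : Fin N,
    ucb B.toParams (empirical (fun i a => bootCtx i a ω) (fun i a => bootAct i a ω))
        (fun s => expert e s ω) (fun s => ctx e s ω) (fun s => act e s ω)
        (fun s => reward e s ω) i t ≤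
      ucb B.toParams (empirical (fun i a => bootCtx i a ω) (fun i a => bootAct i a ω))
        (fun s => expert e s ω) (fun s => ctx e s ω) (fun s => act e s ω)
        (fun s => reward e s ω) (expert e (t + 1) ω) t

/-- The expected cumulative regret over all episodes. -/
def BootstrappedRun.expectedRegret {X V : Type*} [Fintype X] [Fintype V] {N E : ℕ}
    {B : EpisodicBandit X V N E} {T : ℕ} {Ω : Type*} [MeasurableSpace Ω] {P : Measure Ω}
    (r : BootstrappedRun B T P) : ℝ :=
  ∫ ω, ∑ e : Fin E, ∑ t ∈ Finset.Icc 1 T, (B.bestMean e - B.mean e (r.expert e t ω)) ∂P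

end EDUCB

end

/-! It suffices to bound the regret of each episode by `B.regretBound e + 1`
(`sum_gap_mul_measure_le`). The ones add up to `E`; since the single-episode bounds are nonnegative,
`√E` and the factor `1 + 1 / (T² √E)` are simply given away.

One episode. Fix the values of all bootstrap samples. The estimates are then deterministic, and this
event belongs to the past of every round, so a martingale bound can be run inside it. Suppose the
estimates are accurate up to `ξ` and nothing is clipped any more. Then the maximal error is the
width `γ pV / 2` of the ratio interval for every expert and cancels when indices are compared.
Because the ratios are lowered, the importance sampling estimate has a bias between `-γ pV` and `0`.
That nothing is clipped bounds the range of the weights by `2 log (2 / ε)`, and Azuma's inequality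
keeps the deviation below `ε / 4` up to probability `t⁻³²`. As soon as `ε ≤ D / 2`, where `D` is the
gap minus `γ pV`, the index of the expert lies below that of a best one (`ucb_lt_ucb`,
`measure_play_suboptimal_le`). So the expert of rank `k` costs its gap during the burn-in `Tₖ` and a
summable tail afterwards. Since `Tₖ` decreases in `k ≥ 2`, summation by parts gives the stated bound
(`regretBound_eq`).

Bootstrapping. If the estimates fail with probability at most `1 / T`, failure costs an episode at
most `T · (1 / T) = 1`. A Chernoff bound with the number of visits of a context inside the exponent
(`sum_bootWeight_exp_le`) and a union bound over `N |X| |V|` entries require an exponent of at least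
`log (2 T N |X| |V|)`. The prescribed number of samples provides it at accuracy `ξ`, with two
exceptions. If `N > T²`, the claimed bound exceeds `T` and there is nothing to prove. If `log |X| >
10 log (2T)` and `ξ² < 2 pX`, only accuracy `K ξ` with `K² = log |X| / (10 log (2T))` is reached;
but then `ξ² ≤ 2 / |X|`, so that `K ξ` is tiny compared with `1 / (T log T)`
(`exists_accuracy_level`).

In this last case the clipping time says nothing directly, because it refers to accuracy `ξ`. The
estimates are contracted towards the true policies by the factor `1 / K`, which restores accuracy
`ξ`. From one round to the next, `log (2 / ε)` grows by at least `1 / (16 (t + 1))`, which outweighs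
the perturbation, so nothing is clipped from `Tclip + 1` on (`kept_succ`,
`exists_accurate_of_level`). The additional burn-in round is paid for by `π² / 3 > 3`. -/

namespace EDUCB

/-! ### The function `w` -/

lemma exists_div_log_eq {u : ℝ} (hu : 0 ≤ u) :
    ∃ y ∈ Set.Ico (0 : ℝ) 2, y / Real.log (2 / y) = u := by
  rcases hu.eq_or_lt with rfl | hu
  · exact ⟨0, by simp, by simp⟩
  set h : ℝ → ℝ := fun y => u * Real.log (2 / y) - y with hh
  -- Chosen so that `u * log (2 / y₀) = 2 > y₀`; at `y = 2` the sign of `h` is reversed.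
  set y₀ : ℝ := 2 * Real.exp (-(2 / u)) with hy₀
  have hy₀pos : 0 < y₀ := by positivity
  have hexp : Real.exp (-(2 / u)) < 1 := by
    rw [Real.exp_lt_one_iff]
    have : 0 < 2 / u := by positivity
    linarith
  have hy₀lt : y₀ < 2 := by rw [hy₀]; linarith
  have hcont : ContinuousOn h (Set.Icc y₀ 2) := by
    have hne : ∀ y ∈ Set.Icc y₀ 2, y ≠ 0 := fun y hy => (lt_of_lt_of_le hy₀pos hy.1).ne'
    refine ContinuousOn.sub (ContinuousOn.mul continuousOn_const ?_) continuousOn_id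
    refine ContinuousOn.log (ContinuousOn.div continuousOn_const continuousOn_id hne) ?_
    intro y hy
    exact div_ne_zero two_ne_zero (hne y hy)
  have hlog : Real.log (2 / y₀) = 2 / u := by
    rw [hy₀, div_mul_cancel_left₀ two_ne_zero, ← Real.exp_neg, neg_neg, Real.log_exp]
  have h0 : 0 ≤ h y₀ := by
    simp only [hh, hlog]
    rw [mul_div_cancel₀ _ hu.ne']
    linarith
  have h2 : h 2 = -2 := by simp [hh]
  have hmem : (0 : ℝ) ∈ Set.Icc (h 2) (h y₀) := ⟨by rw [h2]; norm_num, h0⟩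
  obtain ⟨y, hy, hyz⟩ := intermediate_value_Icc' hy₀lt.le hcont hmem
  have hypos : 0 < y := lt_of_lt_of_le hy₀pos hy.1
  have hy2 : y < 2 := by
    refine lt_of_le_of_ne hy.2 ?_
    rintro rfl
    rw [h2] at hyz
    norm_num at hyz
  have hl : 0 < Real.log (2 / y) := Real.log_pos (by rw [lt_div_iff₀ hypos]; linarith)
  refine ⟨y, ⟨hypos.le, hy2⟩, ?_⟩
  rw [div_eq_iff hl.ne']
  simp only [hh] at hyz
  linarith

lemma w_mem {u : ℝ} (hu : 0 ≤ u) : w u ∈ Set.Ico (0 : ℝ) 2 :=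
  Function.invFunOn_mem (exists_div_log_eq hu)

lemma w_div_log {u : ℝ} (hu : 0 ≤ u) : w u / Real.log (2 / w u) = u :=
  Function.invFunOn_eq (exists_div_log_eq hu)

lemma w_pos {u : ℝ} (hu : 0 < u) : 0 < w u := by
  refine lt_of_le_of_ne (w_mem hu.le).1 fun h => ?_
  have := w_div_log hu.le
  rw [← h] at this
  simp at this
  exact hu.ne this

lemma log_two_div_w_pos {u : ℝ} (hu : 0 < u) : 0 < Real.log (2 / w u) :=
  Real.log_pos (by rw [lt_div_iff₀ (w_pos hu)]; linarith [(w_mem hu.le).2])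

lemma w_eq {u : ℝ} (hu : 0 < u) : w u = u * Real.log (2 / w u) :=
  (div_eq_iff (log_two_div_w_pos hu).ne').1 (w_div_log hu.le)

lemma log_two_div_anti {a b : ℝ} (ha : 0 < a) (hab : a ≤ b) :
    Real.log (2 / b) ≤ Real.log (2 / a) := by
  have hb : 0 < b := ha.trans_le hab
  exact Real.log_le_log (by positivity) (by gcongr)

/-- In `w u = u * log (2 / w u)` the logarithm decreases as `w` grows, so `w` grows at most
linearly. This takes the factor in `MLow ≤ 3 / 2 * M` out of `w`. -/
lemma w_mul_le {u c : ℝ} (hu : 0 < u) (hc : 1 ≤ c) : w (c * u) ≤ c * w u := by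
  have hcu : 0 < c * u := by positivity
  by_contra! h
  have hw := w_pos hu
  have h1 : w u ≤ w (c * u) := by nlinarith
  have h2 := log_two_div_anti hw h1
  have h3 := w_eq hcu
  have h4 := w_eq hu
  have : c * u * Real.log (2 / w (c * u)) ≤ c * u * Real.log (2 / w u) := by gcongr
  have : c * u * Real.log (2 / w u) = c * w u := by rw [mul_assoc, ← h4]
  linarith

lemma w_le_of_le_div {u y : ℝ} (hu : 0 < u) (hy : 0 < y) (hy2 : y < 2)
    (h : u ≤ y / Real.log (2 / y)) : w u ≤ y := by
  by_contra! hlt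
  have h1 := log_two_div_anti hy hlt.le
  have hl : 0 < Real.log (2 / y) := Real.log_pos (by rw [lt_div_iff₀ hy]; linarith)
  rw [le_div_iff₀ hl] at h
  have h2 := w_eq hu
  have : u * Real.log (2 / w u) ≤ u * Real.log (2 / y) := by gcongr
  linarith

lemma w_mono {u u' : ℝ} (hu : 0 < u) (h : u ≤ u') : w u ≤ w u' := by
  have hu' := hu.trans_le h
  exact w_le_of_le_div hu (w_pos hu') (w_mem hu'.le).2 (by rwa [w_div_log hu'.le])

/-- If `w u` is so small that `log (2 / w u) ≥ 1`, shrinking `u` by the factor `1 - s` increases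
`log (2 / w u)` by at least `s / 2`. -/
lemma log_two_div_w_shrink {u s : ℝ} (hu : 0 < u) (hs0 : 0 ≤ s) (hs1 : s < 1)
    (hl : 1 ≤ Real.log (2 / w u)) :
    Real.log (2 / w u) + s / 2 ≤ Real.log (2 / w ((1 - s) * u)) := by
  set y := w u with hy
  have hu1 : 0 < (1 - s) * u := by have : 0 < 1 - s := by linarith
                                   positivity
  set y₁ := w ((1 - s) * u) with hy₁
  have hyp : 0 < y := w_pos hu
  have hyp₁ : 0 < y₁ := w_pos hu1
  have e : y = u * Real.log (2 / y) := w_eq hu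
  have e₁ : y₁ = (1 - s) * u * Real.log (2 / y₁) := w_eq hu1
  set a := Real.log (2 / y) with ha
  set b := Real.log (2 / y₁) with hb
  have hbpos : 0 < b := log_two_div_w_pos hu1
  have hsub : b - a = Real.log y - Real.log y₁ := by
    rw [ha, hb, Real.log_div two_ne_zero hyp.ne', Real.log_div two_ne_zero hyp₁.ne']
    ring
  by_contra! hcon
  -- Logarithms of `w u = u * log (2 / w u)` before and after shrinking give `b - a = -log (1 - s) -
  -- (log b - log a)`. The first term is at least `s`; since `a ≥ 1`, the bracket is at most `max (b
  -- - a) 0`.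
  have l1 : Real.log y = Real.log u + Real.log a := by
    conv_lhs => rw [e]
    rw [Real.log_mul hu.ne' (by linarith)]
  have l2 : Real.log y₁ = Real.log (1 - s) + Real.log u + Real.log b := by
    conv_lhs => rw [e₁]
    rw [Real.log_mul hu1.ne' hbpos.ne', Real.log_mul (by linarith) hu.ne']
  have l3 : Real.log (1 - s) ≤ -s := by
    have := Real.log_le_sub_one_of_pos (show 0 < 1 - s by linarith)
    linarith
  have hapos : 0 < a := by linarith
  have l4 : Real.log b - Real.log a ≤ b / a - 1 := by
    rw [← Real.log_div hbpos.ne' hapos.ne']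
    exact Real.log_le_sub_one_of_pos (by positivity)
  have l5 : b / a - 1 ≤ max (b - a) 0 := by
    rw [div_sub_one hapos.ne', div_le_iff₀ hapos]
    rcases le_total b a with h | h
    · have := le_max_right (b - a) 0
      nlinarith
    · have := le_max_left (b - a) 0
      nlinarith
  rcases le_total (b - a) 0 with h | h
  · rw [max_eq_right h] at l5
    linarith
  · rw [max_eq_left h] at l5
    linarith

/-! ### The accuracy `ξ` -/

/-- The range of the parameters in a nontrivial problem. -/
structure Params.Admissible (q : Params) : Prop where
  pV_pos : 0 < q.pV
  pV_le : q.pV ≤ 1 / 2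
  γ_pos : 0 < q.γ
  γ_le : q.γ ≤ 1

/-- The downward correction of the estimated ratios in `ratioLow`. -/
noncomputable def Params.slackLow (q : Params) : ℝ := q.ξ / (q.pV * (q.pV - q.ξ))

namespace Params.Admissible

/-- The defining equation with its denominators cleared; the bounds on `ξ` from above and below come
from dropping or estimating `ξ ^ 2` here. -/
lemma ξ_quadratic {q : Params} (h : q.Admissible) : 4 * q.ξ = q.γ * q.pV * (q.pV ^ 2 - q.ξ ^ 2) := by
  have hp := h.pV_pos
  have hg := h.γ_pos
  have hS : Real.sqrt (1 + q.pV ^ 4 * q.γ ^ 2 / 4) ^ 2 = 1 + q.pV ^ 4 * q.γ ^ 2 / 4 :=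
    Real.sq_sqrt (by positivity)
  unfold Params.ξ
  set S := Real.sqrt (1 + q.pV ^ 4 * q.γ ^ 2 / 4)
  field_simp
  nlinarith

lemma ξ_pos {q : Params} (h : q.Admissible) : 0 < q.ξ := by
  have hp := h.pV_pos
  have hg := h.γ_pos
  have : 1 < Real.sqrt (1 + q.pV ^ 4 * q.γ ^ 2 / 4) := by
    rw [Real.lt_sqrt (by norm_num)]
    have : 0 < q.pV ^ 4 * q.γ ^ 2 / 4 := by positivity
    linarith
  unfold Params.ξ
  have : 0 < Real.sqrt (1 + q.pV ^ 4 * q.γ ^ 2 / 4) - 1 := by linarith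
  positivity

lemma ξ_le {q : Params} (h : q.Admissible) : q.ξ ≤ q.γ * q.pV ^ 3 / 4 := by
  have hp := h.pV_pos
  have hg := h.γ_pos
  have hq := h.ξ_quadratic
  have : 0 ≤ q.γ * q.pV * q.ξ ^ 2 := by positivity
  nlinarith

lemma ξ_le_pV {q : Params} (h : q.Admissible) : q.ξ ≤ q.pV / 16 := by
  have hp := h.pV_pos
  have hg := h.γ_pos
  have h1 := h.ξ_le
  have h2 : q.pV ^ 2 ≤ (1 / 2) ^ 2 := pow_le_pow_left₀ hp.le h.pV_le 2
  have h3 : q.γ * (q.pV ^ 2 * q.pV) ≤ 1 * ((1 / 2) ^ 2 * q.pV) := by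
    gcongr
    exact h.γ_le
  nlinarith

/-- With `ξ_le` this makes `ξ` comparable to `γ pV³`; in `level_pow_le` it trades powers of `γ` and
`pV` for `ξ ^ 2`. -/
lemma le_ξ {q : Params} (h : q.Admissible) : q.γ * q.pV ^ 3 / 5 ≤ q.ξ := by
  have hp := h.pV_pos
  have hg := h.γ_pos
  have hq := h.ξ_quadratic
  have h1 : q.ξ ^ 2 ≤ (q.pV / 16) ^ 2 := pow_le_pow_left₀ h.ξ_pos.le h.ξ_le_pV 2
  have h2 : q.γ * q.pV * q.ξ ^ 2 ≤ q.γ * q.pV * (q.pV / 16) ^ 2 := by gcongr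
  have h3 : 0 < q.γ * q.pV ^ 3 := by positivity
  nlinarith

lemma slackLow_pos {q : Params} (h : q.Admissible) : 0 < q.slackLow := by
  have := h.ξ_pos
  have := h.ξ_le_pV
  have := h.pV_pos
  exact div_pos h.ξ_pos (mul_pos h.pV_pos (by linarith))

/-- The defining equation of `ξ` again: the width of the interval between `ratioLow` and `ratioUp`
does not depend on the experts, the context or the action. -/
lemma slack_add {q : Params} (h : q.Admissible) : q.slackLow + q.ξ / (q.pV * (q.pV + q.ξ)) = q.γ * q.pV / 2 := by
  have h1 := h.ξ_pos
  have h2 := h.ξ_le_pV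
  have h3 := h.pV_pos
  have hq := h.ξ_quadratic
  have h4 : q.pV - q.ξ ≠ 0 := by linarith
  have h5 : q.pV + q.ξ ≠ 0 := by linarith
  unfold Params.slackLow
  field_simp
  nlinarith

lemma slackLow_le {q : Params} (h : q.Admissible) : 2 * q.slackLow ≤ q.γ * q.pV * (8 / 15) := by
  have h1 := h.ξ_le
  have h2 := h.ξ_le_pV
  have h3 := h.pV_pos
  have h4 := h.γ_pos
  unfold Params.slackLow
  have h5 : 0 < q.pV * (q.pV - q.ξ) := mul_pos h3 (by linarith)
  rw [← mul_div_assoc, div_le_iff₀ h5]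
  have : q.γ * q.pV * (8 / 15) * (q.pV * (q.pV * (15 / 16))) ≤
      q.γ * q.pV * (8 / 15) * (q.pV * (q.pV - q.ξ)) := by
    gcongr
    linarith
  nlinarith

lemma slackLow_le_half {q : Params} (h : q.Admissible) : 2 * q.slackLow ≤ q.γ * q.pV := by
  have h1 := h.slackLow_pos
  have h2 := h.slackLow_le
  linarith [mul_pos h.γ_pos h.pV_pos]

end Params.Admissible

/-! ### The divergence function -/

/-- The tangent at `1`. It remains valid for negative arguments and reduces lower bounds for
divergences to the quadratic case. -/
lemma two_mul_sub_le_f₁ (r : ℝ) : 2 * (r - 1) ≤ f₁ r := by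
  unfold f₁
  rcases le_total 0 r with h | h
  · have := Real.add_one_le_exp (r - 1)
    nlinarith [sq_nonneg (r - 1)]
  · have h1 : Real.exp (r - 1) ≤ 1 := Real.exp_le_one_iff.2 (by linarith)
    nlinarith [Real.exp_pos (r - 1)]

/-- `r exp (r - 1)` at a point `s ≤ r + d`. -/
lemma mul_exp_sub_one_le {r s d : ℝ} (hr : 0 ≤ r) (hd : 0 ≤ d) (h : s ≤ r + d) :
    s * Real.exp (s - 1) ≤ Real.exp d * ((1 + d) * (r * Real.exp (r - 1)) + d) := by
  have h1 : Real.exp (s - 1) ≤ Real.exp d * Real.exp (r - 1) := by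
    rw [← Real.exp_add]
    exact Real.exp_le_exp.2 (by linarith)
  have h2 : Real.exp (r - 1) ≤ r * Real.exp (r - 1) + 1 := by
    rcases le_total r 1 with h | h
    · have : Real.exp (r - 1) ≤ 1 := Real.exp_le_one_iff.2 (by linarith)
      have : 0 ≤ r * Real.exp (r - 1) := by positivity
      linarith
    · nlinarith [Real.exp_pos (r - 1)]
  calc s * Real.exp (s - 1) ≤ (r + d) * (Real.exp d * Real.exp (r - 1)) := by gcongr
    _ = Real.exp d * (r * Real.exp (r - 1) + d * Real.exp (r - 1)) := by ring
    _ ≤ Real.exp d * (r * Real.exp (r - 1) + d * (r * Real.exp (r - 1) + 1)) := by gcongr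
    _ = _ := by ring

/-- Jensen's inequality for the divergence of two distributions. -/
lemma sum_mul_ratio_sub_one_nonneg {V : Type*} [Fintype V] {a b : V → ℝ} (ha : ∑ v, a v = 1)
    (hb : ∑ v, b v = 1) (hbp : ∀ v, 0 < b v) : 0 ≤ ∑ v, a v * (a v / b v - 1) := by
  have h : ∀ v, 2 * a v - b v - a v ≤ a v * (a v / b v - 1) := by
    intro v
    have hv := hbp v
    have : a v * (a v / b v - 1) - (2 * a v - b v - a v) = (a v - b v) ^ 2 / b v := by
      field_simp
      ring
    have : 0 ≤ (a v - b v) ^ 2 / b v := by positivity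
    linarith
  calc (0 : ℝ) = ∑ v, (2 * a v - b v - a v) := by
        rw [Finset.sum_sub_distrib, Finset.sum_sub_distrib, ← Finset.mul_sum, ha, hb]; norm_num
    _ ≤ _ := Finset.sum_le_sum fun v _ => h v

lemma sum_mul_f₁_nonneg {V : Type*} [Fintype V] {a b : V → ℝ} (ha : ∑ v, a v = 1)
    (hb : ∑ v, b v = 1) (ha0 : ∀ v, 0 ≤ a v) (hbp : ∀ v, 0 < b v) :
    0 ≤ ∑ v, a v * f₁ (a v / b v) := by
  have h := sum_mul_ratio_sub_one_nonneg ha hb hbp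
  have : 2 * ∑ v, a v * (a v / b v - 1) ≤ ∑ v, a v * f₁ (a v / b v) := by
    rw [Finset.mul_sum]
    refine Finset.sum_le_sum fun v _ => ?_
    have := mul_le_mul_of_nonneg_left (two_mul_sub_le_f₁ (a v / b v)) (ha0 v)
    linarith
  linarith

/-! ### Elementary bounds for the environment. -/

namespace EpisodicBandit

variable {X V : Type*} [Fintype X] [Fintype V] {N E : ℕ} (B : EpisodicBandit X V N E)

lemma policy_sum (i : Fin N) (x : X) : ∑ v, B.policy i x v = 1 := (B.policy_isPolicy i x).2

lemma policy_pos (i : Fin N) (x : X) (v : V) : 0 < B.policy i x v :=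
  B.pV_pos.trans_le (B.pV_le i x v)

lemma ctxDist_nonneg (e : Fin E) (x : X) : 0 ≤ B.ctxDist e x := B.pX_pos.le.trans (B.pX_le_ctx e x)

lemma priorDist_nonneg (x : X) : 0 ≤ B.priorDist x := B.pX_pos.le.trans (B.pX_le_prior x)

lemma card_mul_pX_le : Fintype.card X * B.pX ≤ 1 := by
  rw [← B.priorDist_sum]
  have := Finset.card_nsmul_le_sum Finset.univ B.priorDist B.pX fun x _ => B.pX_le_prior x
  simpa [nsmul_eq_mul] using this

lemma card_mul_pV_le (i : Fin N) (x : X) : Fintype.card V * B.pV ≤ 1 := by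
  rw [← B.policy_sum i x]
  have := Finset.card_nsmul_le_sum Finset.univ (B.policy i x) B.pV fun v _ => B.pV_le i x v
  simpa [nsmul_eq_mul] using this

lemma nonempty_ctx (B : EpisodicBandit X V N E) : Nonempty X := by
  by_contra h
  rw [not_nonempty_iff] at h
  have := B.priorDist_sum
  simp at this

/-- Another action carries mass at least `pV`. This is the place where two actions are needed. -/
lemma policy_le (hV : Nontrivial V) (i : Fin N) (x : X) (v : V) :
    B.policy i x v ≤ 1 - B.pV := by
  obtain ⟨v', hv'⟩ := exists_ne v
  classical
  have h := Finset.sum_le_sum_of_subset_of_nonneg (Finset.subset_univ {v, v'})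
    (f := B.policy i x) fun a _ _ => (B.policy_pos i x a).le
  rw [Finset.sum_pair hv'.symm, B.policy_sum] at h
  linarith [B.pV_le i x v']

lemma integral_reward_mem (e : Fin E) (x : X) (v : V) :
    ∫ y, y ∂(B.rewardDist e x v) ∈ Set.Icc (0 : ℝ) 1 := by
  have := B.rewardDist_prob e x v
  have hm := B.rewardDist_mem e x v
  constructor
  · exact integral_nonneg_of_ae (hm.mono fun y hy => hy.1)
  · have h := integral_mono_of_nonneg (hm.mono fun y hy => hy.1) (integrable_const (1 : ℝ))
      (hm.mono fun y hy => hy.2)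
    simpa using h

lemma mean_nonneg (e : Fin E) (i : Fin N) : 0 ≤ B.mean e i := B.γ_pos.le.trans (B.γ_le e i)

lemma mean_le_one (e : Fin E) (i : Fin N) : B.mean e i ≤ 1 := by
  rw [mean, meanReward, ← B.ctxDist_sum e]
  refine Finset.sum_le_sum fun x _ => ?_
  refine mul_le_of_le_one_right (B.ctxDist_nonneg e x) ?_
  rw [← B.policy_sum i x]
  exact Finset.sum_le_sum fun v _ =>
    mul_le_of_le_one_right (B.policy_pos i x v).le (B.integral_reward_mem e x v).2

lemma admissible (hV : Nontrivial V) (e : Fin E) (i : Fin N) : B.toParams.Admissible where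
  pV_pos := B.pV_pos
  pV_le := by
    obtain ⟨x⟩ := B.nonempty_ctx
    have := B.card_mul_pV_le i x
    have h2 : (2 : ℝ) ≤ Fintype.card V := by exact_mod_cast Fintype.one_lt_card
    nlinarith [B.pV_pos]
  γ_pos := B.γ_pos
  γ_le := (B.γ_le e i).trans (B.mean_le_one e i)

/-- The sum inside the log-divergence of experts `i` and `j`. -/
noncomputable def divergence (e : Fin E) (i j : Fin N) : ℝ :=
  ∑ x, B.ctxDist e x * ∑ v, B.policy i x v * f₁ (B.policy i x v / B.policy j x v)

lemma divergence_nonneg (e : Fin E) (i j : Fin N) : 0 ≤ B.divergence e i j :=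
  Finset.sum_nonneg fun x _ => mul_nonneg (B.ctxDist_nonneg e x) <|
    sum_mul_f₁_nonneg (B.policy_sum i x) (B.policy_sum j x) (fun v => (B.policy_pos i x v).le)
      (B.policy_pos j x)

lemma one_add_log_divergence_le (e : Fin E) (i j : Fin N) :
    1 + Real.log (1 + B.divergence e i j) ≤ B.M := B.le_M e i j

lemma one_le_M (e : Fin E) (i : Fin N) : 1 ≤ B.M := by
  have := B.one_add_log_divergence_le e i i
  have h := Real.log_nonneg (show 1 ≤ 1 + B.divergence e i i by
    linarith [B.divergence_nonneg e i i])
  linarith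

lemma le_C (hV : Nontrivial V) (e : Fin E) (i : Fin N) : 32 * B.M / B.γ ≤ B.C := by
  have h := B.admissible hV e i
  have hM := B.one_le_M e i
  have h1 := h.pV_pos
  have h2 := h.pV_le
  have h3 := h.γ_pos
  unfold Params.C
  apply div_le_div_of_nonneg_left (by linarith) (mul_pos h3 (by linarith))
  nlinarith

lemma thirty_two_le_C (hV : Nontrivial V) (e : Fin E) (i : Fin N) : 32 ≤ B.C := by
  have h := B.admissible hV e i
  have hM := B.one_le_M e i
  refine le_trans ?_ (B.le_C hV e i)
  rw [le_div_iff₀ h.γ_pos]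
  nlinarith [h.γ_le]

/-! ### Consequences of accurate estimates -/

/-- The estimates `est` are accurate up to `κ`, and `κ` exceeds `ξ` by so little that the ratio
estimates are accurate up to `B.slackLow + θ`. -/
structure Accurate (est : Fin N → X → V → ℝ) (κ θ : ℝ) : Prop where
  isPolicy : IsPolicyFamily est
  abs_sub_le : ∀ i x v, |B.policy i x v - est i x v| ≤ κ
  le_pV : κ ≤ B.pV / 10
  sub_le : κ - B.ξ ≤ θ * B.pV
  ratio_le : κ / (B.pV * (B.pV - κ)) ≤ B.slackLow + θ
  θ_nonneg : 0 ≤ θ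
  θ_le : θ ≤ 1 / 1000

namespace Accurate

variable {B} {est : Fin N → X → V → ℝ} {κ θ : ℝ}

lemma le_est (h : B.Accurate est κ θ) (i : Fin N) (x : X) (v : V) :
    B.pV * (9 / 10) ≤ est i x v := by
  have h1 := (abs_le.1 (h.abs_sub_le i x v)).2
  have h2 := h.le_pV
  have h3 := B.pV_le i x v
  linarith

lemma est_pos (h : B.Accurate est κ θ) (i : Fin N) (x : X) (v : V) : 0 < est i x v :=
  lt_of_lt_of_le (by linarith [B.pV_pos]) (h.le_est i x v)

lemma est_le_one (h : B.Accurate est κ θ) (i : Fin N) (x : X) (v : V) : est i x v ≤ 1 := by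
  rw [← (h.isPolicy i x).2]
  exact Finset.single_le_sum (fun a _ => (h.isPolicy i x).1 a) (Finset.mem_univ v)

lemma le_ratio (h : B.Accurate est κ θ) (i j : Fin N) (x : X) (v : V) :
    B.pV * (9 / 10) ≤ est i x v / est j x v := by
  rw [le_div_iff₀ (h.est_pos j x v)]
  have := h.le_est i x v
  have := mul_le_mul_of_nonneg_left (h.est_le_one j x v)
    (show 0 ≤ B.pV * (9 / 10) by linarith [B.pV_pos])
  linarith

/-- The numerator of the difference is at most `κ (πᵢ + πⱼ)`, and `pV (πᵢ + πⱼ) ≤ πⱼ` because `πᵢ ≤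
1 - pV`. For `κ = ξ` the bound is exactly `slackLow`. -/
lemma abs_ratio_sub_le' (hV : Nontrivial V) (h : B.Accurate est κ θ) (i j : Fin N) (x : X)
    (v : V) : |est i x v / est j x v - B.policy i x v / B.policy j x v| ≤
      κ / (B.pV * (B.pV - κ)) := by
  have hp := B.pV_pos
  have hκ := h.le_pV
  have hj := h.est_pos j x v
  have hpj := B.policy_pos j x v
  have hpi := B.policy_pos i x v
  have hi1 := abs_le.1 (h.abs_sub_le i x v)
  have hj1 := abs_le.1 (h.abs_sub_le j x v)
  have hκ0 : 0 ≤ κ := (abs_nonneg _).trans (h.abs_sub_le i x v)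
  have hle := B.policy_le hV i x v
  have hpv := B.pV_le j x v
  have hpk : 0 < B.pV - κ := by linarith
  have e : est i x v / est j x v - B.policy i x v / B.policy j x v =
      ((est i x v - B.policy i x v) * B.policy j x v -
        B.policy i x v * (est j x v - B.policy j x v)) / (est j x v * B.policy j x v) := by
    field_simp
    ring
  rw [e, abs_div, abs_of_pos (mul_pos hj hpj), div_le_div_iff₀ (by positivity) (by positivity)]
  have h1 : |(est i x v - B.policy i x v) * B.policy j x v -
        B.policy i x v * (est j x v - B.policy j x v)| ≤
      κ * (B.policy i x v + B.policy j x v) := by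
    rw [abs_le]
    constructor <;> nlinarith
  have h2 : (B.policy i x v + B.policy j x v) * B.pV ≤ B.policy j x v := by
    have : B.policy i x v * B.pV ≤ (1 - B.pV) * B.pV := by gcongr
    nlinarith
  calc _ ≤ κ * (B.policy i x v + B.policy j x v) * (B.pV * (B.pV - κ)) := by gcongr
    _ = κ * ((B.policy i x v + B.policy j x v) * B.pV) * (B.pV - κ) := by ring
    _ ≤ κ * B.policy j x v * est j x v := by
        gcongr
        linarith
    _ = _ := by ring

lemma abs_ratio_sub_le (hV : Nontrivial V) (h : B.Accurate est κ θ) (i j : Fin N) (x : X)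
    (v : V) : |est i x v / est j x v - B.policy i x v / B.policy j x v| ≤ B.slackLow + θ :=
  (h.abs_ratio_sub_le' hV i j x v).trans h.ratio_le

lemma ratioLow_eq (i j : Fin N) (x : X) (v : V) :
    ratioLow B.toParams est i j x v = est i x v / est j x v - B.slackLow := rfl

lemma ratioLow_pos (hq : B.toParams.Admissible) (h : B.Accurate est κ θ) (i j : Fin N) (x : X)
    (v : V) : 0 < ratioLow B.toParams est i j x v := by
  rw [ratioLow_eq]
  have h1 := h.le_ratio i j x v
  have h2 := hq.slackLow_le
  have h3 := hq.pV_pos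
  have : B.γ * B.pV ≤ 1 * B.pV := by
    gcongr
    exact hq.γ_le
  linarith

lemma ratioLow_le (hV : Nontrivial V) (h : B.Accurate est κ θ) (i j : Fin N) (x : X)
    (v : V) : ratioLow B.toParams est i j x v ≤ B.policy i x v / B.policy j x v + θ := by
  rw [ratioLow_eq]
  linarith [(abs_le.1 (h.abs_ratio_sub_le hV i j x v)).2]

lemma le_ratioLow (hV : Nontrivial V) (h : B.Accurate est κ θ) (i j : Fin N) (x : X)
    (v : V) : B.policy i x v / B.policy j x v - (2 * B.slackLow + θ) ≤
      ratioLow B.toParams est i j x v := by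
  rw [ratioLow_eq]
  linarith [(abs_le.1 (h.abs_ratio_sub_le hV i j x v)).1]

lemma ratioUp_sub_ratioLow (hq : B.toParams.Admissible) (i j : Fin N) (x : X) (v : V) :
    ratioUp B.toParams est i j x v - ratioLow B.toParams est i j x v = B.γ * B.pV / 2 := by
  have := hq.slack_add
  rw [ratioLow_eq, ratioUp]
  linarith

lemma ratioUp_le (hq : B.toParams.Admissible) (h : B.Accurate est κ θ) (i j : Fin N) (x : X)
    (v : V) : ratioUp B.toParams est i j x v ≤ 2 / B.pV := by
  have hp := hq.pV_pos
  have h1 := ratioUp_sub_ratioLow (est := est) hq i j x v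
  rw [ratioLow_eq] at h1
  have h2 : est i x v / est j x v ≤ 1 / (B.pV * (9 / 10)) := by
    have := h.le_est j x v
    have := h.est_le_one i x v
    gcongr
  have h3 : B.γ * B.pV / 2 ≤ 1 / 4 := by nlinarith [hq.γ_le, hq.pV_le, hq.γ_pos]
  have h4 := hq.slackLow_pos
  have h5 : 1 / (B.pV * (9 / 10)) = 10 / 9 / B.pV := by field_simp
  have h6 : 2 ≤ 1 / B.pV := by
    rw [le_div_iff₀ hp]; linarith [hq.pV_le]
  have h7 : 2 / B.pV = 2 * (1 / B.pV) := by ring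
  have h8 : 10 / 9 / B.pV = 10 / 9 * (1 / B.pV) := by ring
  linarith

/-- The lowered weights and ratios may make the divergence estimate negative. By the tangent bound
for `f₁` and Jensen's inequality the main term is nonnegative, and the corrections cost at most `2 ·
0.07` for `ξ` and `2 · 0.134` for the slack. The number of contexts is absorbed by `pX * |X| ≤ 1`.
-/
lemma le_one_add_divLow (hq : B.toParams.Admissible) (h : B.Accurate est κ θ) (i j : Fin N) :
    59 / 100 ≤ 1 + divLow B.toParams est i j := by
  have hp := hq.pV_pos
  have hξ := hq.ξ_pos
  have hξ1 : B.ξ / (B.pV * (9 / 10)) ≤ 7 / 100 := by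
    rw [div_le_iff₀ (by positivity)]
    have h2 : B.pV ^ 3 ≤ B.pV / 4 := by
      have : B.pV ^ 2 ≤ (1 / 2) ^ 2 := pow_le_pow_left₀ hp.le hq.pV_le 2
      nlinarith
    have := hq.ξ_le
    have := mul_le_mul hq.γ_le h2 (by positivity) zero_le_one
    linarith
  have hs : B.slackLow ≤ 134 / 1000 := by
    have := hq.slackLow_le
    have : B.γ * B.pV ≤ 1 * (1 / 2) := mul_le_mul hq.γ_le hq.pV_le hp.le zero_le_one
    linarith
  have hx : ∀ x, -(41 / 100) ≤ ∑ v, (est i x v - B.ξ) * f₁ (ratioLow B.toParams est i j x v) := by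
    intro x
    have h1 := sum_mul_ratio_sub_one_nonneg (h.isPolicy i x).2 (h.isPolicy j x).2
      (h.est_pos j x)
    have h2 : ∑ v, est i x v / est j x v ≤ 1 / (B.pV * (9 / 10)) := by
      rw [← (h.isPolicy i x).2, Finset.sum_div]
      refine Finset.sum_le_sum fun v _ => ?_
      have := h.le_est j x v
      have := (h.est_pos i x v).le
      gcongr
    have h3 : ∀ v, 2 * (est i x v * (est i x v / est j x v - 1)) -
        2 * B.ξ * (est i x v / est j x v) - 2 * B.slackLow * est i x v ≤
        (est i x v - B.ξ) * f₁ (ratioLow B.toParams est i j x v) := by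
      intro v
      have hpos : 0 ≤ est i x v - B.ξ := by
        have := h.le_est i x v
        have := hq.ξ_le_pV
        linarith
      have := mul_le_mul_of_nonneg_left
        (two_mul_sub_le_f₁ (ratioLow B.toParams est i j x v)) hpos
      rw [ratioLow_eq] at this ⊢
      have := hq.slackLow_pos
      nlinarith
    have h4 := Finset.sum_le_sum fun v (_ : v ∈ Finset.univ) => h3 v
    rw [Finset.sum_sub_distrib, Finset.sum_sub_distrib, ← Finset.mul_sum, ← Finset.mul_sum,
      ← Finset.mul_sum, (h.isPolicy i x).2] at h4
    have h5 : B.ξ * ∑ v, est i x v / est j x v ≤ B.ξ * (1 / (B.pV * (9 / 10))) := by gcongr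
    rw [mul_one_div] at h5
    linarith
  have h1 : -(41 / 100) ≤ divLow B.toParams est i j := by
    unfold divLow
    have h2 := Finset.sum_le_sum fun x (_ : x ∈ Finset.univ) => hx x
    rw [Finset.sum_const, Finset.card_univ, nsmul_eq_mul] at h2
    have h3 := mul_le_mul_of_nonneg_left h2 B.pX_pos.le
    have h4 := B.card_mul_pX_le
    nlinarith
  linarith

lemma le_MLow (hq : B.toParams.Admissible) (h : B.Accurate est κ θ) (i j : Fin N) :
    3 / 10 ≤ MLow B.toParams est i j := by
  have h1 := h.le_one_add_divLow hq i j
  have h2 := Real.one_sub_inv_le_log_of_pos (show (0 : ℝ) < 59 / 100 by norm_num)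
  have h3 := Real.log_le_log (by norm_num) h1
  unfold MLow
  norm_num at h2
  linarith

/-- Lowering undoes the estimation error up to `θ`, so the part `r exp (r - 1)` grows by little more
than a factor `1`. What is subtracted in `f₁` is understated by `ξ` per action, in total by `|V| ξ ≤
1 / 16`. -/
lemma one_add_divLow_le (hV : Nontrivial V) (hq : B.toParams.Admissible)
    (h : B.Accurate est κ θ) (e : Fin E) (i j : Fin N) :
    1 + divLow B.toParams est i j ≤ 11 / 10 * (1 + B.divergence e i j) := by
  have hp := hq.pV_pos
  have hθ := h.θ_nonneg
  have hexp : Real.exp θ ≤ 1 + 2 * θ := by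
    have := Real.abs_exp_sub_one_sub_id_le (x := θ) (by
      rw [abs_of_nonneg hθ]; linarith [h.θ_le])
    have := (abs_le.1 this).2
    nlinarith [h.θ_le]
  have hc : (1 + θ) ^ 2 * Real.exp θ ≤ 101 / 100 := by
    have h1 : (1 + θ) ^ 2 ≤ (1 + 1 / 1000) ^ 2 := by gcongr; exact h.θ_le
    have h2 : Real.exp θ ≤ 1 + 2 * (1 / 1000) := by linarith [h.θ_le]
    calc _ ≤ (1 + 1 / 1000 : ℝ) ^ 2 * (1 + 2 * (1 / 1000)) := by gcongr
      _ ≤ _ := by norm_num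
  have hc' : (1 + θ) * Real.exp θ * θ ≤ 1 / 100 := by
    have h1 : 1 + θ ≤ 1 + 1 / 1000 := by linarith [h.θ_le]
    have h2 : Real.exp θ ≤ 1 + 2 * (1 / 1000) := by linarith [h.θ_le]
    calc _ ≤ (1 + 1 / 1000 : ℝ) * (1 + 2 * (1 / 1000)) * (1 / 1000) := by gcongr; exact h.θ_le
      _ ≤ _ := by norm_num
  have hx : ∀ x, ∑ v, (est i x v - B.ξ) * f₁ (ratioLow B.toParams est i j x v) ≤
      101 / 100 * (∑ v, B.policy i x v * f₁ (B.policy i x v / B.policy j x v)) + 9 / 100 := by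
    intro x
    have hv : ∀ v, (est i x v - B.ξ) * f₁ (ratioLow B.toParams est i j x v) ≤
        101 / 100 * (B.policy i x v * f₁ (B.policy i x v / B.policy j x v)) +
          102 / 100 * B.policy i x v - est i x v + B.ξ := by
      intro v
      set r := B.policy i x v / B.policy j x v with hr
      set s := ratioLow B.toParams est i j x v with hs
      have hr0 : 0 ≤ r := (div_pos (B.policy_pos i x v) (B.policy_pos j x v)).le
      have hs0 := (h.ratioLow_pos hq i j x v).le
      have hg := mul_exp_sub_one_le hr0 hθ (h.ratioLow_le hV i j x v)
      rw [← hs] at hg hs0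
      have hpol := (B.policy_pos i x v).le
      have h1 : est i x v - B.ξ ≤ B.policy i x v * (1 + θ) := by
        have h2 := (abs_le.1 (h.abs_sub_le i x v)).1
        have h3 := h.sub_le
        have h4 : θ * B.pV ≤ θ * B.policy i x v := by gcongr; exact B.pV_le i x v
        linarith
      have hgr : 0 ≤ r * Real.exp (r - 1) := by positivity
      have h5 : (est i x v - B.ξ) * (s * Real.exp (s - 1)) ≤
          B.policy i x v * (101 / 100 * (r * Real.exp (r - 1)) + 1 / 100) := by
        calc _ ≤ B.policy i x v * (1 + θ) *
              (Real.exp θ * ((1 + θ) * (r * Real.exp (r - 1)) + θ)) := by gcongr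
          _ = B.policy i x v * ((1 + θ) ^ 2 * Real.exp θ * (r * Real.exp (r - 1)) +
              (1 + θ) * Real.exp θ * θ) := by ring
          _ ≤ _ := by gcongr
      unfold f₁
      linarith
    have h6 := Finset.sum_le_sum fun v (_ : v ∈ Finset.univ) => hv v
    rw [Finset.sum_add_distrib, Finset.sum_sub_distrib, Finset.sum_add_distrib,
      ← Finset.mul_sum, ← Finset.mul_sum, B.policy_sum, (h.isPolicy i x).2, Finset.sum_const,
      Finset.card_univ, nsmul_eq_mul] at h6
    have h7 := hq.ξ_le_pV
    have h8 := B.card_mul_pV_le i x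
    have h9 : (Fintype.card V : ℝ) * B.ξ ≤ Fintype.card V * (B.pV / 16) := by gcongr
    linarith
  have hd : divLow B.toParams est i j ≤ 101 / 100 * B.divergence e i j + 9 / 100 := by
    unfold divLow divergence
    have h1 := mul_le_mul_of_nonneg_left
      (Finset.sum_le_sum fun x (_ : x ∈ Finset.univ) => hx x) B.pX_pos.le
    rw [Finset.sum_add_distrib, Finset.sum_const, Finset.card_univ, nsmul_eq_mul,
      ← Finset.mul_sum] at h1
    -- The divergence within each context is nonnegative, so `pX` may be replaced by the true
    -- context probability.
    have h2 : B.pX * ∑ x, ∑ v, B.policy i x v * f₁ (B.policy i x v / B.policy j x v) ≤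
        ∑ x, B.ctxDist e x * ∑ v, B.policy i x v * f₁ (B.policy i x v / B.policy j x v) := by
      rw [Finset.mul_sum]
      refine Finset.sum_le_sum fun x _ => ?_
      have := sum_mul_f₁_nonneg (B.policy_sum i x) (B.policy_sum j x)
        (fun v => (B.policy_pos i x v).le) (B.policy_pos j x)
      have := B.pX_le_ctx e x
      gcongr
    have h3 := B.card_mul_pX_le
    nlinarith
  linarith [B.divergence_nonneg e i j]

lemma MLow_le (hV : Nontrivial V) (hq : B.toParams.Admissible)
    (h : B.Accurate est κ θ) (e : Fin E) (i j : Fin N) :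
    MLow B.toParams est i j ≤ 3 / 2 * B.M := by
  have h1 := h.one_add_divLow_le hV hq e i j
  have h2 := h.le_one_add_divLow hq i j
  have h3 := B.one_le_M e i
  have h4 := B.one_add_log_divergence_le e i j
  have h5 := B.divergence_nonneg e i j
  have h6 := Real.log_le_log (by linarith) h1
  rw [Real.log_mul (by norm_num) (by linarith)] at h6
  have h7 := Real.log_le_sub_one_of_pos (show (0 : ℝ) < 11 / 10 by norm_num)
  unfold MLow
  linarith

end Accurate

end EpisodicBandit

/-! ### Bounds for the normalizing factor and the bias level, uniform in the plays. -/

section Normalization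

variable {X V : Type*} [Fintype X] [Fintype V] {N : ℕ} {q : Params} {est : Fin N → X → V → ℝ}
  {i : Fin N}

lemma div_le_Z {m : ℝ} (hpos : ∀ j, 0 < MLow q est i j) (hm : ∀ j, MLow q est i j ≤ m)
    (k : ℕ → Fin N) (t : ℕ) : t / m ≤ Z q est k i t := by
  have h := Finset.card_nsmul_le_sum (Finset.Icc 1 t) (fun s => (MLow q est i (k s))⁻¹) m⁻¹
    fun s _ => inv_anti₀ (hpos _) (hm _)
  simpa [nsmul_eq_mul, Z, div_eq_mul_inv] using h

lemma Z_pos (hpos : ∀ j, 0 < MLow q est i j) (k : ℕ → Fin N) {t : ℕ} (ht : 1 ≤ t) :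
    0 < Z q est k i t :=
  Finset.sum_pos (fun s _ => inv_pos.2 (hpos _)) ⟨1, by simp [ht]⟩

lemma sqrt_mul_log_pos {t : ℕ} (ht : 2 ≤ t) : 0 < Real.sqrt (t * Real.log t) := by
  have h2 : (2 : ℝ) ≤ t := by exact_mod_cast ht
  have := Real.log_pos (show (1 : ℝ) < t by linarith)
  positivity

lemma sqrt_mul_log_eq {t : ℕ} (ht : 1 ≤ t) :
    Real.sqrt (t * Real.log t) = t * Real.sqrt (Real.log t / t) := by
  have h1 : (0 : ℝ) < t := by exact_mod_cast ht
  rw [show (t : ℝ) * Real.log t = t ^ 2 * (Real.log t / t) by field_simp,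
    Real.sqrt_mul (by positivity), Real.sqrt_sq h1.le]

lemma sqrt_div_Z_le {m : ℝ} (hpos : ∀ j, 0 < MLow q est i j) (hm : ∀ j, MLow q est i j ≤ m)
    (k : ℕ → Fin N) {t : ℕ} (ht : 1 ≤ t) :
    Real.sqrt (t * Real.log t) / Z q est k i t ≤ m * Real.sqrt (Real.log t / t) := by
  have h1 : (0 : ℝ) < t := by exact_mod_cast ht
  have hm0 : 0 < m := (hpos i).trans_le (hm i)
  have hZ := Z_pos hpos k ht
  have h2 := div_le_Z hpos hm k t
  rw [div_le_iff₀ hm0] at h2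
  rw [div_le_iff₀ hZ, sqrt_mul_log_eq ht]
  have := mul_le_mul_of_nonneg_right h2 (Real.sqrt_nonneg (Real.log t / t))
  linarith

/-- Every summand of `Z` is at least `1 / m`, whatever was played; hence the bound does not involve
the plays. -/
lemma eps_le {m : ℝ} (hC : 0 ≤ q.C) (hpos : ∀ j, 0 < MLow q est i j)
    (hm : ∀ j, MLow q est i j ≤ m) (k : ℕ → Fin N) {t : ℕ} (ht : 2 ≤ t) :
    eps q est k i t ≤ q.C * w (m * Real.sqrt (Real.log t / t)) := by
  refine mul_le_mul_of_nonneg_left (w_mono ?_ (sqrt_div_Z_le hpos hm k (by omega))) hC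
  exact div_pos (sqrt_mul_log_pos ht) (Z_pos hpos k (by omega))

lemma eps_pos (hC : 0 < q.C) (hpos : ∀ j, 0 < MLow q est i j) (k : ℕ → Fin N) {t : ℕ}
    (ht : 2 ≤ t) : 0 < eps q est k i t :=
  mul_pos hC (w_pos (div_pos (sqrt_mul_log_pos ht) (Z_pos hpos k (by omega))))

end Normalization

namespace EpisodicBandit

variable {X V : Type*} [Fintype X] [Fintype V] {N E : ℕ} (B : EpisodicBandit X V N E)

lemma accurate_of_abs_sub_le {B : EpisodicBandit X V N E} (hq : B.toParams.Admissible)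
    {est : Fin N → X → V → ℝ}
    (hp : IsPolicyFamily est) (h : ∀ i x v, |B.policy i x v - est i x v| ≤ B.ξ) :
    B.Accurate est B.ξ 0 where
  isPolicy := hp
  abs_sub_le := h
  le_pV := by linarith [hq.ξ_le_pV, hq.pV_pos]
  sub_le := by simp
  ratio_le := by simp [Params.slackLow]
  θ_nonneg := le_rfl
  θ_le := by norm_num

/-! ### The clipping time -/

/-- The defining set has to be shown nonempty, as the infimum of the empty set is `0`. The bias
level tends to `0` uniformly in plays and estimates, while `ratioUp` stays below `2 / pV`. -/
lemma Tclip_spec (hV : Nontrivial V) (e : Fin E) (i₀ : Fin N) :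
    1 ≤ B.Tclip ∧ ∀ t', B.Tclip ≤ t' → ∀ est : Fin N → X → V → ℝ, IsPolicyFamily est →
      (∀ i x v, |B.policy i x v - est i x v| ≤ B.ξ) →
      ∀ (k : ℕ → Fin N) (i j : Fin N) (x : X) (v : V),
        Kept B.toParams est (eps B.toParams est k i t') i j x v := by
  refine Nat.sInf_mem (s := {t : ℕ | 1 ≤ t ∧ ∀ t', t ≤ t' → ∀ est : Fin N → X → V → ℝ,
    IsPolicyFamily est → (∀ i x v, |B.policy i x v - est i x v| ≤ B.ξ) →
    ∀ (k : ℕ → Fin N) (i j : Fin N) (x : X) (v : V),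
      Kept B.toParams est (eps B.toParams est k i t') i j x v}) ?_
  have hq := B.admissible hV e i₀
  have hC := B.thirty_two_le_C hV e i₀
  have hM := B.one_le_M e i₀
  have hp := hq.pV_pos
  -- For `ε ≤ C y₀` the clipping level is at least `2 · (10 / (3 pV)) · (3 / 10) = 2 / pV`.
  set y₀ : ℝ := 2 / B.C * Real.exp (-(10 / (3 * B.pV))) with hy₀
  have hy₀pos : 0 < y₀ := by positivity
  have hy₀lt : y₀ < 2 := by
    have h1 : Real.exp (-(10 / (3 * B.pV))) ≤ 1 :=
      Real.exp_le_one_iff.2 (by have : 0 < 10 / (3 * B.pV) := by positivity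
                                linarith)
    have h2 : 2 / B.C ≤ 2 / 32 := by gcongr
    calc y₀ ≤ 2 / 32 * 1 := by rw [hy₀]; gcongr
      _ < 2 := by norm_num
  have hl : 0 < Real.log (2 / y₀) := Real.log_pos (by rw [lt_div_iff₀ hy₀pos]; linarith)
  have htend : Filter.Tendsto (fun t : ℕ => 3 / 2 * B.M * Real.sqrt (Real.log t / t))
      Filter.atTop (nhds 0) := by
    have h1 : Filter.Tendsto (fun x : ℝ => Real.log x / x) Filter.atTop (nhds 0) := by
      simpa using Real.isLittleO_log_id_atTop.tendsto_div_nhds_zero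
    have h2 := (h1.comp tendsto_natCast_atTop_atTop).sqrt.const_mul (3 / 2 * B.M)
    simpa using h2
  have hev := htend.eventually (gt_mem_nhds (show 0 < y₀ / Real.log (2 / y₀) by positivity))
  obtain ⟨t₀, ht₀⟩ := Filter.eventually_atTop.1 hev
  refine ⟨max t₀ 2, by simp, fun t ht est hpol hest k i j x v => ?_⟩
  have ht2 : 2 ≤ t := (le_max_right _ _).trans ht
  have hacc := accurate_of_abs_sub_le hq hpol hest
  have hpos : ∀ j, 0 < MLow B.toParams est i j := fun j => by linarith [hacc.le_MLow hq i j]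
  have heps := eps_le (by linarith) hpos (hacc.MLow_le hV hq e i) k ht2
  have heps0 := eps_pos (by linarith) hpos k ht2
  have hu : 0 < 3 / 2 * B.M * Real.sqrt (Real.log t / t) :=
    (div_pos (sqrt_mul_log_pos ht2) (Z_pos hpos k (by omega))).trans_le
      (sqrt_div_Z_le hpos (hacc.MLow_le hV hq e i) k (by omega))
  have hw := w_le_of_le_div hu hy₀pos hy₀lt (ht₀ t ((le_max_left _ _).trans ht)).le
  have h1 : eps B.toParams est k i t ≤ 2 * Real.exp (-(10 / (3 * B.pV))) := by
    refine heps.trans ?_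
    calc _ ≤ B.C * y₀ := by gcongr
      _ = _ := by rw [hy₀]; field_simp
  right
  have h2 := log_two_div_anti heps0 h1
  rw [div_mul_cancel_left₀ two_ne_zero, ← Real.exp_neg, neg_neg, Real.log_exp] at h2
  have h3 := hacc.le_MLow hq i j
  have h4 : 0 ≤ Real.log (2 / eps B.toParams est k i t) := le_trans (by positivity) h2
  calc ratioUp B.toParams est i j x v ≤ 2 / B.pV := hacc.ratioUp_le hq i j x v
    _ = 2 * (10 / (3 * B.pV)) * (3 / 10) := by field_simp
    _ ≤ _ := by gcongr

/-! ### Stability of the clipping time under perturbation of the estimates. -/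

namespace Accurate

variable {B} {est est' : Fin N → X → V → ℝ} {κ θ κ' θ' : ℝ}

/-- Split `1 + divLow` as `1 - S + G`, where `G` collects the terms `r exp (r - 1)` and `S` the
subtracted weights. `S` is the same for all policy families. `G` changes by a factor close to `1`
plus a multiple of `d S`, which is relative as well because `1 - S + G` is bounded away from `0`. -/
lemma one_add_divLow_le_exp_mul (hq : B.toParams.Admissible) (h : B.Accurate est κ θ)
    (h' : B.Accurate est' κ' θ') {d : ℝ} (hd : 0 ≤ d)
    (hest : ∀ i x v, est i x v ≤ est' i x v + d * (B.pV / 2))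
    (hratio : ∀ i j x v, est i x v / est j x v ≤ est' i x v / est' j x v + d) (i j : Fin N) :
    1 + divLow B.toParams est i j ≤ Real.exp (5 * d) * (1 + divLow B.toParams est' i j) := by
  have hp := hq.pV_pos
  set S : ℝ := B.pX * ∑ x : X, ∑ v : V, (est' i x v - B.ξ) with hS
  set G' : ℝ := B.pX * ∑ x, ∑ v, (est' i x v - B.ξ) *
    (ratioLow B.toParams est' i j x v * Real.exp (ratioLow B.toParams est' i j x v - 1)) with hG'
  have hsum : ∀ est₁ : Fin N → X → V → ℝ, IsPolicyFamily est₁ →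
      ∑ x : X, ∑ v : V, (est₁ i x v - B.ξ) =
        Fintype.card X * (1 - Fintype.card V * B.ξ) := by
    intro est₁ hpol
    simp only [Finset.sum_sub_distrib, (hpol i _).2]
    simp
    ring
  have hpos' : ∀ x v, B.pV / 2 ≤ est' i x v - B.ξ := fun x v => by
    have := h'.le_est i x v
    have := hq.ξ_le_pV
    linarith
  have hS1 : S ≤ 1 := by
    rw [hS, hsum _ h'.isPolicy]
    have h1 := B.card_mul_pX_le
    have h2 : 0 ≤ B.pX * Fintype.card X := mul_nonneg B.pX_pos.le (Nat.cast_nonneg _)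
    have h3 : 0 ≤ (Fintype.card V : ℝ) * B.ξ := mul_nonneg (Nat.cast_nonneg _) hq.ξ_pos.le
    nlinarith
  have hS0 : 0 ≤ S := mul_nonneg B.pX_pos.le <| Finset.sum_nonneg fun x _ =>
    Finset.sum_nonneg fun v _ => by linarith [hpos' x v]
  have hG0 : 0 ≤ G' := mul_nonneg B.pX_pos.le <| Finset.sum_nonneg fun x _ =>
    Finset.sum_nonneg fun v _ => by
      have := hpos' x v
      have := h'.ratioLow_pos hq i j x v
      have : 0 ≤ est' i x v - B.ξ := by linarith
      positivity
  have hdiv' : 1 + divLow B.toParams est' i j = 1 - S + G' := by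
    rw [hS, hG']
    unfold divLow f₁
    simp only [mul_sub, mul_one, Finset.sum_sub_distrib]
    ring
  have hdiv : 1 + divLow B.toParams est i j = 1 - S + B.pX * ∑ x, ∑ v, (est i x v - B.ξ) *
      (ratioLow B.toParams est i j x v * Real.exp (ratioLow B.toParams est i j x v - 1)) := by
    rw [hS, hsum _ h'.isPolicy, ← hsum _ h.isPolicy]
    unfold divLow f₁
    simp only [mul_sub, mul_one, Finset.sum_sub_distrib]
    ring
  have hterm : ∀ x v, (est i x v - B.ξ) *
      (ratioLow B.toParams est i j x v * Real.exp (ratioLow B.toParams est i j x v - 1)) ≤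
      (1 + d) ^ 2 * Real.exp d * ((est' i x v - B.ξ) *
        (ratioLow B.toParams est' i j x v * Real.exp (ratioLow B.toParams est' i j x v - 1))) +
      (1 + d) * d * Real.exp d * (est' i x v - B.ξ) := by
    intro x v
    have hl := (h.ratioLow_pos hq i j x v).le
    have hl' := (h'.ratioLow_pos hq i j x v).le
    have h1 : ratioLow B.toParams est i j x v ≤ ratioLow B.toParams est' i j x v + d := by
      rw [ratioLow_eq, ratioLow_eq]
      linarith [hratio i j x v]
    have h2 := mul_exp_sub_one_le hl' hd h1
    have h3 : est i x v - B.ξ ≤ (est' i x v - B.ξ) * (1 + d) := by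
      have := hest i x v
      have := mul_le_mul_of_nonneg_left (hpos' x v) hd
      linarith
    have h4 : 0 ≤ est' i x v - B.ξ := by linarith [hpos' x v]
    calc _ ≤ (est' i x v - B.ξ) * (1 + d) * (Real.exp d * ((1 + d) *
          (ratioLow B.toParams est' i j x v *
            Real.exp (ratioLow B.toParams est' i j x v - 1)) + d)) := by gcongr
      _ = _ := by ring
  have h5 : B.pX * ∑ x, ∑ v, (est i x v - B.ξ) *
      (ratioLow B.toParams est i j x v * Real.exp (ratioLow B.toParams est i j x v - 1)) ≤
      (1 + d) ^ 2 * Real.exp d * G' + (1 + d) * d * Real.exp d * S := by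
    have h6 := mul_le_mul_of_nonneg_left (Finset.sum_le_sum fun x (_ : x ∈ Finset.univ) =>
      Finset.sum_le_sum fun v (_ : v ∈ Finset.univ) => hterm x v) B.pX_pos.le
    simp only [Finset.sum_add_distrib, ← Finset.mul_sum] at h6
    rw [hS, hG']
    linarith
  have h7 := h'.le_one_add_divLow hq i j
  rw [hdiv'] at h7 ⊢
  rw [hdiv]
  have he1 : 1 ≤ Real.exp d := Real.one_le_exp hd
  have h8 : (1 + d) * (1 + 3 * d) * Real.exp d ≤ Real.exp (5 * d) := by
    have e1 := Real.add_one_le_exp d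
    have e2 := Real.add_one_le_exp (3 * d)
    calc _ ≤ Real.exp d * Real.exp (3 * d) * Real.exp d := by gcongr <;> linarith
      _ = _ := by rw [← Real.exp_add, ← Real.exp_add]; congr 1; ring
  have h9 : 1 ≤ (1 + d) ^ 2 * Real.exp d := by nlinarith
  have h10 : 0 ≤ (1 + d) * d * Real.exp d := by positivity
  calc _ ≤ (1 - S) + ((1 + d) ^ 2 * Real.exp d * G' + (1 + d) * d * Real.exp d * S) := by linarith
    _ ≤ (1 + d) ^ 2 * Real.exp d * (1 - S) +
        ((1 + d) ^ 2 * Real.exp d * G' + (1 + d) * d * Real.exp d * 1) := by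
        gcongr
        nlinarith
    -- `1 ≤ 2 (1 - S + G')`, from the lower bound `59 / 100`.
    _ ≤ (1 + d) ^ 2 * Real.exp d * (1 - S) +
        ((1 + d) ^ 2 * Real.exp d * G' + (1 + d) * d * Real.exp d * (2 * (1 - S + G'))) := by
        gcongr
        linarith
    _ = (1 + d) * (1 + 3 * d) * Real.exp d * (1 - S + G') := by ring
    _ ≤ _ := by gcongr

lemma MLow_le_add (hq : B.toParams.Admissible) (h : B.Accurate est κ θ)
    (h' : B.Accurate est' κ' θ') {d : ℝ} (hd : 0 ≤ d)
    (hest : ∀ i x v, est i x v ≤ est' i x v + d * (B.pV / 2))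
    (hratio : ∀ i j x v, est i x v / est j x v ≤ est' i x v / est' j x v + d) (i j : Fin N) :
    MLow B.toParams est i j ≤ (1 + 17 * d) * MLow B.toParams est' i j := by
  have h1 := h.one_add_divLow_le_exp_mul hq h' hd hest hratio i j
  have h2 := h.le_one_add_divLow hq i j
  have h3 := h'.le_one_add_divLow hq i j
  have h4 := Real.log_le_log (by linarith) h1
  rw [Real.log_mul (Real.exp_ne_zero _) (by linarith), Real.log_exp] at h4
  have h5 := h'.le_MLow hq i j
  have h6 : MLow B.toParams est i j ≤ MLow B.toParams est' i j + 5 * d := by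
    unfold MLow
    linarith
  -- `MLow ≥ 3 / 10` makes the error relative: `5 d ≤ 17 d * MLow`.
  nlinarith

end Accurate

end EpisodicBandit

/-- The quantity `√(log t / t)` decreases by a relative amount of at least `1 / (4 (t + 1))`. -/
lemma sqrt_log_div_succ_le {t : ℕ} (ht : 8 ≤ t) :
    (1 + 1 / (8 * ((t : ℝ) + 1))) * Real.sqrt (Real.log (t + 1 : ℕ) / (t + 1 : ℕ)) ≤
      (1 - 1 / (8 * ((t : ℝ) + 1))) * Real.sqrt (Real.log t / t) := by
  have ht' : (8 : ℝ) ≤ t := by exact_mod_cast ht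
  have hlog2 : 2 ≤ Real.log t := by
    have h1 : Real.log 8 ≤ Real.log t := Real.log_le_log (by norm_num) ht'
    have h2 : Real.log 8 = 3 * Real.log 2 := by
      rw [show (8 : ℝ) = 2 ^ 3 by norm_num, Real.log_pow]; norm_num
    linarith [Real.log_two_gt_d9]
  have hlog : Real.log (t + 1) ≤ Real.log t + 1 / t := by
    have h1 := Real.log_le_sub_one_of_pos (show (0 : ℝ) < (t + 1) / t by positivity)
    rw [Real.log_div (by positivity) (by positivity)] at h1
    have : ((t : ℝ) + 1) / t - 1 = 1 / t := by field_simp; ring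
    linarith
  set σ : ℝ := 1 / (8 * ((t : ℝ) + 1)) with hσ
  have hσ0 : 0 < σ := by positivity
  have hσ1 : σ * (t + 1) = 1 / 8 := by rw [hσ]; field_simp
  have hσ2 : σ ≤ 1 / 8 := by nlinarith
  push_cast
  have e1 : (1 + σ) * Real.sqrt (Real.log (t + 1) / (t + 1)) =
      Real.sqrt ((1 + σ) ^ 2 * (Real.log (t + 1) / (t + 1))) := by
    rw [Real.sqrt_mul (by positivity), Real.sqrt_sq (by positivity)]
  have e2 : (1 - σ) * Real.sqrt (Real.log t / t) =
      Real.sqrt ((1 - σ) ^ 2 * (Real.log t / t)) := by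
    rw [Real.sqrt_mul (by positivity), Real.sqrt_sq (by linarith)]
  rw [e1, e2]
  apply Real.sqrt_le_sqrt
  rw [← mul_div_assoc, ← mul_div_assoc, div_le_div_iff₀ (by positivity) (by positivity)]
  -- The increment of the logarithm contributes at most `1`, and `1 ≤ log t / 2`.
  have h1 : Real.log (t + 1) * t ≤ Real.log t * (t + 1 / 2) := by
    have h2 : (1 : ℝ) / t * t = 1 := by field_simp
    nlinarith
  calc (1 + σ) ^ 2 * Real.log (t + 1) * t = (1 + σ) ^ 2 * (Real.log (t + 1) * t) := by ring
    _ ≤ (1 + σ) ^ 2 * (Real.log t * (t + 1 / 2)) := by gcongr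
    _ = Real.log t * ((1 + σ) ^ 2 * (t + 1 / 2)) := by ring
    _ ≤ Real.log t * ((1 - σ) ^ 2 * (t + 1)) := by
        refine mul_le_mul_of_nonneg_left ?_ (by linarith)
        -- `σ` is chosen such that `4 σ (t + 1) = 1 / 2`, leaving `((1 + σ) ^ 2 - 1) / 2 ≥ 0`.
        have : (1 - σ) ^ 2 * ((t : ℝ) + 1) - (1 + σ) ^ 2 * (t + 1 / 2) =
          (1 + σ) ^ 2 / 2 - 4 * (σ * (t + 1)) := by ring
        rw [hσ1] at this
        nlinarith
    _ = _ := by ring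

namespace EpisodicBandit

variable {X V : Type*} [Fintype X] [Fintype V] {N E : ℕ} {B : EpisodicBandit X V N E}

/-- The balance for `kept_succ`: `a` and `b` are `log (2 / ε)` before and after a round, `m'` and
`m` the log-divergence estimates for the two families. The perturbation costs `34 d a` through the
factor `1 + 17 d` and `4 d` through the ratio, together at most `38 l d ≤ s`, which the gain of `s /
2` covers. -/
lemma le_two_mul_of_perturbed {a b d s l r r' m m' : ℝ} (hr : r ≤ r' + d) (hr' : r' ≤ 2 * a * m')
    (hm' : m' ≤ (1 + 17 * d) * m) (hm : 3 / 10 ≤ m) (ha : 0 ≤ a) (hal : a ≤ l) (hl : 1 ≤ l)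
    (hs : 38 * l * d ≤ s) (hd : 0 ≤ d) (hab : a + s / 2 ≤ b) : r ≤ 2 * b * m := by
  have h2 : 2 * a * m' ≤ 2 * a * ((1 + 17 * d) * m) := by gcongr
  have h4 : 34 * d * a ≤ 34 * d * l := by gcongr
  have h5 : 4 * d ≤ 4 * d * l := by nlinarith
  have h6 : d ≤ 4 * d * m := by nlinarith
  have h7 : (34 * d * a + 4 * d) * m ≤ s * m :=
    mul_le_mul_of_nonneg_right (by linarith) (by linarith)
  have h8 := mul_le_mul_of_nonneg_right hab (show 0 ≤ m by linarith)
  linarith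

/-- One round after the clipping time nothing is clipped for estimates `est` that are close to
estimates `est'` of accuracy `ξ`. -/
lemma Accurate.kept_succ (hV : Nontrivial V) (hq : B.toParams.Admissible) (e : Fin E)
    {est est' : Fin N → X → V → ℝ} {κ θ d : ℝ} (h : B.Accurate est κ θ)
    (h' : B.Accurate est' B.ξ 0) (hd : 0 ≤ d)
    (hest : ∀ i x v, |est i x v - est' i x v| ≤ d * (B.pV / 2))
    (hratio : ∀ i j x v, |est i x v / est j x v - est' i x v / est' j x v| ≤ d)
    {t : ℕ} (ht : B.Tclip ≤ t) (ht8 : 8 ≤ t)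
    (hsmall : 304 * ((t : ℝ) + 1) * Real.log (2 * ((t : ℝ) + 1)) * d ≤ 1)
    (k : ℕ → Fin N) (i j : Fin N) (x : X) (v : V) :
    Kept B.toParams est (eps B.toParams est k i (t + 1)) i j x v := by
  have ht' : (8 : ℝ) ≤ t := by exact_mod_cast ht8
  have hp := hq.pV_pos
  have hC := B.thirty_two_le_C hV e i
  have hpos : ∀ j, 0 < MLow B.toParams est i j := fun j => by linarith [h.le_MLow hq i j]
  have hpos' : ∀ j, 0 < MLow B.toParams est' i j := fun j => by linarith [h'.le_MLow hq i j]
  have : Nonempty (Fin N) := ⟨i⟩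
  obtain ⟨j', hj'⟩ := Finite.exists_max (MLow B.toParams est' i)
  set m := MLow B.toParams est' i j' with hm
  have hm0 : 3 / 10 ≤ m := h'.le_MLow hq i j'
  set σ : ℝ := 1 / (8 * ((t : ℝ) + 1)) with hσ
  have hσ0 : 0 < σ := by positivity
  have hσ1 : σ * (t + 1) = 1 / 8 := by rw [hσ]; field_simp
  have hσ2 : σ ≤ 1 / 8 := by nlinarith
  have hL1 : 1 ≤ Real.log (2 * ((t : ℝ) + 1)) := by
    rw [Real.le_log_iff_exp_le (by positivity)]
    linarith [Real.exp_one_lt_d9]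
  have hdσ : 38 * Real.log (2 * ((t : ℝ) + 1)) * d ≤ σ := by
    rw [hσ, le_div_iff₀ (by positivity)]
    linarith
  have hdσ' : 38 * d ≤ σ := le_trans (by nlinarith) hdσ
  have hup : ∀ a b : ℝ, |a - b| ≤ d → a ≤ b + d := fun a b hab => by
    linarith [(abs_le.1 hab).2]
  have hlo : ∀ a b : ℝ, |a - b| ≤ d → b ≤ a + d := fun a b hab => by
    linarith [(abs_le.1 hab).1]
  have hMle : ∀ j, MLow B.toParams est i j ≤ (1 + 17 * d) * MLow B.toParams est' i j :=
    h.MLow_le_add hq h' hd (fun i x v => by linarith [(abs_le.1 (hest i x v)).2])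
      (fun i j x v => hup _ _ (hratio i j x v)) i
  have hMle' : ∀ j, MLow B.toParams est' i j ≤ (1 + 17 * d) * MLow B.toParams est i j :=
    h'.MLow_le_add hq h hd (fun i x v => by linarith [(abs_le.1 (hest i x v)).1])
      (fun i j x v => hlo _ _ (hratio i j x v)) i
  -- the most restrictive plays for `est'`
  set u' : ℝ := m * Real.sqrt (Real.log t / t) with hu'
  have hsq0 : 0 < Real.sqrt (Real.log t / t) := by
    have : 0 < Real.log t := Real.log_pos (by linarith)
    positivity
  have hu'0 : 0 < u' := by positivity
  have heps' : eps B.toParams est' (fun _ => j') i t = B.C * w u' := by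
    unfold eps Z
    rw [Finset.sum_const, Nat.card_Icc, Nat.add_sub_cancel, nsmul_eq_mul,
      sqrt_mul_log_eq (by omega), hu']
    congr 2
    field_simp
    exact hm.symm
  -- The clipping time covers every sequence of plays, hence also the constant one that makes `Z`
  -- smallest.
  have hkept := (B.Tclip_spec hV e i).2 t ht est' h'.isPolicy h'.abs_sub_le (fun _ => j') i j x v
  rw [heps'] at hkept
  have hw' := w_pos hu'0
  have hCpos : 0 < B.C := by linarith
  have hkept' := hkept.resolve_left (by positivity)
  have hup0 : 0 < ratioUp B.toParams est' i j x v := by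
    have h1 := Accurate.ratioUp_sub_ratioLow (est := est') hq i j x v
    have h2 := h'.ratioLow_pos hq i j x v
    have h3 := mul_pos hq.γ_pos hp
    linarith
  have hlogpos : 0 < Real.log (2 / (B.C * w u')) := by
    by_contra! hcon
    have := mul_nonpos_of_nonpos_of_nonneg hcon (hpos' j).le
    linarith
  have hlogeq : ∀ y : ℝ, 0 < y → Real.log (2 / (B.C * y)) = Real.log (2 / y) - Real.log B.C := by
    intro y hy
    rw [Real.log_div two_ne_zero (by positivity), Real.log_div two_ne_zero hy.ne',
      Real.log_mul hCpos.ne' hy.ne']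
    ring
  have hlogC : 1 ≤ Real.log B.C := by
    rw [Real.le_log_iff_exp_le hCpos]
    linarith [Real.exp_one_lt_d9]
  have hL : 1 ≤ Real.log (2 / w u') := by
    rw [hlogeq _ hw'] at hlogpos
    linarith
  -- the bias level grows by at most the factor `1 - σ` in `u`
  have hZpos := Z_pos hpos k (show 1 ≤ t + 1 by omega)
  have hu0 : 0 < Real.sqrt ((t + 1 : ℕ) * Real.log (t + 1 : ℕ)) / Z B.toParams est k i (t + 1) :=
    div_pos (sqrt_mul_log_pos (by omega)) hZpos
  have hu_le : Real.sqrt ((t + 1 : ℕ) * Real.log (t + 1 : ℕ)) / Z B.toParams est k i (t + 1) ≤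
      (1 - σ) * u' := by
    refine (sqrt_div_Z_le (m := (1 + 17 * d) * m) hpos (fun j => (hMle j).trans ?_) k
      (by omega)).trans ?_
    · have := hj' j
      gcongr
    · have h1 := sqrt_log_div_succ_le ht8
      rw [← hσ] at h1
      have h2 : (1 + 17 * d) ≤ 1 + σ := by linarith
      calc _ ≤ (1 + σ) * m * Real.sqrt (Real.log (t + 1 : ℕ) / (t + 1 : ℕ)) := by gcongr
        _ = m * ((1 + σ) * Real.sqrt (Real.log (t + 1 : ℕ) / (t + 1 : ℕ))) := by ring
        _ ≤ m * ((1 - σ) * Real.sqrt (Real.log t / t)) := by gcongr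
        _ = _ := by rw [hu']; ring
  have hgrow := log_two_div_w_shrink hu'0 hσ0.le (by linarith) hL
  have hwu := w_mono hu0 hu_le
  have hwpos := w_pos hu0
  have hgrow' := hgrow.trans (log_two_div_anti hwpos hwu)
  right
  have hepsdef : eps B.toParams est k i (t + 1) = B.C *
      w (Real.sqrt ((t + 1 : ℕ) * Real.log (t + 1 : ℕ)) / Z B.toParams est k i (t + 1)) := rfl
  rw [hepsdef, hlogeq _ hwpos]
  rw [hlogeq _ hw'] at hkept' hlogpos
  set L := Real.log (2 / w u') with hLdef
  -- an upper bound for the level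
  have hLle : L - Real.log B.C ≤ Real.log (2 * ((t : ℝ) + 1)) := by
    rw [hLdef, ← hlogeq _ hw']
    apply Real.log_le_log (by positivity)
    have h1 : u' ≤ w u' := by
      rw [w_eq hu'0]
      nlinarith
    have h2 : 1 / ((t : ℝ) + 1) ≤ Real.sqrt (Real.log t / t) := by
      apply Real.le_sqrt_of_sq_le
      have h3 : 1 ≤ Real.log t := by
        rw [Real.le_log_iff_exp_le (by positivity)]
        linarith [Real.exp_one_lt_d9]
      rw [div_pow, div_le_div_iff₀ (by positivity) (by positivity)]
      nlinarith
    rw [div_le_iff₀ (by positivity)]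
    have h4 : 1 ≤ ((t : ℝ) + 1) * Real.sqrt (Real.log t / t) := by
      rw [div_le_iff₀ (by positivity)] at h2
      linarith
    have h5 : 32 * (3 / 10 * Real.sqrt (Real.log t / t)) ≤ B.C * w u' := by
      refine mul_le_mul hC (le_trans ?_ h1) (by positivity) hCpos.le
      rw [hu']
      gcongr
    nlinarith
  have h1 : ratioUp B.toParams est i j x v ≤ ratioUp B.toParams est' i j x v + d := by
    unfold ratioUp
    linarith [hup _ _ (hratio i j x v)]
  exact le_two_mul_of_perturbed h1 hkept' (hMle' j) (h.le_MLow hq i j) hlogpos.le hLle hL1 hdσ hd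
    (by linarith)

end EpisodicBandit

/-! ### Exponential moments of one round. -/

namespace EpisodicBandit

variable {X V : Type*} [Fintype X] [Fintype V] {N E : ℕ} (B : EpisodicBandit X V N E)

/-- Mean under expert `j` in episode `e` of the reward weighted by `a`. -/
noncomputable def weightedMean (e : Fin E) (j : Fin N) (a : X → V → ℝ) : ℝ :=
  ∑ x, B.ctxDist e x * ∑ v, B.policy j x v * (a x v * ∫ y, y ∂(B.rewardDist e x v))

/-- Hoeffding's lemma for the weighted reward of one round. -/
lemma lintegral_exp_round_le (e : Fin E) (j : Fin N) {a : X → V → ℝ} {b : ℝ}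
    (ha : ∀ x v, a x v ∈ Set.Icc 0 b) (s : ℝ) :
    ∑ x, ∑ v, ENNReal.ofReal (B.ctxDist e x * B.policy j x v) *
      ∫⁻ y, ENNReal.ofReal (Real.exp (s * (y * a x v - B.weightedMean e j a)))
        ∂(B.rewardDist e x v) ≤ ENNReal.ofReal (Real.exp (s ^ 2 * b ^ 2 / 8)) := by
  have hprob := B.rewardDist_prob e
  have hw : ∀ z : X × V, 0 ≤ B.ctxDist e z.1 * B.policy j z.1 z.2 := fun z =>
    mul_nonneg (B.ctxDist_nonneg e _) (B.policy_pos j _ _).le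
  -- The law of the weighted reward, a mixture over context and action. It is supported in `[0, b]`
  -- with mean `weightedMean`, so the usual Hoeffding lemma applies.
  set ν : Measure ℝ := ∑ z : X × V, ENNReal.ofReal (B.ctxDist e z.1 * B.policy j z.1 z.2) •
    (B.rewardDist e z.1 z.2).map (fun y => y * a z.1 z.2) with hν
  have hmeas : ∀ z : X × V, Measurable fun y : ℝ => y * a z.1 z.2 := fun z =>
    measurable_id.mul_const _
  have hνlint : ∀ f : ℝ → ENNReal, Measurable f → ∫⁻ y, f y ∂ν =
      ∑ x, ∑ v, ENNReal.ofReal (B.ctxDist e x * B.policy j x v) *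
        ∫⁻ y, f (y * a x v) ∂(B.rewardDist e x v) := by
    intro f hf
    rw [hν, lintegral_finsetSum_measure, Fintype.sum_prod_type]
    refine Finset.sum_congr rfl fun x _ => Finset.sum_congr rfl fun v _ => ?_
    rw [lintegral_smul_measure, lintegral_map hf (hmeas (x, v)), smul_eq_mul]
  have hsum : ∑ x, ∑ v, ENNReal.ofReal (B.ctxDist e x * B.policy j x v) = 1 := by
    rw [← Fintype.sum_prod_type' fun x v => ENNReal.ofReal (B.ctxDist e x * B.policy j x v),
      ← ENNReal.ofReal_sum_of_nonneg fun z _ => hw z, Fintype.sum_prod_type]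
    simp only [← Finset.mul_sum, B.policy_sum, mul_one, B.ctxDist_sum, ENNReal.ofReal_one]
  have hνprob : IsProbabilityMeasure ν := by
    constructor
    rw [← lintegral_one, hνlint _ measurable_const]
    simpa using hsum
  have hae : ∀ᵐ y ∂ν, y ∈ Set.Icc (0 : ℝ) b := by
    have hms : MeasurableSet {y : ℝ | y ∉ Set.Icc (0 : ℝ) b} := measurableSet_Icc.compl
    have hmi : Measurable ({y : ℝ | y ∉ Set.Icc (0 : ℝ) b}.indicator (1 : ℝ → ENNReal)) :=
      measurable_one.indicator hms
    rw [ae_iff, ← lintegral_indicator_one hms, hνlint _ hmi]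
    refine Finset.sum_eq_zero fun x _ => Finset.sum_eq_zero fun v _ => ?_
    convert mul_zero _
    refine (lintegral_congr_ae (g := fun _ => 0) ?_).trans (by simp)
    filter_upwards [B.rewardDist_mem e x v] with y hy
    have h1 := ha x v
    have : y * a x v ∈ Set.Icc 0 b := ⟨mul_nonneg hy.1 h1.1, by nlinarith [hy.1, hy.2, h1.1, h1.2]⟩
    simp only [Set.indicator_apply_eq_zero, Set.mem_ofPred_eq]
    exact fun h => absurd this h
  have hint : ∀ z : X × V, Integrable (fun y : ℝ => y) (B.rewardDist e z.1 z.2) := fun z => by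
    have := hprob z.1 z.2
    refine Integrable.of_mem_Icc 0 1 aemeasurable_id ?_
    exact B.rewardDist_mem e z.1 z.2
  have hmean : ∫ y, y ∂ν = B.weightedMean e j a := by
    rw [hν, integral_finsetSum_measure, Fintype.sum_prod_type, weightedMean]
    · refine Finset.sum_congr rfl fun x _ => ?_
      rw [Finset.mul_sum]
      refine Finset.sum_congr rfl fun v _ => ?_
      rw [integral_smul_measure, integral_map (hmeas (x, v)).aemeasurable
        measurable_id'.aestronglyMeasurable, integral_mul_const,
        ENNReal.toReal_ofReal (hw (x, v)), smul_eq_mul]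
      ring
    · intro z _
      refine Integrable.smul_measure ?_ ENNReal.ofReal_ne_top
      rw [integrable_map_measure measurable_id'.aestronglyMeasurable (hmeas z).aemeasurable]
      exact (hint z).mul_const _
  have hsub := ProbabilityTheory.hasSubgaussianMGF_of_mem_Icc (X := id) aemeasurable_id hae
  have hmgf := hsub.mgf_le s
  have hintexp := hsub.integrable_exp_mul s
  simp only [id_eq, hmean] at hmgf hintexp
  rw [← hνlint (fun y => ENNReal.ofReal (Real.exp (s * (y - B.weightedMean e j a))))
    (by fun_prop), ← ofReal_integral_eq_lintegral_ofReal hintexp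
      (Filter.Eventually.of_forall fun y => (Real.exp_pos _).le)]
  refine ENNReal.ofReal_le_ofReal (hmgf.trans_eq ?_)
  congr 1
  simp only [sub_zero, NNReal.coe_pow, NNReal.coe_div, coe_nnnorm, NNReal.coe_ofNat,
    Real.norm_eq_abs, div_pow, sq_abs]
  ring

end EpisodicBandit

/-! ### The filtration of a run and Azuma's inequality. -/

namespace BootstrappedRun

variable {X V : Type*} [Fintype X] [Fintype V] {N E : ℕ} {B : EpisodicBandit X V N E} {T : ℕ}
  {Ω : Type*} [mΩ : MeasurableSpace Ω] {P : Measure Ω} (r : BootstrappedRun B T P)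

/-- The information available before round `t` of episode `e`. -/
@[reducible] def past (e : Fin E) (t : ℕ) : MeasurableSpace Ω :=
  (⨆ i, ⨆ a, (MeasurableSpace.comap (r.bootCtx i a) ⊤ ⊔
        MeasurableSpace.comap (r.bootAct i a) ⊤)) ⊔
      ⨆ e' : Fin E, ⨆ s : ℕ, ⨆ _ : 1 ≤ s ∧ ((e' < e ∧ s ≤ T) ∨ (e' = e ∧ s < t)),
        (MeasurableSpace.comap (r.expert e' s) ⊤ ⊔ MeasurableSpace.comap (r.ctx e' s) ⊤ ⊔
          MeasurableSpace.comap (r.act e' s) ⊤ ⊔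
          MeasurableSpace.comap (r.reward e' s) inferInstance)

lemma past_le (e : Fin E) (t : ℕ) : r.past e t ≤ mΩ := by
  unfold past
  refine sup_le (iSup_le fun i => iSup_le fun a => sup_le ?_ ?_)
    (iSup_le fun e' => iSup_le fun s => iSup_le fun _ => sup_le (sup_le (sup_le ?_ ?_) ?_) ?_)
  · exact (r.measurable_bootCtx i a).comap_le
  · exact (r.measurable_bootAct i a).comap_le
  · exact (r.measurable_expert e' s).comap_le
  · exact (r.measurable_ctx e' s).comap_le
  · exact (r.measurable_act e' s).comap_le
  · exact (r.measurable_reward e' s).comap_le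

lemma round_le_past (e : Fin E) {s t : ℕ} (hs : 1 ≤ s) (hst : s < t) :
    MeasurableSpace.comap (r.expert e s) ⊤ ⊔ MeasurableSpace.comap (r.ctx e s) ⊤ ⊔
          MeasurableSpace.comap (r.act e s) ⊤ ⊔
          MeasurableSpace.comap (r.reward e s) inferInstance ≤ r.past e t := by
  unfold past
  refine le_trans ?_ le_sup_right
  exact le_iSup_of_le e (le_iSup_of_le s (le_iSup_of_le ⟨hs, Or.inr ⟨rfl, hst⟩⟩ le_rfl))

lemma measurable_bootCtx_past (e : Fin E) (t : ℕ) (i : Fin N) (a : Fin (B.numSamples T)) :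
    Measurable[r.past e t, ⊤] (r.bootCtx i a) := by
  refine Measurable.of_comap_le (le_trans ?_ le_sup_left)
  exact le_iSup_of_le i (le_iSup_of_le a le_sup_left)

lemma measurable_bootAct_past (e : Fin E) (t : ℕ) (i : Fin N) (a : Fin (B.numSamples T)) :
    Measurable[r.past e t, ⊤] (r.bootAct i a) := by
  refine Measurable.of_comap_le (le_trans ?_ le_sup_left)
  exact le_iSup_of_le i (le_iSup_of_le a le_sup_right)

lemma measurable_weighted_past (e : Fin E) {s t : ℕ} (hs : 1 ≤ s) (hst : s < t)
    {φ : Fin N → X → V → ℝ → ℝ} (hφ : ∀ j x v, Measurable (φ j x v)) :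
    Measurable[r.past e t]
      (fun ω => φ (r.expert e s ω) (r.ctx e s ω) (r.act e s ω) (r.reward e s ω)) := by
  let _ : MeasurableSpace X := ⊤
  let _ : MeasurableSpace V := ⊤
  have hle := r.round_le_past e hs hst
  have h1 : Measurable[r.past e t] (r.expert e s) := Measurable.of_comap_le
    (le_trans (le_sup_left.trans (le_sup_left.trans le_sup_left)) hle)
  have h2 : Measurable[r.past e t] (r.ctx e s) := Measurable.of_comap_le
    (le_trans (le_sup_right.trans (le_sup_left.trans le_sup_left)) hle)
  have h3 : Measurable[r.past e t] (r.act e s) := Measurable.of_comap_le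
    (le_trans (le_sup_right.trans le_sup_left) hle)
  have h4 : Measurable[r.past e t] (r.reward e s) := Measurable.of_comap_le
    (le_trans le_sup_right hle)
  have h5 : Measurable fun z : ((Fin N × X) × V) × ℝ => φ z.1.1.1 z.1.1.2 z.1.2 z.2 :=
    measurable_from_prod_countable_right fun z => hφ z.1.1 z.1.2 z.2
  exact h5.comp (((h1.prodMk h2).prodMk h3).prodMk h4)

end BootstrappedRun

namespace BootstrappedRun

variable {X V : Type*} [Fintype X] [Fintype V] {N E : ℕ} {B : EpisodicBandit X V N E} {T : ℕ}
  {Ω : Type*} [mΩ : MeasurableSpace Ω] {P : Measure Ω} (r : BootstrappedRun B T P)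

lemma measurableSet_expert (e : Fin E) (t : ℕ) (j : Fin N) :
    MeasurableSet {ω | r.expert e t ω = j} :=
  r.measurable_expert e t (show MeasurableSet[⊤] {j} from trivial)

lemma measurableSet_round (e : Fin E) (t : ℕ) (j : Fin N) (x : X) (v : V) :
    MeasurableSet {ω | r.expert e t ω = j ∧ r.ctx e t ω = x ∧ r.act e t ω = v} :=
  (r.measurableSet_expert e t j).inter
    ((r.measurable_ctx e t (show MeasurableSet[⊤] {x} from trivial)).inter
      (r.measurable_act e t (show MeasurableSet[⊤] {v} from trivial)))

/-- The law of a round, for a function of the past and of the reward. -/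
lemma setLIntegral_round [IsProbabilityMeasure P] (e : Fin E) {t : ℕ} (ht : t ∈ Finset.Icc 1 T)
    {h : Ω → ENNReal} (hh : Measurable[r.past e t] h) (j : Fin N) (x : X) (v : V)
    {φ : ℝ → ENNReal} (hφ : Measurable φ) :
    ∫⁻ ω in {ω | r.expert e t ω = j ∧ r.ctx e t ω = x ∧ r.act e t ω = v},
        h ω * φ (r.reward e t ω) ∂P =
      (∫⁻ ω in {ω | r.expert e t ω = j}, h ω ∂P) *
        (ENNReal.ofReal (B.ctxDist e x * B.policy j x v) * ∫⁻ y, φ y ∂(B.rewardDist e x v)) := by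
  have hm := r.past_le e t
  set A := {ω | r.expert e t ω = j ∧ r.ctx e t ω = x ∧ r.act e t ω = v} with hA
  have hAm : MeasurableSet A := r.measurableSet_round e t j x v
  set D := {ω | r.expert e t ω = j} with hD
  have hY := r.measurable_reward e t
  set c := ENNReal.ofReal (B.ctxDist e x * B.policy j x v) with hc
  set I := ∫⁻ y, φ y ∂(B.rewardDist e x v) with hI
  have hset : ∀ F : Set Ω, MeasurableSet[r.past e t] F →
      ∫⁻ ω in F ∩ A, φ (r.reward e t ω) ∂P = P (F ∩ D) * (c * I) := by
    intro F hF
    have hFA : MeasurableSet (F ∩ A) := (hm F hF).inter hAm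
    have hmap : (P.restrict (F ∩ A)).map (r.reward e t) =
        (P (F ∩ D) * c) • B.rewardDist e x v := by
      ext S hS
      rw [Measure.map_apply hY hS, Measure.restrict_apply (hY hS), Measure.smul_apply,
        smul_eq_mul, mul_assoc, ← r.round_law e t ht F hF j x v S hS]
      congr 1
      ext ω
      simp only [hA, Set.mem_inter_iff, Set.mem_preimage, Set.mem_ofPred_eq]
      tauto
    rw [← lintegral_map hφ hY, hmap, lintegral_smul_measure, smul_eq_mul, mul_assoc]
  have hφY : Measurable fun ω => φ (r.reward e t ω) := hφ.comp hY
  -- Since `h` is measurable with respect to the past, its integral sees only the restrictions of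
  -- the two measures to the past, and there they agree by the law of the round.
  have htrim : ((P.restrict A).withDensity fun ω => φ (r.reward e t ω)).trim hm =
      ((c * I) • P.restrict D).trim hm := by
    refine @Measure.ext _ (r.past e t) _ _ fun F hF => ?_
    rw [trim_measurableSet_eq hm hF, trim_measurableSet_eq hm hF, withDensity_apply _ (hm F hF),
      Measure.restrict_restrict (hm F hF), hset F hF, Measure.smul_apply,
      Measure.restrict_apply (hm F hF), smul_eq_mul, mul_comm]
  have h1 : ∫⁻ ω in A, h ω * φ (r.reward e t ω) ∂P =
      ∫⁻ ω, h ω ∂((P.restrict A).withDensity fun ω => φ (r.reward e t ω)) := by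
    rw [lintegral_withDensity_eq_lintegral_mul _ hφY (hh.mono hm le_rfl)]
    simp only [Pi.mul_apply, mul_comm]
  rw [h1, ← lintegral_trim hm hh, htrim, lintegral_trim hm hh, lintegral_smul_measure,
    smul_eq_mul, mul_comm]

/-- The current round can be integrated out at the price of a factor `c`. As `c` is the same for all
experts, the way the expert was chosen is irrelevant. -/
lemma lintegral_round_le [IsProbabilityMeasure P] (e : Fin E) {t : ℕ} (ht : t ∈ Finset.Icc 1 T)
    {h : Ω → ENNReal} (hh : Measurable[r.past e t] h) {φ : Fin N → X → V → ℝ → ENNReal}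
    (hφ : ∀ j x v, Measurable (φ j x v)) {c : ENNReal}
    (hc : ∀ j, ∑ x, ∑ v, ENNReal.ofReal (B.ctxDist e x * B.policy j x v) *
      ∫⁻ y, φ j x v y ∂(B.rewardDist e x v) ≤ c) :
    ∫⁻ ω, h ω * φ (r.expert e t ω) (r.ctx e t ω) (r.act e t ω) (r.reward e t ω) ∂P ≤
      (∫⁻ ω, h ω ∂P) * c := by
  have hpart : ∀ f : Ω → ENNReal, ∫⁻ ω, f ω ∂P = ∑ z : Fin N × X × V,
      ∫⁻ ω in {ω | r.expert e t ω = z.1 ∧ r.ctx e t ω = z.2.1 ∧ r.act e t ω = z.2.2}, f ω ∂P := by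
    intro f
    rw [← tsum_fintype (L := SummationFilter.unconditional _), ← lintegral_iUnion]
    · rw [← setLIntegral_univ]
      congr 2
      ext ω
      simp
    · exact fun z => r.measurableSet_round e t _ _ _
    · intro z z' hz
      refine Set.disjoint_left.2 fun ω h1 h2 => hz ?_
      obtain ⟨a1, a2, a3⟩ := h1
      obtain ⟨b1, b2, b3⟩ := h2
      exact Prod.ext (a1.symm.trans b1) (Prod.ext (a2.symm.trans b2) (a3.symm.trans b3))
  have hpartD : ∫⁻ ω, h ω ∂P = ∑ j : Fin N, ∫⁻ ω in {ω | r.expert e t ω = j}, h ω ∂P := by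
    rw [← tsum_fintype (L := SummationFilter.unconditional _), ← lintegral_iUnion]
    · rw [← setLIntegral_univ]
      congr 2
      ext ω
      simp
    · exact fun z => r.measurableSet_expert e t _
    · intro z z' hz
      exact Set.disjoint_left.2 fun ω h1 h2 => hz (h1.symm.trans h2)
  rw [hpart, hpartD, Finset.sum_mul, Fintype.sum_prod_type]
  refine Finset.sum_le_sum fun j _ => ?_
  refine le_trans (le_of_eq ?_) (mul_le_mul_right (hc j) _)
  rw [Fintype.sum_prod_type, Finset.mul_sum]
  refine Finset.sum_congr rfl fun x _ => ?_
  rw [Finset.mul_sum]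
  refine Finset.sum_congr rfl fun v _ => ?_
  rw [← r.setLIntegral_round e ht hh j x v (hφ j x v)]
  refine setLIntegral_congr_fun (r.measurableSet_round e t j x v) ?_
  rintro ω ⟨h1, h2, h3⟩
  simp only at h1 h2 h3 ⊢
  rw [h1, h2, h3]

/-- The centred sum of the weighted rewards of the first `n` rounds of episode `e`. -/
noncomputable def centredSum (e : Fin E) (a : Fin N → X → V → ℝ) (n : ℕ) (ω : Ω) : ℝ :=
  ∑ s ∈ Finset.Icc 1 n, (r.reward e s ω * a (r.expert e s ω) (r.ctx e s ω) (r.act e s ω) -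
    B.weightedMean e (r.expert e s ω) (a (r.expert e s ω)))

lemma measurable_centredSum_past (e : Fin E) (a : Fin N → X → V → ℝ) {n t : ℕ} (hn : n < t) :
    Measurable[r.past e t] (r.centredSum e a n) := by
  unfold centredSum
  refine Finset.measurable_fun_sum _ fun s hs => ?_
  rw [Finset.mem_Icc] at hs
  exact r.measurable_weighted_past e hs.1 (by omega)
    (φ := fun j x v y => y * a j x v - B.weightedMean e j (a j)) (fun j x v => by fun_prop)

/-- Induction on the rounds. The indicator of `F` is measurable with respect to every past and is
carried along, which yields a bound relative to `P F` without conditioning. -/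
lemma lintegral_exp_centredSum_le [IsProbabilityMeasure P] (e : Fin E) {F : Set Ω}
    (hF : ∀ t, MeasurableSet[r.past e t] F) {a : Fin N → X → V → ℝ} {b : ℝ}
    (ha : ∀ j x v, a j x v ∈ Set.Icc 0 b) (s : ℝ) {n : ℕ} (hn : n ≤ T) :
    ∫⁻ ω in F, ENNReal.ofReal (Real.exp (s * r.centredSum e a n ω)) ∂P ≤
      P F * ENNReal.ofReal (Real.exp (n * (s ^ 2 * b ^ 2 / 8))) := by
  have hFm : MeasurableSet F := r.past_le e 0 F (hF 0)
  induction n with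
  | zero => simp [centredSum]
  | succ n ih =>
    have hmeas : Measurable[r.past e (n + 1)] (F.indicator fun ω =>
        ENNReal.ofReal (Real.exp (s * r.centredSum e a n ω))) := by
      refine Measurable.indicator ?_ (hF _)
      exact ENNReal.measurable_ofReal.comp (Real.measurable_exp.comp
        ((r.measurable_centredSum_past e a (Nat.lt_succ_self n)).const_mul s))
    have h := r.lintegral_round_le e (t := n + 1) (by simp; omega) hmeas
      (φ := fun j x v y => ENNReal.ofReal (Real.exp (s * (y * a j x v -
        B.weightedMean e j (a j))))) (fun j x v => by fun_prop)
      (fun j => B.lintegral_exp_round_le e j (ha j) s)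
    rw [lintegral_indicator hFm] at h
    calc _ = ∫⁻ ω, (F.indicator fun ω =>
          ENNReal.ofReal (Real.exp (s * r.centredSum e a n ω))) ω *
          ENNReal.ofReal (Real.exp (s * (r.reward e (n + 1) ω *
            a (r.expert e (n + 1) ω) (r.ctx e (n + 1) ω) (r.act e (n + 1) ω) -
            B.weightedMean e (r.expert e (n + 1) ω) (a (r.expert e (n + 1) ω))))) ∂P := by
          rw [← lintegral_indicator hFm]
          refine lintegral_congr fun ω => ?_
          by_cases hω : ω ∈ F
          · rw [Set.indicator_of_mem hω, Set.indicator_of_mem hω,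
              ← ENNReal.ofReal_mul (Real.exp_pos _).le, ← Real.exp_add, centredSum,
              Finset.sum_Icc_succ_top (by omega)]
            congr 2
            rw [centredSum]
            ring
          · rw [Set.indicator_of_notMem hω, Set.indicator_of_notMem hω, zero_mul]
      _ ≤ _ := h
      _ ≤ P F * ENNReal.ofReal (Real.exp (n * (s ^ 2 * b ^ 2 / 8))) *
          ENNReal.ofReal (Real.exp (s ^ 2 * b ^ 2 / 8)) := by
          gcongr
          exact ih (by omega)
      _ = _ := by
          rw [mul_assoc, ← ENNReal.ofReal_mul (Real.exp_pos _).le, ← Real.exp_add]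
          congr 3
          push_cast
          ring

/-- Azuma's inequality for the weighted rewards of an episode; `σ = ±1` selects the tail. -/
lemma measure_centredSum_ge_le [IsProbabilityMeasure P] (e : Fin E) {F : Set Ω}
    (hF : ∀ t, MeasurableSet[r.past e t] F) {a : Fin N → X → V → ℝ} {b : ℝ} (hb : 0 < b)
    (ha : ∀ j x v, a j x v ∈ Set.Icc 0 b) {σ : ℝ} (hσ : σ ^ 2 = 1) {n : ℕ} (hn1 : 1 ≤ n)
    (hn : n ≤ T) {l : ℝ} (hl : 0 ≤ l) :
    P (F ∩ {ω | l ≤ σ * r.centredSum e a n ω}) ≤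
      P F * ENNReal.ofReal (Real.exp (-(2 * l ^ 2 / (n * b ^ 2)))) := by
  have hn0 : (0 : ℝ) < n := by exact_mod_cast hn1
  have hFm : MeasurableSet F := r.past_le e 0 F (hF 0)
  -- The minimizer of `-s l + n s² b² / 8`.
  set s : ℝ := 4 * l / (n * b ^ 2) with hs
  have hs0 : 0 ≤ s := by positivity
  have hmeas : Measurable fun ω => ENNReal.ofReal (Real.exp (s * σ * r.centredSum e a n ω)) :=
    ENNReal.measurable_ofReal.comp (Real.measurable_exp.comp
      (((r.measurable_centredSum_past e a (Nat.lt_succ_self n)).mono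
        (r.past_le e _) le_rfl).const_mul _))
  have h1 := r.lintegral_exp_centredSum_le e hF ha (s * σ) hn
  have h2 := mul_meas_ge_le_lintegral₀ (μ := P.restrict F) hmeas.aemeasurable
    (ENNReal.ofReal (Real.exp (s * l)))
  have h3 : P (F ∩ {ω | l ≤ σ * r.centredSum e a n ω}) ≤
      P.restrict F {ω | ENNReal.ofReal (Real.exp (s * l)) ≤
        ENNReal.ofReal (Real.exp (s * σ * r.centredSum e a n ω))} := by
    rw [Measure.restrict_apply' hFm, Set.inter_comm]
    refine measure_mono (Set.inter_subset_inter_left _ fun ω hω => ?_)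
    refine ENNReal.ofReal_le_ofReal (Real.exp_le_exp.2 ?_)
    rw [mul_assoc]
    exact mul_le_mul_of_nonneg_left hω hs0
  have h4 := h2.trans h1
  have h5 : P (F ∩ {ω | l ≤ σ * r.centredSum e a n ω}) * ENNReal.ofReal (Real.exp (s * l)) ≤
      P F * ENNReal.ofReal (Real.exp (n * ((s * σ) ^ 2 * b ^ 2 / 8))) := by
    refine le_trans ?_ h4
    rw [mul_comm]
    gcongr
  calc _ = P (F ∩ {ω | l ≤ σ * r.centredSum e a n ω}) * ENNReal.ofReal (Real.exp (s * l)) *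
        ENNReal.ofReal (Real.exp (-(s * l))) := by
        rw [mul_assoc, ← ENNReal.ofReal_mul (Real.exp_pos _).le, ← Real.exp_add]
        simp
    _ ≤ P F * ENNReal.ofReal (Real.exp (n * ((s * σ) ^ 2 * b ^ 2 / 8))) *
        ENNReal.ofReal (Real.exp (-(s * l))) := by gcongr
    _ = _ := by
        rw [mul_assoc, ← ENNReal.ofReal_mul (Real.exp_pos _).le, ← Real.exp_add, mul_pow, hσ, hs]
        congr 3
        field_simp
        ring

end BootstrappedRun

/-! ### Bias of the estimates and comparison of the indices. -/

namespace EpisodicBandit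

variable {X V : Type*} [Fintype X] [Fintype V] {N E : ℕ} {B : EpisodicBandit X V N E}

/-- The weights with which the rewards enter the estimate for expert `i`. -/
noncomputable def estimateWeight (B : EpisodicBandit X V N E) (est : Fin N → X → V → ℝ)
    (i j : Fin N) (x : X) (v : V) : ℝ :=
  ratioLow B.toParams est i j x v / MLow B.toParams est i j

namespace Accurate

variable {est : Fin N → X → V → ℝ} {κ θ : ℝ}

/-- Importance sampling: the exact ratios turn the law of expert `j` into that of expert `i`. -/
lemma sum_policy_mul_ratio (e : Fin E) (i j : Fin N) :
    ∑ x, B.ctxDist e x * ∑ v, B.policy j x v *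
      (B.policy i x v / B.policy j x v * ∫ y, y ∂(B.rewardDist e x v)) = B.mean e i := by
  unfold mean meanReward
  refine Finset.sum_congr rfl fun x _ => ?_
  congr 1
  refine Finset.sum_congr rfl fun v _ => ?_
  have := (B.policy_pos j x v).ne'
  field_simp

lemma weightedMean_estimateWeight (e : Fin E) (i j : Fin N) :
    B.weightedMean e j (B.estimateWeight est i j) = (MLow B.toParams est i j)⁻¹ *
      ∑ x, B.ctxDist e x * ∑ v, B.policy j x v *
        (ratioLow B.toParams est i j x v * ∫ y, y ∂(B.rewardDist e x v)) := by
  unfold weightedMean estimateWeight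
  simp only [Finset.mul_sum]
  refine Finset.sum_congr rfl fun x _ => Finset.sum_congr rfl fun v _ => ?_
  ring

/-- The bias is one-sided up to `θ`: lowering the ratios compensates overestimation here, and
doubles the possible underestimation in `le_weightedMean`. -/
lemma weightedMean_le (hV : Nontrivial V) (hq : B.toParams.Admissible)
    (h : B.Accurate est κ θ) (e : Fin E) (i j : Fin N) :
    B.weightedMean e j (B.estimateWeight est i j) ≤
      (MLow B.toParams est i j)⁻¹ * (B.mean e i + θ) := by
  have hM := h.le_MLow hq i j
  rw [weightedMean_estimateWeight]
  refine mul_le_mul_of_nonneg_left ?_ (by positivity)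
  have hθ := mul_le_mul_of_nonneg_left (B.mean_le_one e j) h.θ_nonneg
  have h1 : ∑ x, B.ctxDist e x * ∑ v, B.policy j x v *
        (ratioLow B.toParams est i j x v * ∫ y, y ∂(B.rewardDist e x v)) ≤
      B.mean e i + θ * B.mean e j := by
    rw [← sum_policy_mul_ratio e i j]
    unfold mean meanReward
    rw [Finset.mul_sum, ← Finset.sum_add_distrib]
    refine Finset.sum_le_sum fun x _ => ?_
    rw [mul_left_comm, ← mul_add, Finset.mul_sum _ _ θ, ← Finset.sum_add_distrib]
    refine mul_le_mul_of_nonneg_left ?_ (B.ctxDist_nonneg e x)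
    refine Finset.sum_le_sum fun v _ => ?_
    rw [mul_left_comm θ, ← mul_add, ← add_mul]
    refine mul_le_mul_of_nonneg_left ?_ (B.policy_pos j x v).le
    exact mul_le_mul_of_nonneg_right (h.ratioLow_le hV i j x v) (B.integral_reward_mem e x v).1
  linarith

lemma le_weightedMean (hV : Nontrivial V) (hq : B.toParams.Admissible)
    (h : B.Accurate est κ θ) (e : Fin E) (i j : Fin N) :
    (MLow B.toParams est i j)⁻¹ * (B.mean e i - (2 * B.slackLow + θ)) ≤
      B.weightedMean e j (B.estimateWeight est i j) := by
  have hM := h.le_MLow hq i j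
  rw [weightedMean_estimateWeight]
  refine mul_le_mul_of_nonneg_left ?_ (by positivity)
  have hc : 0 ≤ 2 * B.slackLow + θ := by linarith [hq.slackLow_pos, h.θ_nonneg]
  have hθ := mul_le_mul_of_nonneg_left (B.mean_le_one e j) hc
  have h1 : B.mean e i - (2 * B.slackLow + θ) * B.mean e j ≤
      ∑ x, B.ctxDist e x * ∑ v, B.policy j x v *
        (ratioLow B.toParams est i j x v * ∫ y, y ∂(B.rewardDist e x v)) := by
    rw [← sum_policy_mul_ratio e i j]
    unfold mean meanReward
    rw [Finset.mul_sum, ← Finset.sum_sub_distrib]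
    refine Finset.sum_le_sum fun x _ => ?_
    rw [mul_left_comm, ← mul_sub, Finset.mul_sum, ← Finset.sum_sub_distrib]
    refine mul_le_mul_of_nonneg_left ?_ (B.ctxDist_nonneg e x)
    refine Finset.sum_le_sum fun v _ => ?_
    rw [mul_left_comm (2 * B.slackLow + θ), ← mul_sub, ← sub_mul]
    refine mul_le_mul_of_nonneg_left ?_ (B.policy_pos j x v).le
    exact mul_le_mul_of_nonneg_right (h.le_ratioLow hV i j x v) (B.integral_reward_mem e x v).1
  linarith

/-- Without clipping the error is the width of the ratio interval, the same for all experts; it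
drops out of comparisons. -/
lemma maxError_eq (hq : B.toParams.Admissible) (k : ℕ → Fin N) (i : Fin N) (t : ℕ)
    (hX : Nonempty X) (hV : Nontrivial V)
    (hkept : ∀ j x v, Kept B.toParams est (eps B.toParams est k i t) i j x v) :
    maxError B.toParams est k i t = B.γ * B.pV / 2 := by
  have : Nonempty (Fin N) := ⟨i⟩
  unfold maxError
  simp only [if_pos (hkept _ _ _), mul_one, ratioUp_sub_ratioLow hq]
  exact ciSup_const

lemma estimate_eq (k : ℕ → Fin N) (x : ℕ → X) (v : ℕ → V) (y : ℕ → ℝ) (i : Fin N) (t : ℕ)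
    (hkept : ∀ j x v, Kept B.toParams est (eps B.toParams est k i t) i j x v) :
    estimate B.toParams est k x v y i t = (Z B.toParams est k i t)⁻¹ *
      ∑ s ∈ Finset.Icc 1 t, y s * B.estimateWeight est i (k s) (x s) (v s) := by
  unfold estimate estimateWeight
  simp only [if_pos (hkept _ _ _), mul_one]
  congr 1
  refine Finset.sum_congr rfl fun s _ => ?_
  ring

/-- The range of the weights is controlled by the clipping level. -/
lemma exists_weight_bound (hq : B.toParams.Admissible) (h : B.Accurate est κ θ) (i : Fin N)
    (hX : Nonempty X) (hV : Nontrivial V) :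
    ∃ b : ℝ, 0 < b ∧ (∀ j x v, B.estimateWeight est i j x v ∈ Set.Icc 0 b) ∧
      ∀ ε : ℝ, ε ≠ 0 → (∀ j x v, Kept B.toParams est ε i j x v) → b ≤ 2 * Real.log (2 / ε) := by
  have : Nonempty (Fin N) := ⟨i⟩
  obtain ⟨z, hz⟩ := Finite.exists_max fun z : Fin N × X × V =>
    ratioUp B.toParams est i z.1 z.2.1 z.2.2 / MLow B.toParams est i z.1
  have hM : ∀ j, 0 < MLow B.toParams est i j := fun j => by linarith [h.le_MLow hq i j]
  have hlow := h.ratioLow_pos hq i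
  have hle : ∀ j x v, ratioLow B.toParams est i j x v ≤ ratioUp B.toParams est i j x v := by
    intro j x v
    have h1 := ratioUp_sub_ratioLow (est := est) hq i j x v
    have h2 := mul_pos hq.γ_pos hq.pV_pos
    linarith
  refine ⟨_, div_pos ((hlow z.1 z.2.1 z.2.2).trans_le (hle _ _ _)) (hM z.1), fun j x v => ⟨?_, ?_⟩,
    fun ε hε hkept => ?_⟩
  · exact (div_pos (hlow j x v) (hM j)).le
  · refine le_trans ?_ (hz (j, x, v))
    exact div_le_div_of_nonneg_right (hle j x v) (hM j).le
  · rw [div_le_iff₀ (hM _)]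
    exact (hkept _ _ _).resolve_left hε

/-- With `u = √(t log t) / Z` and `w u ≤ ε`, the equation for `w` gives `w u = u log (2 / w u) ≥ u b
/ 2`. Since `C ≥ 32`, it follows that `ε = C w u ≥ 16 u b`: the deviation allowed by Azuma's
inequality is at most `ε / 4` after normalization. -/
lemma le_Z_mul_eps (hV : Nontrivial V) (hq : B.toParams.Admissible) (e : Fin E)
    (h : B.Accurate est κ θ) {i : Fin N} {b : ℝ} (k : ℕ → Fin N) {t : ℕ} (ht : 2 ≤ t)
    (hb0 : 0 < b) (hb : b ≤ 2 * Real.log (2 / eps B.toParams est k i t)) :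
    4 * b * Real.sqrt (t * Real.log t) ≤ Z B.toParams est k i t * (eps B.toParams est k i t / 4) := by
  have hC := B.thirty_two_le_C hV e i
  have hpos : ∀ j, 0 < MLow B.toParams est i j := fun j => by linarith [h.le_MLow hq i j]
  have hZ := Z_pos hpos k (show 1 ≤ t by omega)
  have hs := sqrt_mul_log_pos ht
  have hu := div_pos hs hZ
  have hw := w_pos hu
  have hwe := w_eq hu
  unfold eps at hb ⊢
  set u := Real.sqrt (t * Real.log t) / Z B.toParams est k i t with hudef
  have hle : w u ≤ B.C * w u := by nlinarith
  have h1 := log_two_div_anti hw hle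
  have h2 : b / 2 ≤ Real.log (2 / w u) := by linarith
  have hsu : Real.sqrt (t * Real.log t) = Z B.toParams est k i t * u := by
    rw [hudef]; field_simp
  have h3 : u * (b / 2) ≤ w u := by
    rw [hwe]
    gcongr
  have h4 : 32 * (u * (b / 2)) ≤ B.C * w u := by gcongr
  rw [hsu]
  calc _ = Z B.toParams est k i t * (32 * (u * (b / 2)) / 4) := by ring
    _ ≤ _ := by gcongr

/-- The threshold in `tau` says that `w (M √(log t / t)) ≤ D / (3 C)`. Replacing `M` by `3 M / 2`,
the bound for the estimates, costs a factor `3 / 2`. -/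
lemma eps_le_half (hV : Nontrivial V) (hq : B.toParams.Admissible) (e : Fin E)
    (h : B.Accurate est κ θ) (i : Fin N) (k : ℕ → Fin N) {t : ℕ} (ht : 2 ≤ t) {D : ℝ}
    (hD : 0 < D) (hD1 : D ≤ 1)
    (htau : 9 * B.C ^ 2 * B.M ^ 2 * Real.log (6 * B.C / D) ^ 2 / D ^ 2 ≤ t / Real.log t) :
    eps B.toParams est k i t ≤ D / 2 := by
  have hC := B.thirty_two_le_C hV e i
  have hM := B.one_le_M e i
  have ht' : (2 : ℝ) ≤ t := by exact_mod_cast ht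
  have hlog : 0 < Real.log t := Real.log_pos (by linarith)
  have hpos : ∀ j, 0 < MLow B.toParams est i j := fun j => by linarith [h.le_MLow hq i j]
  have h1 := eps_le (by linarith) hpos (h.MLow_le hV hq e i) k ht
  set u := B.M * Real.sqrt (Real.log t / t) with hu
  have hu0 : 0 < u := by positivity
  have h2 : w (3 / 2 * B.M * Real.sqrt (Real.log t / t)) ≤ 3 / 2 * w u := by
    rw [mul_assoc]
    exact w_mul_le hu0 (by norm_num)
  set y := D / (3 * B.C) with hy
  have hy0 : 0 < y := by positivity
  have hy2 : y < 2 := by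
    rw [hy, div_lt_iff₀ (by positivity)]
    linarith
  have hyl : 2 / y = 6 * B.C / D := by
    rw [hy]
    field_simp
    norm_num
  have hl : 0 < Real.log (6 * B.C / D) := Real.log_pos (by rw [lt_div_iff₀ hD]; linarith)
  have h3 : w u ≤ y := by
    refine w_le_of_le_div hu0 hy0 hy2 ?_
    rw [hyl, le_div_iff₀ hl]
    refine abs_le_of_sq_le_sq' ?_ hy0.le |>.2
    rw [hu, mul_pow, mul_pow, Real.sq_sqrt (by positivity), hy, div_pow]
    rw [div_le_div_iff₀ (by positivity) hlog] at htau
    rw [← mul_div_assoc, div_mul_eq_mul_div, div_le_div_iff₀ (by positivity) (by positivity)]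
    calc _ = 9 * B.C ^ 2 * B.M ^ 2 * Real.log (6 * B.C / D) ^ 2 * Real.log t := by ring
      _ ≤ _ := by linarith
  have hCpos : 0 < B.C := by linarith
  calc _ ≤ B.C * (3 / 2 * y) := h1.trans (by
        refine mul_le_mul_of_nonneg_left (h2.trans ?_) hCpos.le
        linarith)
    _ = D / 2 := by rw [hy]; field_simp

/-- If the centred sums of the experts `i` and `i'` do not deviate and `i` is worse than `i'` by
more than `γ pV`, the index of `i` is smaller after the burn-in. -/
lemma ucb_lt_ucb (hV : Nontrivial V) (hq : B.toParams.Admissible) (e : Fin E)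
    (h : B.Accurate est κ θ) (i i' : Fin N) (k : ℕ → Fin N) (x : ℕ → X) (v : ℕ → V) (y : ℕ → ℝ)
    {t : ℕ} (ht : 2 ≤ t) {D : ℝ} (hDdef : D = B.mean e i' - B.mean e i - B.γ * B.pV)
    (hD : 0 < D)
    (htau : 9 * B.C ^ 2 * B.M ^ 2 * Real.log (6 * B.C / D) ^ 2 / D ^ 2 ≤ t / Real.log t)
    (hθ : 16 * θ < D)
    (hkept : ∀ i j x v, Kept B.toParams est (eps B.toParams est k i t) i j x v)
    {b b' : ℝ} (hb0 : 0 < b) (hb0' : 0 < b')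
    (hb : b ≤ 2 * Real.log (2 / eps B.toParams est k i t))
    (hb' : b' ≤ 2 * Real.log (2 / eps B.toParams est k i' t))
    (hdev : ∑ s ∈ Finset.Icc 1 t, (y s * B.estimateWeight est i (k s) (x s) (v s) -
      B.weightedMean e (k s) (B.estimateWeight est i (k s))) < 4 * b * Real.sqrt (t * Real.log t))
    (hdev' : -(4 * b' * Real.sqrt (t * Real.log t)) <
      ∑ s ∈ Finset.Icc 1 t, (y s * B.estimateWeight est i' (k s) (x s) (v s) -
        B.weightedMean e (k s) (B.estimateWeight est i' (k s)))) :
    ucb B.toParams est k x v y i t < ucb B.toParams est k x v y i' t := by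
  have hX := B.nonempty_ctx
  have hD1 : D ≤ 1 := by
    have := mul_pos hq.γ_pos hq.pV_pos
    linarith [B.mean_le_one e i', B.mean_nonneg e i]
  have hC := B.thirty_two_le_C hV e i
  have hpos : ∀ i j, 0 < MLow B.toParams est i j := fun i j => by linarith [h.le_MLow hq i j]
  have hZ := Z_pos (hpos i) k (show 1 ≤ t by omega)
  have hZ' := Z_pos (hpos i') k (show 1 ≤ t by omega)
  have h1 := h.le_Z_mul_eps hV hq e k ht hb0 hb
  have h1' := h.le_Z_mul_eps hV hq e k ht hb0' hb'
  have hε := h.eps_le_half hV hq e i k ht hD hD1 htau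
  have hε' := eps_pos (by linarith) (hpos i') k ht
  have ht0 : t ≠ 0 := by omega
  unfold ucb
  rw [if_neg ht0, if_neg ht0, EReal.coe_lt_coe_iff, maxError_eq hq k i t hX hV (hkept i),
    maxError_eq hq k i' t hX hV (hkept i'), estimate_eq k x v y i t (hkept i),
    estimate_eq k x v y i' t (hkept i')]
  rw [Finset.sum_sub_distrib] at hdev hdev'
  have h2 : ∑ s ∈ Finset.Icc 1 t, B.weightedMean e (k s) (B.estimateWeight est i (k s)) ≤
      Z B.toParams est k i t * (B.mean e i + θ) := by
    rw [Z, Finset.sum_mul]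
    exact Finset.sum_le_sum fun s _ => h.weightedMean_le hV hq e i (k s)
  have h2' : Z B.toParams est k i' t * (B.mean e i' - (2 * B.slackLow + θ)) ≤
      ∑ s ∈ Finset.Icc 1 t, B.weightedMean e (k s) (B.estimateWeight est i' (k s)) := by
    rw [Z, Finset.sum_mul]
    exact Finset.sum_le_sum fun s _ => h.le_weightedMean hV hq e i' (k s)
  have h3 : (Z B.toParams est k i t)⁻¹ *
      ∑ s ∈ Finset.Icc 1 t, y s * B.estimateWeight est i (k s) (x s) (v s) ≤
      B.mean e i + θ + eps B.toParams est k i t / 4 := by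
    rw [inv_mul_le_iff₀ hZ, mul_add]
    linarith
  have h3' : B.mean e i' - (2 * B.slackLow + θ) - eps B.toParams est k i' t / 4 ≤
      (Z B.toParams est k i' t)⁻¹ *
      ∑ s ∈ Finset.Icc 1 t, y s * B.estimateWeight est i' (k s) (x s) (v s) := by
    rw [le_inv_mul_iff₀ hZ', mul_sub]
    linarith
  -- Apart from the common error term, the index of `i` is at most `μᵢ + θ + 7 ε / 4` with `ε ≤ D /
  -- 2`. The index of `i'` exceeds `μᵢ' - γ pV - θ`, since `3 / 2 > 1 / 4`. The difference is more
  -- than `D / 8 - 2 θ > 0`.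
  have h4 := hq.slackLow_le_half
  linarith

end Accurate

end EpisodicBandit

/-! ### The probability of a suboptimal play. -/

namespace BootstrappedRun

variable {X V : Type*} [Fintype X] [Fintype V] {N E : ℕ} {B : EpisodicBandit X V N E} {T : ℕ}
  {Ω : Type*} [mΩ : MeasurableSpace Ω] {P : Measure Ω} (r : BootstrappedRun B T P)

/-- After the burn-in a suboptimal expert is unlikely to be played. -/
lemma measure_play_suboptimal_le [IsProbabilityMeasure P] (hV : Nontrivial V)
    (hq : B.toParams.Admissible) (e : Fin E) {F : Set Ω} (hF : ∀ t, MeasurableSet[r.past e t] F)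
    {est : Fin N → X → V → ℝ} {κ θ : ℝ} (h : B.Accurate est κ θ)
    (hest : ∀ ω ∈ F, empirical (fun i a => r.bootCtx i a ω) (fun i a => r.bootAct i a ω) = est)
    (i i' : Fin N) {t : ℕ} (ht : 2 ≤ t) (htT : t < T)
    (hkept : ∀ k i j x v, Kept B.toParams est (eps B.toParams est k i t) i j x v)
    {D : ℝ} (hDdef : D = B.mean e i' - B.mean e i - B.γ * B.pV) (hD : 0 < D)
    (htau : 9 * B.C ^ 2 * B.M ^ 2 * Real.log (6 * B.C / D) ^ 2 / D ^ 2 ≤ t / Real.log t)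
    (hθ : 16 * θ < D) :
    P (F ∩ {ω | r.expert e (t + 1) ω = i}) ≤ P F * ENNReal.ofReal (2 * ((t : ℝ) ^ 32)⁻¹) := by
  have hX := B.nonempty_ctx
  have hC := B.thirty_two_le_C hV e i
  have hpos : ∀ i j, 0 < MLow B.toParams est i j := fun i j => by linarith [h.le_MLow hq i j]
  obtain ⟨b, hb0, hba, hb⟩ := h.exists_weight_bound hq i hX hV
  obtain ⟨b', hb0', hba', hb'⟩ := h.exists_weight_bound hq i' hX hV
  have hne : ∀ k i, eps B.toParams est k i t ≠ 0 := fun k i =>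
    (eps_pos (by linarith) (hpos i) k ht).ne'
  have ht0 : (0 : ℝ) < t := by exact_mod_cast (show 0 < t by omega)
  have hlog : 0 ≤ Real.log t := Real.log_natCast_nonneg t
  -- The deviation `4 b √(t log t)` turns the exponent in Azuma's inequality into `-32 log t`.
  have htail : ∀ b : ℝ, 0 < b → Real.exp (-(2 * (4 * b * Real.sqrt (t * Real.log t)) ^ 2 /
      (t * b ^ 2))) = ((t : ℝ) ^ 32)⁻¹ := by
    intro b hb
    rw [mul_pow, Real.sq_sqrt (by positivity), Real.exp_neg]
    congr 1
    rw [show 2 * ((4 * b) ^ 2 * (t * Real.log t)) / (t * b ^ 2) = Real.log t * (32 : ℕ) by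
      push_cast; field_simp; ring, Real.exp_mul, Real.exp_log ht0, Real.rpow_natCast]
  have hdev := r.measure_centredSum_ge_le e hF hb0 (fun j x v => hba j x v) (σ := 1) (by norm_num)
    (show 1 ≤ t by omega) htT.le (l := 4 * b * Real.sqrt (t * Real.log t)) (by positivity)
  have hdev' := r.measure_centredSum_ge_le e hF hb0' (fun j x v => hba' j x v) (σ := -1)
    (by norm_num) (show 1 ≤ t by omega) htT.le (l := 4 * b' * Real.sqrt (t * Real.log t))
    (by positivity)
  rw [htail b hb0] at hdev
  rw [htail b' hb0'] at hdev'
  have hsub : P (F ∩ {ω | r.expert e (t + 1) ω = i}) ≤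
      P (F ∩ {ω | 4 * b * Real.sqrt (t * Real.log t) ≤
          1 * r.centredSum e (B.estimateWeight est i) t ω} ∪
        F ∩ {ω | 4 * b' * Real.sqrt (t * Real.log t) ≤
          -1 * r.centredSum e (B.estimateWeight est i') t ω}) := by
    refine measure_mono_ae ?_
    filter_upwards [r.play_argmax e t htT] with ω hω
    rintro ⟨hωF, hωi⟩
    have hωi' : r.expert e (t + 1) ω = i := hωi
    by_contra hcon
    have hcon' : ¬ (4 * b * Real.sqrt (t * Real.log t) ≤
          1 * r.centredSum e (B.estimateWeight est i) t ω) ∧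
        ¬ (4 * b' * Real.sqrt (t * Real.log t) ≤
          -1 * r.centredSum e (B.estimateWeight est i') t ω) :=
      ⟨fun h1 => hcon (Or.inl ⟨hωF, h1⟩), fun h1 => hcon (Or.inr ⟨hωF, h1⟩)⟩
    obtain ⟨h1, h2⟩ := hcon'
    have h3 := hω i'
    rw [hest ω hωF, hωi'] at h3
    refine absurd h3 (not_le.2 ?_)
    refine h.ucb_lt_ucb hV hq e i i' _ _ _ _ ht hDdef hD htau hθ (hkept _) hb0 hb0'
      (hb _ (hne _ _) (hkept _ i)) (hb' _ (hne _ _) (hkept _ i')) ?_ ?_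
    · rw [one_mul, not_le] at h1
      exact h1
    · rw [not_le] at h2
      have : -(4 * b' * Real.sqrt (t * Real.log t)) <
        r.centredSum e (B.estimateWeight est i') t ω := by linarith
      exact this
  calc _ ≤ _ := hsub
    _ ≤ _ := measure_union_le _ _
    _ ≤ P F * ENNReal.ofReal ((t : ℝ) ^ 32)⁻¹ + P F * ENNReal.ofReal ((t : ℝ) ^ 32)⁻¹ :=
        add_le_add hdev hdev'
    _ = _ := by
        rw [← mul_add, ← ENNReal.ofReal_add (by positivity) (by positivity), two_mul]

end BootstrappedRun

/-! ### Concentration of the empirical policies -/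

lemma bernoulli_mgf_le {p : ℝ} (hp0 : 0 ≤ p) (hp1 : p ≤ 1) (s : ℝ) :
    p * Real.exp (s * (1 - p)) + (1 - p) * Real.exp (s * (0 - p)) ≤ Real.exp (s ^ 2 / 8) := by
  set ν : Measure ℝ := ENNReal.ofReal p • Measure.dirac 1 + ENNReal.ofReal (1 - p) •
    Measure.dirac 0 with hν
  have hprob : IsProbabilityMeasure ν := by
    constructor
    simp only [hν, Measure.add_apply, Measure.smul_apply, measure_univ, smul_eq_mul, mul_one]
    rw [← ENNReal.ofReal_add hp0 (by linarith)]
    simp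
  have hint : ∀ f : ℝ → ℝ, Measurable f → ∫ y, f y ∂ν = p * f 1 + (1 - p) * f 0 := by
    intro f hf
    have hi : ∀ z : ℝ, Integrable f (Measure.dirac z) := fun z =>
      integrable_dirac (by simp)
    rw [hν, integral_add_measure ((hi 1).smul_measure ENNReal.ofReal_ne_top)
      ((hi 0).smul_measure ENNReal.ofReal_ne_top), integral_smul_measure, integral_smul_measure,
      integral_dirac, integral_dirac, ENNReal.toReal_ofReal hp0,
      ENNReal.toReal_ofReal (by linarith), smul_eq_mul, smul_eq_mul]
  have hae : ∀ᵐ y ∂ν, y ∈ Set.Icc (0 : ℝ) 1 := by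
    rw [hν, ae_add_measure_iff]
    constructor <;> refine Measure.ae_smul_measure ?_ _ <;> simp [ae_dirac_eq]
  have hsub := (ProbabilityTheory.hasSubgaussianMGF_of_mem_Icc (X := id) aemeasurable_id hae).mgf_le s
  have hmean : ∫ y, id y ∂ν = p := by
    rw [hint _ measurable_id]
    simp
  rw [hmean, ProbabilityTheory.mgf, hint (fun y => Real.exp (s * (id y - p))) (by fun_prop)] at hsub
  refine hsub.trans (le_of_eq ?_)
  congr 1
  norm_num
  ring

lemma prod_sum_sum_eq {J X V : Type*} [Fintype J] [DecidableEq J] [Fintype X] [Fintype V]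
    (g : J → X → V → ℝ) : ∏ i, ∑ x, ∑ v, g i x v =
      ∑ x : J → X, ∑ v : J → V, ∏ i, g i (x i) (v i) := by
  rw [Finset.prod_univ_sum, Fintype.piFinset_univ]
  refine Finset.sum_congr rfl fun x _ => ?_
  rw [Finset.prod_univ_sum, Fintype.piFinset_univ]

lemma sum_prod_prod_eq {I A X V : Type*} [Fintype I] [Fintype A] [DecidableEq I] [DecidableEq A]
    [Fintype X] [Fintype V] (f : I → A → X → V → ℝ) :
    ∑ x : I → A → X, ∑ v : I → A → V, ∏ i, ∏ a, f i a (x i a) (v i a) =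
      ∏ i, ∏ a, ∑ x, ∑ v, f i a x v := by
  simp_rw [prod_sum_sum_eq]

namespace EpisodicBandit

variable {X V : Type*} [Fintype X] [Fintype V] {N E : ℕ} (B : EpisodicBandit X V N E)

/-- Probability of the bootstrap samples `(x, v)`. -/
noncomputable def bootWeight {A : ℕ} (x : Fin N → Fin A → X) (v : Fin N → Fin A → V) : ℝ :=
  ∏ i, ∏ a, B.priorDist (x i a) * B.policy i (x i a) (v i a)

lemma bootWeight_nonneg {A : ℕ} (x : Fin N → Fin A → X) (v : Fin N → Fin A → V) :
    0 ≤ B.bootWeight x v :=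
  Finset.prod_nonneg fun _ _ => Finset.prod_nonneg fun _ _ =>
    mul_nonneg (B.priorDist_nonneg _) (B.policy_pos _ _ _).le

open Classical in
/-- The excess, over `κ` per visit of `x₀`, of the deviation of the action counts of expert `i₀`;
`σ = ±1` selects the direction. -/
noncomputable def countExcess {A : ℕ} (κ σ : ℝ) (i₀ : Fin N) (x₀ : X) (v₀ : V)
    (x : Fin N → Fin A → X) (v : Fin N → Fin A → V) : ℝ :=
  ∑ a, if x i₀ a = x₀ then
    σ * ((if v i₀ a = v₀ then 1 else 0) - B.policy i₀ x₀ v₀) - κ else 0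

open Classical in
-- The samples are independent, so the exponential moment factorizes. A sample in context `x₀`
-- contributes at most `exp (-4κ²) exp (2κ²) ≤ 1 - 7/4 κ²`, by Hoeffding's lemma for the indicator
-- of `v₀`; any other sample contributes `1`. As the visits are counted in the exponent, no separate
-- estimate of their number is needed.
lemma sum_bootWeight_exp_le {A : ℕ} {κ σ : ℝ} (hκ : κ ^ 2 ≤ 1 / 8) (hσ : σ ^ 2 = 1)
    (i₀ : Fin N) (x₀ : X) (v₀ : V) :
    ∑ x : Fin N → Fin A → X, ∑ v : Fin N → Fin A → V, B.bootWeight x v *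
      Real.exp (4 * κ * B.countExcess κ σ i₀ x₀ v₀ x v) ≤
        Real.exp (-(7 / 4 * κ ^ 2 * (B.pX * A))) := by
  set π := B.policy i₀ x₀ v₀ with hπ
  have hπ0 : 0 ≤ π := (B.policy_pos i₀ x₀ v₀).le
  have hπ1 : π ≤ 1 := by
    rw [← B.policy_sum i₀ x₀]
    exact Finset.single_le_sum (fun a _ => (B.policy_pos i₀ x₀ a).le) (Finset.mem_univ v₀)
  set f : Fin N → Fin A → X → V → ℝ := fun i a x v => B.priorDist x * B.policy i x v *
    (if i = i₀ then Real.exp (4 * κ * (if x = x₀ then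
      σ * ((if v = v₀ then 1 else 0) - π) - κ else 0)) else 1) with hf
  have h1 : ∀ (x : Fin N → Fin A → X) (v : Fin N → Fin A → V), B.bootWeight x v *
      Real.exp (4 * κ * B.countExcess κ σ i₀ x₀ v₀ x v) =
      ∏ i, ∏ a, f i a (x i a) (v i a) := by
    intro x v
    simp only [hf, Finset.prod_mul_distrib, bootWeight]
    congr 1
    rw [Finset.prod_eq_single i₀]
    · simp only [if_true, countExcess, Finset.mul_sum, Real.exp_sum, hπ]
    · intro i _ hi
      simp [hi]
    · simp
  simp_rw [h1]
  rw [sum_prod_prod_eq]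
  have hne : ∀ i, i ≠ i₀ → ∏ a, ∑ x, ∑ v, f i a x v = 1 := by
    intro i hi
    refine Finset.prod_eq_one fun a _ => ?_
    simp only [hf, if_neg hi, mul_one, ← Finset.mul_sum, B.policy_sum, B.priorDist_sum]
  rw [Finset.prod_eq_single i₀ (fun i _ hi => hne i hi) (by simp)]
  -- the factor of one sample
  have hfac : ∀ a, ∑ x, ∑ v, f i₀ a x v ≤ Real.exp (-(7 / 4 * κ ^ 2 * B.pX)) := by
    intro a
    have hz : Real.exp (-(2 * κ ^ 2)) ≤ 1 - 7 / 4 * κ ^ 2 := by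
      have h2 := Real.abs_exp_sub_one_sub_id_le (x := -(2 * κ ^ 2)) (by
        rw [abs_neg, abs_of_nonneg (by positivity)]; linarith)
      have h3 := (abs_le.1 h2).2
      have hsmall : Real.exp (-(2 * κ ^ 2)) * (1 + 2 * κ ^ 2 + (2 * κ ^ 2) ^ 2 / 2) ≤ 1 := by
        have h4 := Real.quadratic_le_exp_of_nonneg (x := 2 * κ ^ 2) (by positivity)
        have h5 : Real.exp (-(2 * κ ^ 2)) * Real.exp (2 * κ ^ 2) = 1 := by
          rw [← Real.exp_add]; simp
        calc _ ≤ Real.exp (-(2 * κ ^ 2)) * Real.exp (2 * κ ^ 2) := by gcongr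
          _ = 1 := h5
      have h6 : 0 ≤ κ ^ 2 := sq_nonneg κ
      have h7 : (1 : ℝ) ≤ (1 - 7 / 4 * κ ^ 2) * (1 + 2 * κ ^ 2 + (2 * κ ^ 2) ^ 2 / 2) := by
        nlinarith [mul_nonneg h6 h6, mul_nonneg h6 (mul_nonneg h6 h6)]
      have h8 : 0 < 1 + 2 * κ ^ 2 + (2 * κ ^ 2) ^ 2 / 2 := by positivity
      nlinarith
    have hx₀ : ∑ v, f i₀ a x₀ v ≤ B.priorDist x₀ * (1 - 7 / 4 * κ ^ 2) := by
      have h2 : ∑ v, f i₀ a x₀ v = B.priorDist x₀ * Real.exp (-(4 * κ ^ 2)) *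
          (π * Real.exp (4 * κ * σ * (1 - π)) + (1 - π) * Real.exp (4 * κ * σ * (0 - π))) := by
        have h3 : ∀ v, f i₀ a x₀ v = B.priorDist x₀ * Real.exp (-(4 * κ ^ 2)) *
            ((if v = v₀ then π * Real.exp (4 * κ * σ * (1 - π)) -
              π * Real.exp (4 * κ * σ * (0 - π)) else 0) +
              B.policy i₀ x₀ v * Real.exp (4 * κ * σ * (0 - π))) := by
          intro v
          have h4 : ∀ c : ℝ, Real.exp (4 * κ * (σ * (c - π) - κ)) =
              Real.exp (-(4 * κ ^ 2)) * Real.exp (4 * κ * σ * (c - π)) := by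
            intro c
            rw [← Real.exp_add]
            congr 1
            ring
          simp only [hf, if_true]
          by_cases hv : v = v₀
          · simp only [hv, if_true, h4, ← hπ]
            ring
          · simp only [hv, if_false, h4]
            ring
        simp only [h3, ← Finset.mul_sum, Finset.sum_add_distrib, ← Finset.sum_mul, B.policy_sum,
          Finset.sum_ite_eq', Finset.mem_univ, if_true]
        ring
      rw [h2]
      have h5 := bernoulli_mgf_le hπ0 hπ1 (4 * κ * σ)
      rw [mul_pow, hσ] at h5
      have hp0 := B.priorDist_nonneg x₀
      calc _ ≤ B.priorDist x₀ * Real.exp (-(4 * κ ^ 2)) * Real.exp ((4 * κ) ^ 2 * 1 / 8) := by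
            gcongr
        _ = B.priorDist x₀ * Real.exp (-(2 * κ ^ 2)) := by
            rw [mul_assoc, ← Real.exp_add]
            congr 2
            ring
        _ ≤ _ := by gcongr
    have hother : ∀ x, x ≠ x₀ → ∑ v, f i₀ a x v = B.priorDist x := by
      intro x hx
      simp only [hf, if_true, if_neg hx, mul_zero, Real.exp_zero, mul_one, ← Finset.mul_sum,
        B.policy_sum]
    have hsum : ∑ x, ∑ v, f i₀ a x v ≤ 1 - 7 / 4 * κ ^ 2 * B.priorDist x₀ := by
      rw [← Finset.add_sum_erase _ _ (Finset.mem_univ x₀)]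
      rw [Finset.sum_congr rfl fun x hx => hother x (Finset.ne_of_mem_erase hx)]
      have := Finset.add_sum_erase Finset.univ B.priorDist (Finset.mem_univ x₀)
      rw [B.priorDist_sum] at this
      linarith
    have h9 := Real.add_one_le_exp (-(7 / 4 * κ ^ 2 * B.pX))
    have h10 : κ ^ 2 * B.pX ≤ κ ^ 2 * B.priorDist x₀ := by
      gcongr
      exact B.pX_le_prior x₀
    linarith
  have hnonneg : ∀ a, 0 ≤ ∑ x, ∑ v, f i₀ a x v := by
    intro a
    refine Finset.sum_nonneg fun x _ => Finset.sum_nonneg fun v _ => ?_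
    refine mul_nonneg (mul_nonneg (B.priorDist_nonneg _) (B.policy_pos _ _ _).le) ?_
    split_ifs <;> positivity
  calc _ ≤ ∏ _a : Fin A, Real.exp (-(7 / 4 * κ ^ 2 * B.pX)) :=
        Finset.prod_le_prod (fun a _ => hnonneg a) fun a _ => hfac a
    _ = _ := by
        rw [Finset.prod_const, Finset.card_univ, Fintype.card_fin, ← Real.exp_nat_mul]
        congr 1
        ring

open Classical in
lemma countExcess_nonneg_of_lt {A : ℕ} {κ : ℝ} (i₀ : Fin N) (x₀ : X) (v₀ : V)
    (x : Fin N → Fin A → X) (v : Fin N → Fin A → V)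
    (h : κ < |B.policy i₀ x₀ v₀ - empirical x v i₀ x₀ v₀|) :
    0 ≤ B.countExcess κ 1 i₀ x₀ v₀ x v ∨ 0 ≤ B.countExcess κ (-1) i₀ x₀ v₀ x v := by
  set π := B.policy i₀ x₀ v₀ with hπ
  set c : ℝ := ((Finset.univ.filter fun a => x i₀ a = x₀).card : ℝ) with hc
  set n : ℝ := ((Finset.univ.filter fun a => x i₀ a = x₀ ∧ v i₀ a = v₀).card : ℝ) with hn
  have hex : ∀ σ : ℝ, B.countExcess κ σ i₀ x₀ v₀ x v = σ * (n - π * c) - κ * c := by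
    intro σ
    have h1 : ∀ a, (if x i₀ a = x₀ then
        σ * ((if v i₀ a = v₀ then 1 else 0) - π) - κ else 0) =
        σ * (if x i₀ a = x₀ ∧ v i₀ a = v₀ then 1 else 0) -
          (σ * π + κ) * (if x i₀ a = x₀ then 1 else 0) := by
      intro a
      by_cases hx : x i₀ a = x₀ <;> by_cases hv : v i₀ a = v₀ <;> simp [hx, hv] <;> ring
    rw [countExcess, ← hπ]
    simp only [h1, Finset.sum_sub_distrib, ← Finset.mul_sum, Finset.sum_boole, ← hc, ← hn]
    ring
  have hemp : empirical x v i₀ x₀ v₀ = n / c := rfl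
  rw [hex, hex]
  rw [hemp] at h
  have hc0 : 0 ≤ c := Nat.cast_nonneg _
  rcases hc0.eq_or_lt with h0 | h0
  -- A context that was never visited has both excesses equal to `0`, so this failure is covered
  -- too.
  · have hn0 : n = 0 := by
      have h2 : n ≤ c := by
        rw [hn, hc]
        exact_mod_cast Finset.card_le_card fun a ha => by
          simp only [Finset.mem_filter] at ha ⊢
          exact ⟨ha.1, ha.2.1⟩
      have : 0 ≤ n := Nat.cast_nonneg _
      linarith
    left
    rw [← h0, hn0]
    simp
  · have h3 : n = n / c * c := by field_simp
    rcases lt_abs.1 h with h | h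
    · right
      rw [h3]
      nlinarith
    · left
      rw [h3]
      nlinarith

end EpisodicBandit

namespace BootstrappedRun

variable {X V : Type*} [Fintype X] [Fintype V] {N E : ℕ} {B : EpisodicBandit X V N E} {T : ℕ}
  {Ω : Type*} [mΩ : MeasurableSpace Ω] {P : Measure Ω} (r : BootstrappedRun B T P)

/-- The event that the bootstrap samples are `(x, v)`. -/
def bootEvent (z : (Fin N → Fin (B.numSamples T) → X) × (Fin N → Fin (B.numSamples T) → V)) :
    Set Ω :=
  {ω | ∀ i a, r.bootCtx i a ω = z.1 i a ∧ r.bootAct i a ω = z.2 i a}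

lemma measurableSet_bootEvent (e : Fin E) (t : ℕ)
    (z : (Fin N → Fin (B.numSamples T) → X) × (Fin N → Fin (B.numSamples T) → V)) :
    MeasurableSet[r.past e t] (r.bootEvent z) := by
  have h : r.bootEvent z = ⋂ i, ⋂ a, (r.bootCtx i a ⁻¹' {z.1 i a} ∩ r.bootAct i a ⁻¹' {z.2 i a}) := by
    ext ω
    simp [bootEvent]
  rw [h]
  refine MeasurableSet.iInter fun i => MeasurableSet.iInter fun a => MeasurableSet.inter ?_ ?_
  · exact r.measurable_bootCtx_past e t i a (show MeasurableSet[⊤] _ from trivial)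
  · exact r.measurable_bootAct_past e t i a (show MeasurableSet[⊤] _ from trivial)

lemma empirical_eq_of_mem
    {z : (Fin N → Fin (B.numSamples T) → X) × (Fin N → Fin (B.numSamples T) → V)} {ω : Ω} (h : ω ∈ r.bootEvent z) :
    empirical (fun i a => r.bootCtx i a ω) (fun i a => r.bootAct i a ω) = empirical z.1 z.2 := by
  have h1 : (fun i a => r.bootCtx i a ω) = z.1 := funext fun i => funext fun a => (h i a).1
  have h2 : (fun i a => r.bootAct i a ω) = z.2 := funext fun i => funext fun a => (h i a).2
  rw [h1, h2]

open Classical in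
/-- The probability that some empirical policy is off by more than `κ`. -/
lemma sum_measure_bad_le {κ : ℝ} (hκ0 : 0 ≤ κ) (hκ : κ ^ 2 ≤ 1 / 8) :
    ∑ z ∈ Finset.univ.filter (fun z : (Fin N → Fin (B.numSamples T) → X) ×
        (Fin N → Fin (B.numSamples T) → V) =>
        ∃ i x v, κ < |B.policy i x v - empirical z.1 z.2 i x v|), P (r.bootEvent z) ≤
      ENNReal.ofReal (2 * (N * Fintype.card X * Fintype.card V) *
        Real.exp (-(7 / 4 * κ ^ 2 * (B.pX * B.numSamples T)))) := by
  have hP : ∀ z, P (r.bootEvent z) = ENNReal.ofReal (B.bootWeight z.1 z.2) := fun z =>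
    r.boot_law z.1 z.2
  simp_rw [hP]
  rw [← ENNReal.ofReal_sum_of_nonneg fun z _ => B.bootWeight_nonneg _ _]
  refine ENNReal.ofReal_le_ofReal ?_
  set g : Fin N × X × V → (Fin N → Fin (B.numSamples T) → X) ×
        (Fin N → Fin (B.numSamples T) → V) → ℝ := fun y z =>
    Real.exp (4 * κ * B.countExcess κ 1 y.1 y.2.1 y.2.2 z.1 z.2) +
      Real.exp (4 * κ * B.countExcess κ (-1) y.1 y.2.1 y.2.2 z.1 z.2) with hg
  have hg0 : ∀ y z, 0 ≤ g y z := fun y z => by positivity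
  -- Markov's inequality and the union bound at once: a bad sample makes at least one of the
  -- exponentials at least `1`.
  have hg1 : ∀ z, (∃ i x v, κ < |B.policy i x v - empirical z.1 z.2 i x v|) →
      1 ≤ ∑ y, g y z := by
    rintro z ⟨i, x, v, h⟩
    refine le_trans ?_ (Finset.single_le_sum (fun y _ => hg0 y z) (Finset.mem_univ (i, x, v)))
    have h2 : ∀ u : ℝ, 0 ≤ u → 1 ≤ Real.exp (4 * κ * u) := fun u hu =>
      Real.one_le_exp (by positivity)
    rcases B.countExcess_nonneg_of_lt i x v z.1 z.2 h with h1 | h1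
    · have := h2 _ h1
      have := Real.exp_pos (4 * κ * B.countExcess κ (-1) i x v z.1 z.2)
      simp only [hg]
      linarith
    · have := h2 _ h1
      have := Real.exp_pos (4 * κ * B.countExcess κ 1 i x v z.1 z.2)
      simp only [hg]
      linarith
  calc _ ≤ ∑ z ∈ Finset.univ.filter (fun z : (Fin N → Fin (B.numSamples T) → X) ×
        (Fin N → Fin (B.numSamples T) → V) =>
        ∃ i x v, κ < |B.policy i x v - empirical z.1 z.2 i x v|),
        B.bootWeight z.1 z.2 * ∑ y, g y z := by
        refine Finset.sum_le_sum fun z hz => ?_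
        exact le_mul_of_one_le_right (B.bootWeight_nonneg _ _) (hg1 z (Finset.mem_filter.1 hz).2)
    _ ≤ ∑ z, B.bootWeight z.1 z.2 * ∑ y, g y z :=
        Finset.sum_le_sum_of_subset_of_nonneg (Finset.filter_subset _ _) fun z _ _ =>
          mul_nonneg (B.bootWeight_nonneg _ _) (Finset.sum_nonneg fun y _ => hg0 y z)
    _ = ∑ y, ∑ z, B.bootWeight z.1 z.2 * g y z := by
        simp_rw [Finset.mul_sum]
        exact Finset.sum_comm
    _ ≤ ∑ _y : Fin N × X × V, 2 * Real.exp (-(7 / 4 * κ ^ 2 * (B.pX * B.numSamples T))) := by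
        refine Finset.sum_le_sum fun y _ => ?_
        simp only [hg, mul_add, Finset.sum_add_distrib]
        rw [Fintype.sum_prod_type, Fintype.sum_prod_type]
        have h1 := B.sum_bootWeight_exp_le (A := B.numSamples T) hκ (σ := 1) (by norm_num) y.1
          y.2.1 y.2.2
        have h2 := B.sum_bootWeight_exp_le (A := B.numSamples T) hκ (σ := -1) (by norm_num) y.1
          y.2.1 y.2.2
        linarith
    _ = _ := by
        rw [Finset.sum_const, Finset.card_univ, Fintype.card_prod, Fintype.card_prod,
          Fintype.card_fin, nsmul_eq_mul]
        push_cast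
        ring

end BootstrappedRun

/-! ### The accuracy reached by the bootstrap. -/

/-- The numerical inequality behind the transfer of the clipping time to less accurate estimates. -/
lemma mul_log_mul_le_one {n d : ℝ} (hn : 1000000 ≤ n) (hd : 0 ≤ d)
    (h : d ^ 6 * n ^ 10 ≤ 8 / 5) : 152 * n * Real.log n * d ≤ 1 := by
  have hn0 : 0 < n := by linarith
  have hlog0 : 0 ≤ Real.log n := Real.log_nonneg (by linarith)
  have hlog : Real.log n ^ 6 ≤ 46656 * n := by
    have h1 := Real.log_le_rpow_div hn0.le (show (0 : ℝ) < 1 / 6 by norm_num)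
    have h2 := pow_le_pow_left₀ hlog0 h1 6
    refine h2.trans (le_of_eq ?_)
    rw [div_pow, ← Real.rpow_natCast, ← Real.rpow_mul hn0.le]
    norm_num
    ring
  refine (pow_le_one_iff_of_nonneg (by positivity) (show 6 ≠ 0 by norm_num)).1 ?_
  have hn4 : 0 < n ^ 4 := by positivity
  have h3 : (152 * n * Real.log n * d) ^ 6 * n ^ 4 ≤ 152 ^ 6 * (46656 * n) * (8 / 5) := by
    calc _ = 152 ^ 6 * Real.log n ^ 6 * (d ^ 6 * n ^ 10) := by ring
      _ ≤ _ := by gcongr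
  have h4 : (152 : ℝ) ^ 6 * (46656 * n) * (8 / 5) ≤ n ^ 4 := by
    have h5 : (1000000 : ℝ) ^ 3 * n ≤ n ^ 3 * n := by gcongr
    nlinarith
  exact le_of_mul_le_mul_right (by linarith) hn4

/-- Applied with `c = |X|` and `n = 2T`. For `z = log c / (10 log n)` one has `z³ ≤ exp (3 (z -
1))`, whereas `c / n ^ 10 = exp (10 (z - 1) log n)` is larger. -/
lemma sqrt_pow_six_mul_le {n c : ℝ} (hn : 3 ≤ n) (hc0 : 0 < c)
    (hc : 10 * Real.log n < Real.log c) :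
    Real.sqrt (Real.log c / (10 * Real.log n)) ^ 6 * n ^ 10 ≤ c := by
  have hn0 : 0 < n := by linarith
  have hl1 : 1 ≤ Real.log n := by
    rw [Real.le_log_iff_exp_le hn0]
    linarith [Real.exp_one_lt_d9]
  set l := Real.log n with hl
  set z : ℝ := Real.log c / (10 * l) with hz
  have hl0 : 0 < l := by linarith
  have hz1 : 1 < z := by rw [hz, lt_div_iff₀ (by positivity)]; linarith
  have hzl : z * (10 * l) = Real.log c := by rw [hz]; field_simp
  have h1 : z ≤ Real.exp (z - 1) := by linarith [Real.add_one_le_exp (z - 1)]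
  have h2 : Real.sqrt z ^ 6 ≤ Real.exp (3 * (z - 1)) := by
    calc Real.sqrt z ^ 6 = (Real.sqrt z ^ 2) ^ 3 := by ring
      _ = z ^ 3 := by rw [Real.sq_sqrt (by linarith)]
      _ ≤ Real.exp (z - 1) ^ 3 := by gcongr
      _ = _ := by rw [← Real.exp_nat_mul]; norm_num
  have h3 : n ^ 10 = Real.exp (10 * l) := by
    rw [hl, mul_comm, Real.exp_mul, Real.exp_log hn0]
    norm_cast
  calc Real.sqrt z ^ 6 * n ^ 10 ≤ Real.exp (3 * (z - 1)) * Real.exp (10 * l) := by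
        rw [h3]
        gcongr
    _ = Real.exp (3 * (z - 1) + 10 * l) := (Real.exp_add _ _).symm
    _ ≤ Real.exp (Real.log c) := by
        refine Real.exp_le_exp.2 ?_
        rw [← hzl]
        nlinarith
    _ = c := Real.exp_log hc0

lemma Params.Admissible.level_le {q : Params} (hq : q.Admissible) {κ n : ℝ} (hn : 1000000 ≤ n)
    (h : 152 * n * Real.log n * (9 / 4 * κ / q.pV ^ 2) ≤ 1) : κ ≤ q.pV / 10 := by
  have hpV := hq.pV_pos
  have hl1 : 1 ≤ Real.log n := by
    rw [Real.le_log_iff_exp_le (by linarith)]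
    linarith [Real.exp_one_lt_d9]
  set d := 9 / 4 * κ / q.pV ^ 2 with hd
  have h3 : κ = 4 / 9 * d * q.pV ^ 2 := by rw [hd]; field_simp
  have h2 : (10 : ℝ) ≤ 152 * n * Real.log n := by
    have : 152 * n * 1 ≤ 152 * n * Real.log n := by gcongr
    linarith
  have h1 : d ≤ 1 / 10 := by nlinarith
  have h4 : 4 / 9 * d * q.pV ^ 2 ≤ 4 / 9 * (1 / 10) * q.pV ^ 2 := by gcongr
  rw [h3]
  nlinarith [hq.pV_le]

/-- Since `ξ ≤ γ pV³ / 4`, four of the six powers of `ξ` pay for `pV ^ 12` in the denominator. The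
remaining two pay for `c`. -/
lemma Params.Admissible.level_pow_le {q : Params} (hq : q.Admissible) {K n c : ℝ}
    (hKc : K ^ 6 * n ^ 10 ≤ c) (hc : q.ξ ^ 2 * c ≤ 2) :
    (9 / 4 * (K * q.ξ) / q.pV ^ 2) ^ 6 * n ^ 10 ≤ 8 / 5 := by
  have hpV := hq.pV_pos
  have hξ := hq.ξ_pos
  have hγ := hq.γ_pos
  have hn : 0 ≤ n ^ 10 := by positivity
  have hξp : q.ξ ^ 6 ≤ (1 / 4) ^ 6 * (25 * q.ξ ^ 2) * q.pV ^ 12 := by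
    have h3 : q.ξ ^ 6 ≤ (q.γ * q.pV ^ 3 / 4) ^ 6 := pow_le_pow_left₀ hξ.le hq.ξ_le 6
    have h4 : (q.γ * q.pV ^ 3 / 5) ^ 2 ≤ q.ξ ^ 2 := pow_le_pow_left₀ (by positivity) hq.le_ξ 2
    have h5 : q.γ ^ 4 ≤ 1 := pow_le_one₀ hγ.le hq.γ_le
    calc q.ξ ^ 6 ≤ (q.γ * q.pV ^ 3 / 4) ^ 6 := h3
      _ = (1 / 4) ^ 6 * (25 * (q.γ * q.pV ^ 3 / 5) ^ 2) * q.pV ^ 12 * q.γ ^ 4 := by ring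
      _ ≤ (1 / 4) ^ 6 * (25 * q.ξ ^ 2) * q.pV ^ 12 * 1 := by gcongr
      _ = _ := by ring
  have h1 : (9 / 4 * (K * q.ξ) / q.pV ^ 2) ^ 6 = (9 / 4) ^ 6 * K ^ 6 * q.ξ ^ 6 / q.pV ^ 12 := by
    ring
  have h2 : (9 / 4 * (K * q.ξ) / q.pV ^ 2) ^ 6 ≤ (9 / 16) ^ 6 * 25 * q.ξ ^ 2 * K ^ 6 := by
    rw [h1, div_le_iff₀ (by positivity)]
    calc (9 / 4) ^ 6 * K ^ 6 * q.ξ ^ 6 ≤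
        (9 / 4) ^ 6 * K ^ 6 * ((1 / 4) ^ 6 * (25 * q.ξ ^ 2) * q.pV ^ 12) := by gcongr
      _ = _ := by ring
  calc _ ≤ (9 / 16) ^ 6 * 25 * q.ξ ^ 2 * K ^ 6 * n ^ 10 := by gcongr
    _ = (9 / 16) ^ 6 * 25 * (q.ξ ^ 2 * (K ^ 6 * n ^ 10)) := by ring
    _ ≤ (9 / 16) ^ 6 * 25 * (q.ξ ^ 2 * c) := by gcongr
    _ ≤ (9 / 16) ^ 6 * 25 * 2 := by gcongr
    _ ≤ 8 / 5 := by norm_num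

namespace EpisodicBandit

variable {X V : Type*} [Fintype X] [Fintype V] {N E : ℕ} (B : EpisodicBandit X V N E)

lemma le_pX_mul_numSamples (T : ℕ) : 4 * Fintype.card V * Real.log (2 * T) / B.ξ ^ 2 +
    Real.log (Fintype.card X * N * T * Real.sqrt E) / (2 * B.pX) ≤ B.pX * B.numSamples T := by
  have hp := B.pX_pos
  have h1 := Nat.le_ceil (2 * B.samplesPerContext T / B.pX +
    Real.log (Fintype.card X * N * T * Real.sqrt E) / (2 * B.pX ^ 2))
  have h2 := mul_le_mul_of_nonneg_left h1 hp.le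
  refine le_trans (le_of_eq ?_) h2
  unfold samplesPerContext
  field_simp
  ring

set_option maxHeartbeats 800000 in
/-- There is a level `K ξ` of accuracy that the empirical policies reach with high probability,
and that is either `ξ` or so small that the clipping time is hardly affected. -/
lemma exists_accuracy_level (hV : Nontrivial V) (hq : B.toParams.Admissible) (e : Fin E)
    (i₀ : Fin N) {T : ℕ} (hT : 500000 ≤ T) (hN : N ≤ T ^ 2) :
    ∃ K : ℝ, 1 ≤ K ∧ K * B.ξ ≤ B.pV / 10 ∧
      2 * (N * Fintype.card X * Fintype.card V) *
        Real.exp (-(7 / 4 * (K * B.ξ) ^ 2 * (B.pX * B.numSamples T))) ≤ 1 / (T : ℝ) ∧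
      (K = 1 ∨ 304 * (T : ℝ) * Real.log (2 * T) * (9 / 4 * (K * B.ξ) / B.pV ^ 2) ≤ 1) := by
  have hX := B.nonempty_ctx
  have hT' : (500000 : ℝ) ≤ T := by exact_mod_cast hT
  have hE1 : 1 ≤ E := by have := e.pos; omega
  have hN1 : 1 ≤ N := by have := i₀.pos; omega
  have hE1' : (1 : ℝ) ≤ E := by exact_mod_cast hE1
  have hN1' : (1 : ℝ) ≤ N := by exact_mod_cast hN1
  have hX1 : (1 : ℝ) ≤ Fintype.card X := by exact_mod_cast Fintype.card_pos
  have hV2 : (2 : ℝ) ≤ Fintype.card V := by exact_mod_cast Fintype.one_lt_card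
  have hN2 : (N : ℝ) ≤ (T : ℝ) ^ 2 := by exact_mod_cast hN
  have hpX := B.pX_pos
  have hpV := hq.pV_pos
  have hξ := hq.ξ_pos
  have hXpX := B.card_mul_pX_le
  set cX : ℝ := (Fintype.card X : ℝ) with hcX
  set cV : ℝ := (Fintype.card V : ℝ) with hcV
  set n : ℝ := 2 * (T : ℝ) with hn
  set l : ℝ := Real.log n with hl
  have hl1 : 1 ≤ l := by
    rw [hl, Real.le_log_iff_exp_le (by positivity)]
    linarith [Real.exp_one_lt_d9]
  have hlogT : Real.log T ≤ l := Real.log_le_log (by positivity) (by linarith)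
  have hlogN : Real.log N ≤ 2 * l := by
    have h1 := Real.log_le_log (by positivity) hN2
    rw [Real.log_pow] at h1
    push_cast at h1
    linarith
  have hlogN0 : 0 ≤ Real.log N := Real.log_nonneg hN1'
  have hlogX0 : 0 ≤ Real.log cX := Real.log_nonneg hX1
  have hlogV : Real.log cV ≤ cV - 1 := Real.log_le_sub_one_of_pos (by positivity)
  have hsqE : 1 ≤ Real.sqrt E := Real.one_le_sqrt.2 hE1'
  have hextra : Real.log cX + Real.log N ≤ Real.log (cX * N * T * Real.sqrt E) := by
    rw [← Real.log_mul (by positivity) (by positivity)]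
    refine Real.log_le_log (by positivity) ?_
    have h1 : cX * N * 1 * 1 ≤ cX * N * T * Real.sqrt E := by
      gcongr
      linarith
    linarith
  have hA := B.le_pX_mul_numSamples T
  have hexp : ∀ Q : ℝ, l + Real.log N + Real.log cX + Real.log cV ≤ Q →
      2 * (N * cX * cV) * Real.exp (-Q) ≤ 1 / (T : ℝ) := by
    intro Q hQ
    have h1 : Real.exp (l + Real.log N + Real.log cX + Real.log cV) = n * N * cX * cV := by
      rw [Real.exp_add, Real.exp_add, Real.exp_add, hl, Real.exp_log (by positivity),
        Real.exp_log (by positivity), Real.exp_log (by positivity), Real.exp_log (by positivity)]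
    have h2 := Real.exp_le_exp.2 hQ
    rw [h1] at h2
    rw [Real.exp_neg, ← div_eq_mul_inv, div_le_div_iff₀ (Real.exp_pos _) (by positivity), one_mul]
    refine le_trans (le_of_eq ?_) h2
    rw [hn]
    ring
  have hξ16 := hq.ξ_le_pV
  -- If `ξ² ≥ 2 pX`, the second term of the sample size pays for `log N + log |X|`.
  rcases le_or_gt (2 * B.pX) (B.ξ ^ 2) with hcase | hcase
  · refine ⟨1, le_rfl, by linarith, hexp _ ?_, Or.inl rfl⟩
    rw [one_mul]
    have h1 : 7 / 4 * B.ξ ^ 2 * (4 * cV * l / B.ξ ^ 2 +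
        Real.log (cX * N * T * Real.sqrt E) / (2 * B.pX)) ≤
        7 / 4 * B.ξ ^ 2 * (B.pX * B.numSamples T) := by gcongr
    have h2 : 7 / 4 * B.ξ ^ 2 * (4 * cV * l / B.ξ ^ 2 +
        Real.log (cX * N * T * Real.sqrt E) / (2 * B.pX)) =
        7 * cV * l + 7 / 4 * (Real.log (cX * N * T * Real.sqrt E) *
          (B.ξ ^ 2 / (2 * B.pX))) := by
      field_simp
    have h3 : 1 ≤ B.ξ ^ 2 / (2 * B.pX) := by rwa [le_div_iff₀ (by positivity), one_mul]
    have h4 : Real.log (cX * N * T * Real.sqrt E) * 1 ≤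
        Real.log (cX * N * T * Real.sqrt E) * (B.ξ ^ 2 / (2 * B.pX)) := by
      gcongr
      linarith
    nlinarith
  · have hQ : ∀ K : ℝ, 7 * cV * (K ^ 2 * l) ≤
        7 / 4 * (K * B.ξ) ^ 2 * (B.pX * B.numSamples T) := by
      intro K
      have h0 : 0 ≤ Real.log (cX * N * T * Real.sqrt E) / (2 * B.pX) := by
        have : 0 ≤ Real.log (cX * N * T * Real.sqrt E) := by linarith
        positivity
      calc 7 * cV * (K ^ 2 * l) = 7 / 4 * (K * B.ξ) ^ 2 * (4 * cV * l / B.ξ ^ 2) := by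
            field_simp
        _ ≤ _ := by
            gcongr
            linarith
    have hfit : ∀ L : ℝ, l ≤ L → Real.log cX ≤ 10 * L →
        l + Real.log N + Real.log cX + Real.log cV ≤ 7 * cV * L := by
      intro L h1 h2
      have h3 : cV - 1 ≤ (cV - 1) * L := le_mul_of_one_le_right (by linarith) (by linarith)
      nlinarith
    -- Now only the first term is used. It supplies the exponent `7 |V| log (2T)`, enough as long as
    -- `log |X| ≤ 10 log (2T)`; otherwise the level is raised by the factor `K` that restores this
    -- balance.
    rcases le_or_gt (Real.log cX) (10 * l) with hc | hc
    · refine ⟨1, le_rfl, by linarith, hexp _ ((hfit l le_rfl hc).trans ?_), Or.inl rfl⟩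
      simpa using hQ 1
    · set z : ℝ := Real.log cX / (10 * l) with hz
      have hl0 : 0 < l := by linarith
      have hz1 : 1 < z := by rw [hz, lt_div_iff₀ (by positivity)]; linarith
      have hzl : z * (10 * l) = Real.log cX := by rw [hz]; field_simp
      set K := Real.sqrt z with hK
      have hK2 : K ^ 2 = z := Real.sq_sqrt (by linarith)
      have hK1 : 1 ≤ K := Real.one_le_sqrt.2 hz1.le
      set d : ℝ := 9 / 4 * (K * B.ξ) / B.pV ^ 2 with hd
      have hd0 : 0 ≤ d := by positivity
      have hKX : K ^ 6 * n ^ 10 ≤ cX := sqrt_pow_six_mul_le (by linarith) (by linarith) hc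
      have hξX : B.ξ ^ 2 * cX ≤ 2 := by nlinarith
      have hd6 : d ^ 6 * n ^ 10 ≤ 8 / 5 := hq.level_pow_le hKX hξX
      have hsmall := mul_log_mul_le_one (n := n) (by rw [hn]; linarith) hd0 hd6
      have hsmall' : 304 * (T : ℝ) * Real.log n * d ≤ 1 := by
        rw [hn] at hsmall ⊢
        linarith
      refine ⟨K, hK1, ?_, hexp _ ((hfit (K ^ 2 * l) ?_ ?_).trans (hQ K)), Or.inr hsmall'⟩
      · exact hq.level_le (by rw [hn]; linarith) hsmall
      · rw [hK2]
        nlinarith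
      · rw [hK2]
        linarith

/-- Estimates at the accuracy level of `exists_accuracy_level` are accurate enough for ED-UCB, and
are not clipped from round `B.Tclip + 1` on. -/
lemma exists_accurate_of_level {B : EpisodicBandit X V N E} (hV : Nontrivial V)
    (hq : B.toParams.Admissible) (e : Fin E)
    (i₀ : Fin N) {T : ℕ} (hT : 500000 ≤ T) {K : ℝ} (hK : 1 ≤ K) (hKξ : K * B.ξ ≤ B.pV / 10)
    (hKd : K = 1 ∨ 304 * (T : ℝ) * Real.log (2 * T) * (9 / 4 * (K * B.ξ) / B.pV ^ 2) ≤ 1)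
    {est : Fin N → X → V → ℝ} (hpol : IsPolicyFamily est)
    (hest : ∀ i x v, |B.policy i x v - est i x v| ≤ K * B.ξ) :
    ∃ κ θ, B.Accurate est κ θ ∧ 16 * θ ≤ 1 / (T : ℝ) ∧ ∀ t, B.Tclip + 1 ≤ t → 9 ≤ t → t ≤ T →
      ∀ (k : ℕ → Fin N) (i j : Fin N) (x : X) (v : V),
        Kept B.toParams est (eps B.toParams est k i t) i j x v := by
  have hT' : (500000 : ℝ) ≤ T := by exact_mod_cast hT
  have hpV := hq.pV_pos
  have hξ := hq.ξ_pos
  rcases hKd with rfl | hKd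
  · rw [one_mul] at hest
    refine ⟨B.ξ, 0, accurate_of_abs_sub_le hq hpol hest, by simp, fun t ht _ _ k i j x v => ?_⟩
    exact (B.Tclip_spec hV e i₀).2 t (by omega) est hpol hest k i j x v
  · set κ := K * B.ξ with hκ
    -- As `κ ≤ pV / 10`, ratios are accurate up to `(10 / 9) κ / pV² ≤ d / 2`. Hence `d` bounds the
    -- distance of the ratios of two families of accuracy `κ`.
    set d : ℝ := 9 / 4 * κ / B.pV ^ 2 with hd
    have hκ0 : 0 < κ := by positivity
    have hd0 : 0 < d := by positivity
    have hlog1 : 1 ≤ Real.log (2 * T) := by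
      rw [Real.le_log_iff_exp_le (by positivity)]
      linarith [Real.exp_one_lt_d9]
    have hdT : 304 * (T : ℝ) * d ≤ 1 := by
      refine le_trans ?_ hKd
      have : 304 * (T : ℝ) * d * 1 ≤ 304 * (T : ℝ) * d * Real.log (2 * T) := by gcongr
      linarith
    have hd1 : d ≤ 1 / 1000 := by nlinarith
    have hκd : κ = 4 / 9 * d * B.pV ^ 2 := by rw [hd]; field_simp
    have hpV2 : B.pV ^ 2 ≤ B.pV / 2 := by nlinarith [hq.pV_le]
    have hratio : κ / (B.pV * (B.pV - κ)) ≤ d / 2 := by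
      rw [div_le_iff₀ (mul_pos hpV (by linarith))]
      have : d / 2 * (B.pV * (B.pV * (9 / 10))) ≤ d / 2 * (B.pV * (B.pV - κ)) := by
        gcongr
        linarith
      nlinarith
    have hκd' : κ ≤ d * (B.pV / 2) * (4 / 9) := by
      rw [hκd]
      nlinarith
    have hξκ : B.ξ ≤ κ := by rw [hκ]; nlinarith
    have hacc : B.Accurate est κ d :=
      { isPolicy := hpol
        abs_sub_le := hest
        le_pV := hKξ
        sub_le := by nlinarith
        ratio_le := by linarith [hq.slackLow_pos]
        θ_nonneg := hd0.le
        θ_le := hd1 }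
    have hK0 : 0 < K := by linarith
    -- Contraction towards the true policies by `1 / K`: the accuracy becomes `ξ`, so the clipping
    -- time applies to `est'`.
    set est' : Fin N → X → V → ℝ := fun i x v =>
      (1 - 1 / K) * B.policy i x v + 1 / K * est i x v with hest'
    have hKinv : 1 / K ≤ 1 := by rw [div_le_one hK0]; exact hK
    have hKinv0 : 0 < 1 / K := by positivity
    have hpol' : IsPolicyFamily est' := by
      intro i x
      refine ⟨fun v => ?_, ?_⟩
      · exact add_nonneg (mul_nonneg (by linarith) (B.policy_pos i x v).le)
          (mul_nonneg hKinv0.le ((hpol i x).1 v))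
      · simp only [hest', Finset.sum_add_distrib, ← Finset.mul_sum, B.policy_sum, (hpol i x).2]
        ring
    have hdiff' : ∀ i x v, |B.policy i x v - est' i x v| ≤ B.ξ := by
      intro i x v
      have h1 : B.policy i x v - est' i x v = 1 / K * (B.policy i x v - est i x v) := by
        simp only [hest']; ring
      rw [h1, abs_mul, abs_of_pos hKinv0]
      calc _ ≤ 1 / K * κ := by gcongr; exact hest i x v
        _ = B.ξ := by rw [hκ]; field_simp
    have hacc' := accurate_of_abs_sub_le hq hpol' hdiff'
    have hdiff : ∀ i x v, |est i x v - est' i x v| ≤ d * (B.pV / 2) := by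
      intro i x v
      have h1 := abs_sub_le (est i x v) (B.policy i x v) (est' i x v)
      rw [abs_sub_comm (est i x v) (B.policy i x v)] at h1
      have h3 : 0 < d * (B.pV / 2) := by positivity
      linarith [hest i x v, hdiff' i x v]
    have hrat : ∀ i j x v, |est i x v / est j x v - est' i x v / est' j x v| ≤ d := by
      intro i j x v
      have h1 := abs_sub_le (est i x v / est j x v) (B.policy i x v / B.policy j x v)
        (est' i x v / est' j x v)
      rw [abs_sub_comm (B.policy i x v / B.policy j x v)] at h1
      have h2 := hacc.abs_ratio_sub_le' hV i j x v
      have h3 := hacc'.abs_ratio_sub_le' hV i j x v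
      have h4 : B.ξ / (B.pV * (B.pV - B.ξ)) ≤ κ / (B.pV * (B.pV - κ)) := by
        have : 0 < B.pV - κ := by linarith
        gcongr
      linarith
    refine ⟨κ, d, hacc, ?_, fun t ht ht9 htT k i j x v => ?_⟩
    · rw [le_div_iff₀ (by positivity)]
      linarith
    · obtain ⟨t, rfl⟩ : ∃ t', t = t' + 1 := ⟨t - 1, by omega⟩
      refine hacc.kept_succ hV hq e hacc' hd0.le hdiff hrat (by omega) (by omega) ?_ k i j x v
      have htT' : (t : ℝ) + 1 ≤ T := by exact_mod_cast htT
      have hlog0 : 0 ≤ Real.log (2 * ((t : ℝ) + 1)) := Real.log_nonneg (by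
        have : (0 : ℝ) ≤ t := Nat.cast_nonneg t
        linarith)
      refine le_trans ?_ hKd
      gcongr

end EpisodicBandit

/-! ### Auxiliary monotonicity and sums. -/

lemma div_log_mono {s t : ℝ} (hs : 3 ≤ s) (hst : s ≤ t) : s / Real.log s ≤ t / Real.log t := by
  have he : Real.exp 1 ≤ s := by linarith [Real.exp_one_lt_d9]
  have h := Real.log_div_self_antitoneOn (Set.mem_ofPred_eq ▸ he)
    (Set.mem_ofPred_eq ▸ (he.trans hst)) hst
  have h1 : 0 < Real.log s := Real.log_pos (by linarith)
  have h2 : 0 < Real.log t := Real.log_pos (by linarith)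
  have h3 := inv_anti₀ (div_pos h2 (by linarith)) h
  simpa using h3

lemma exists_le_div_log (c : ℝ) : ∃ t : ℕ, 2 ≤ t ∧ c ≤ t / Real.log t := by
  have h1 : Filter.Tendsto (fun x : ℝ => Real.log x / x) Filter.atTop (nhds 0) := by
    simpa using Real.isLittleO_log_id_atTop.tendsto_div_nhds_zero
  have h2 := (h1.comp tendsto_natCast_atTop_atTop).eventually
    (gt_mem_nhds (show (0 : ℝ) < 1 / (|c| + 1) by positivity))
  obtain ⟨t, ht, ht2⟩ := (h2.and (Filter.eventually_ge_atTop 2)).exists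
  refine ⟨t, ht2, ?_⟩
  have ht' : (2 : ℝ) ≤ t := by exact_mod_cast ht2
  have hlog : 0 < Real.log t := Real.log_pos (by linarith)
  have ht'' : Real.log t / t < 1 / (|c| + 1) := ht
  rw [div_lt_div_iff₀ (by linarith) (by positivity)] at ht''
  rw [le_div_iff₀ hlog]
  nlinarith [le_abs_self c]

/-- Summation by parts for the burn-in regret. -/
lemma sum_sub_mul_eq (g b : ℕ → ℝ) {N : ℕ} (hN : 2 ≤ N) :
    ∑ m ∈ Finset.Icc 2 N, (g m - g (m - 1)) * b m =
      b N * g N + ∑ k ∈ Finset.Icc 2 (N - 1), (b k - b (k + 1)) * g k - b 2 * g 1 := by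
  induction N, hN using Nat.le_induction with
  | base => simp; ring
  | succ n hn ih =>
    rw [Finset.sum_Icc_succ_top (by omega), ih]
    obtain ⟨m, rfl⟩ : ∃ m, n = m + 1 := ⟨n - 1, by omega⟩
    rw [show m + 1 + 1 - 1 = m + 1 by omega, show m + 1 - 1 = m by omega,
      Finset.sum_Icc_succ_top (by omega)]
    ring

/-- For `t ≥ 3` the term is at most `1 / (t (t + 1))`, and the sum telescopes. -/
lemma sum_tail_le_one (T : ℕ) :
    ∑ t ∈ Finset.range T, (if 3 ≤ t then 2 * ((t : ℝ) ^ 32)⁻¹ else 0) ≤ 1 := by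
  have h : ∀ n : ℕ, ∑ t ∈ Finset.range (n + 1), (if 3 ≤ t then 2 * ((t : ℝ) ^ 32)⁻¹ else 0) ≤
      1 - 1 / ((n : ℝ) + 1) := by
    intro n
    induction n with
    | zero => simp
    | succ n ih =>
      rw [Finset.sum_range_succ]
      have h1 : (if 3 ≤ n + 1 then 2 * (((n + 1 : ℕ) : ℝ) ^ 32)⁻¹ else 0) ≤
          1 / ((n : ℝ) + 1) - 1 / (((n + 1 : ℕ) : ℝ) + 1) := by
        have h2 : 1 / ((n : ℝ) + 1) - 1 / (((n + 1 : ℕ) : ℝ) + 1) =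
            1 / (((n : ℝ) + 1) * ((n : ℝ) + 1 + 1)) := by
          push_cast
          field_simp
          ring
        rw [h2]
        split_ifs with h3
        · push_cast
          have h4 : (3 : ℝ) ≤ (n : ℝ) + 1 := by exact_mod_cast h3
          set x : ℝ := (n : ℝ) + 1
          rw [← div_eq_mul_inv, div_le_div_iff₀ (by positivity) (by positivity)]
          have h5 : x ^ 3 ≤ x ^ 32 := pow_le_pow_right₀ (by linarith) (by norm_num)
          have h6 : 0 ≤ (x - 3) * (x * (x + 1)) := mul_nonneg (by linarith) (by positivity)
          nlinarith
        · positivity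
      linarith
  cases T with
  | zero => simp
  | succ n =>
    refine (h n).trans ?_
    have : 0 ≤ 1 / ((n : ℝ) + 1) := by positivity
    linarith

namespace EpisodicBandit

variable {X V : Type*} [Fintype X] [Fintype V] {N E : ℕ} (B : EpisodicBandit X V N E)

/-! ### Gaps -/

lemma mean_le_bestMean (e : Fin E) (i : Fin N) : B.mean e i ≤ B.bestMean e :=
  le_ciSup (Set.finite_range _).bddAbove i

lemma exists_mean_eq_bestMean (e : Fin E) (hN : 0 < N) : ∃ i, B.mean e i = B.bestMean e := by
  have : Nonempty (Fin N) := ⟨⟨0, hN⟩⟩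
  exact exists_eq_ciSup_of_finite

lemma expertGap_nonneg (e : Fin E) (i : Fin N) : 0 ≤ B.expertGap e i :=
  sub_nonneg.2 (B.mean_le_bestMean e i)

lemma expertGap_le_one (e : Fin E) (i : Fin N) : B.expertGap e i ≤ 1 := by
  obtain ⟨i', hi'⟩ := B.exists_mean_eq_bestMean e i.pos
  rw [expertGap, ← hi']
  linarith [B.mean_le_one e i', B.mean_nonneg e i]

/-- The position of expert `i` in the list of the experts of episode `e`, the best first. -/
noncomputable def rank (e : Fin E) (i : Fin N) : ℕ :=
  ((Tuple.sort (B.expertGap e)).symm i : ℕ) + 1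

lemma rank_mem (e : Fin E) (i : Fin N) : 1 ≤ B.rank e i ∧ B.rank e i ≤ N := by
  unfold rank
  have := ((Tuple.sort (B.expertGap e)).symm i).2
  omega

lemma gap_eq (e : Fin E) {k : ℕ} (hk : k - 1 < N) :
    B.gap e k = B.expertGap e (Tuple.sort (B.expertGap e) ⟨k - 1, hk⟩) := by
  rw [gap, dif_pos hk]

lemma gap_rank (e : Fin E) (i : Fin N) : B.gap e (B.rank e i) = B.expertGap e i := by
  have h : B.rank e i - 1 < N := by have := B.rank_mem e i; omega
  rw [B.gap_eq e h]
  simp [rank]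

lemma gap_nonneg (e : Fin E) (k : ℕ) : 0 ≤ B.gap e k := by
  unfold gap
  split_ifs
  · exact B.expertGap_nonneg e _
  · exact le_rfl

lemma gap_le_one (e : Fin E) (k : ℕ) : B.gap e k ≤ 1 := by
  unfold gap
  split_ifs
  · exact B.expertGap_le_one e _
  · exact zero_le_one

lemma gap_mono (e : Fin E) {k k' : ℕ} (hk : 1 ≤ k) (h : k ≤ k') (hk' : k' ≤ N) :
    B.gap e k ≤ B.gap e k' := by
  rw [B.gap_eq e (show k - 1 < N by omega), B.gap_eq e (show k' - 1 < N by omega)]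
  exact Tuple.monotone_sort (B.expertGap e) (Fin.mk_le_mk.2 (by omega))

lemma gap_one (e : Fin E) (hN : 0 < N) : B.gap e 1 = 0 := by
  obtain ⟨i, hi⟩ := B.exists_mean_eq_bestMean e hN
  have h1 := B.gap_mono e le_rfl (B.rank_mem e i).1 (B.rank_mem e i).2
  rw [gap_rank, expertGap, hi, sub_self] at h1
  exact le_antisymm h1 (B.gap_nonneg e 1)

lemma sum_expertGap (e : Fin E) (hN : 2 ≤ N) :
    ∑ i, B.expertGap e i = ∑ k ∈ Finset.Icc 2 N, B.gap e k := by
  rw [← Equiv.sum_comp (Tuple.sort (B.expertGap e))]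
  have h1 : ∀ i : Fin N, B.expertGap e (Tuple.sort (B.expertGap e) i) =
      (fun k : ℕ => B.gap e (k + 1)) i := by
    intro i
    simp only
    rw [B.gap_eq e (show (i : ℕ) + 1 - 1 < N by have := i.2; omega)]
    simp
  rw [Finset.sum_congr rfl fun i _ => h1 i, Fin.sum_univ_eq_sum_range (fun k => B.gap e (k + 1)) N]
  obtain ⟨n, rfl⟩ : ∃ n, N = n + 1 := ⟨N - 1, by omega⟩
  rw [Finset.sum_range_succ']
  simp only [zero_add, B.gap_one e (by omega), add_zero]
  rw [Finset.range_eq_Ico, Finset.sum_Ico_add' (fun k => B.gap e (k + 1)) 0 n 1,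
    Finset.sum_Ico_add' (fun k => B.gap e k) (0 + 1) (n + 1) 1]
  rfl

/-- With a single action all experts coincide and all gaps vanish. -/
lemma nontrivial_of_gap (e : Fin E) (hN : 2 ≤ N) (hgap : B.γ * B.pV < B.gap e 2) :
    Nontrivial V := by
  by_contra hV
  rw [not_nontrivial_iff_subsingleton] at hV
  have hpol : ∀ i j x v, B.policy i x v = B.policy j x v := by
    intro i j x v
    have h1 := B.policy_sum i x
    have h2 := B.policy_sum j x
    rw [Fintype.sum_subsingleton _ v] at h1 h2
    rw [h1, h2]
  have hmean : ∀ i j, B.mean e i = B.mean e j := by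
    intro i j
    unfold mean
    congr 1
    funext x v
    exact hpol i j x v
  have hzero : ∀ i, B.expertGap e i = 0 := by
    intro i
    obtain ⟨i', hi'⟩ := B.exists_mean_eq_bestMean e (by omega)
    rw [expertGap, ← hi', hmean i i', sub_self]
  rw [B.gap_eq e (show 2 - 1 < N by omega), hzero] at hgap
  exact absurd hgap (not_lt.2 (mul_pos B.γ_pos B.pV_pos).le)

/-! ### Burn-in times -/

lemma lt_gap (e : Fin E) (hgap : B.γ * B.pV < B.gap e 2) {k : ℕ} (hk : 2 ≤ k) (hkN : k ≤ N) :
    B.γ * B.pV < B.gap e k :=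
  hgap.trans_le (B.gap_mono e (by omega) hk hkN)

variable {B}

lemma threshold_anti (hV : Nontrivial V) (e : Fin E) (i₀ : Fin N) {D D' : ℝ} (hD : 0 < D)
    (hD' : D ≤ D') (hD1 : D' ≤ 1) :
    9 * B.C ^ 2 * B.M ^ 2 * Real.log (6 * B.C / D') ^ 2 / D' ^ 2 ≤
      9 * B.C ^ 2 * B.M ^ 2 * Real.log (6 * B.C / D) ^ 2 / D ^ 2 := by
  have hC := B.thirty_two_le_C hV e i₀
  have hC0 : 0 < B.C := by linarith
  have hD0' : 0 < D' := by linarith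
  have h1 : 0 ≤ Real.log (6 * B.C / D') := Real.log_nonneg (by rw [le_div_iff₀ hD0']; linarith)
  have h2 : Real.log (6 * B.C / D') ≤ Real.log (6 * B.C / D) :=
    Real.log_le_log (by positivity) (by gcongr)
  gcongr

/-- `230400 = 9 · 32² · 5²`, from `C ≥ 32`, `M ≥ 1` and `log (6 C / D) ≥ log 192 ≥ 5`. It forces the
burn-in to be long, so that crude numerical estimates suffice elsewhere. -/
lemma le_threshold (hV : Nontrivial V) (e : Fin E) (i₀ : Fin N) {D : ℝ} (hD : 0 < D)
    (hD1 : D ≤ 1) :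
    230400 / D ^ 2 ≤ 9 * B.C ^ 2 * B.M ^ 2 * Real.log (6 * B.C / D) ^ 2 / D ^ 2 := by
  have hC := B.thirty_two_le_C hV e i₀
  have hM := B.one_le_M e i₀
  have h1 : 5 ≤ Real.log (6 * B.C / D) := by
    rw [Real.le_log_iff_exp_le (by positivity)]
    have h2 : Real.exp 5 ≤ 192 := by
      rw [show (5 : ℝ) = (5 : ℕ) * 1 by norm_num, Real.exp_nat_mul]
      calc Real.exp 1 ^ 5 ≤ 2.8 ^ 5 := by
            gcongr
            linarith [Real.exp_one_lt_d9]
        _ ≤ 192 := by norm_num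
    refine h2.trans ?_
    rw [le_div_iff₀ hD]
    nlinarith
  refine div_le_div_of_nonneg_right ?_ (by positivity)
  calc (230400 : ℝ) = 9 * 32 ^ 2 * 1 ^ 2 * 5 ^ 2 := by norm_num
    _ ≤ _ := by gcongr

lemma large_of_threshold_le {t : ℕ} (ht : 2 ≤ t) (h : 230400 ≤ (t : ℝ) / Real.log t) :
    500000 ≤ t := by
  have ht' : (2 : ℝ) ≤ t := by exact_mod_cast ht
  have hlog : 0 < Real.log t := Real.log_pos (by linarith)
  rw [le_div_iff₀ hlog] at h
  have h1 : Real.log 2 ≤ Real.log t := Real.log_le_log (by norm_num) ht'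
  have h2 := Real.log_two_gt_d9
  have h3 : (100000 : ℝ) ≤ t := by linarith
  have h4 : 3 ≤ Real.log t := by
    rw [Real.le_log_iff_exp_le (by linarith), show (3 : ℝ) = (3 : ℕ) * 1 by norm_num,
      Real.exp_nat_mul]
    calc Real.exp 1 ^ 3 ≤ 2.8 ^ 3 := by
          gcongr
          linarith [Real.exp_one_lt_d9]
      _ ≤ (t : ℝ) := by norm_num; linarith
  have h5 : (500000 : ℝ) ≤ t := by linarith
  exact_mod_cast h5

/-- The infimum is attained, and its inequality persists because `t / log t` increases from `3` on.
-/
lemma tau_spec (hV : Nontrivial V) (e : Fin E) (i₀ : Fin N) {k : ℕ}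
    (hgap : B.γ * B.pV < B.gap e k) :
    500000 ≤ B.tau e k ∧ ∀ t : ℕ, B.tau e k ≤ t →
      9 * B.C ^ 2 * B.M ^ 2 * Real.log (6 * B.C / (B.gap e k - B.γ * B.pV)) ^ 2 /
        (B.gap e k - B.γ * B.pV) ^ 2 ≤ t / Real.log t := by
  have hD : 0 < B.gap e k - B.γ * B.pV := by linarith
  have hD1 : B.gap e k - B.γ * B.pV ≤ 1 := by
    linarith [B.gap_le_one e k, mul_pos B.γ_pos B.pV_pos]
  have hmem := Nat.sInf_mem (s := {t : ℕ | 2 ≤ t ∧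
    9 * B.C ^ 2 * B.M ^ 2 * Real.log (6 * B.C / (B.gap e k - B.γ * B.pV)) ^ 2 /
      (B.gap e k - B.γ * B.pV) ^ 2 ≤ t / Real.log t}) (exists_le_div_log _)
  change 2 ≤ B.tau e k ∧ 9 * B.C ^ 2 * B.M ^ 2 *
    Real.log (6 * B.C / (B.gap e k - B.γ * B.pV)) ^ 2 /
      (B.gap e k - B.γ * B.pV) ^ 2 ≤ (B.tau e k : ℝ) / Real.log (B.tau e k) at hmem
  have h1 := B.le_threshold hV e i₀ hD hD1
  have h2 : (230400 : ℝ) ≤ 230400 / (B.gap e k - B.γ * B.pV) ^ 2 := by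
    rw [le_div_iff₀ (by positivity)]
    nlinarith
  have h3 := large_of_threshold_le (t := B.tau e k) hmem.1 (by linarith [hmem.2])
  refine ⟨h3, fun t ht => hmem.2.trans (div_log_mono ?_ (by exact_mod_cast ht))⟩
  have : (500000 : ℝ) ≤ B.tau e k := by exact_mod_cast h3
  linarith

lemma tau_anti (hV : Nontrivial V) (e : Fin E) (i₀ : Fin N) (hgap : B.γ * B.pV < B.gap e 2)
    {k k' : ℕ} (hk : 2 ≤ k) (hkk' : k ≤ k') (hk' : k' ≤ N) : B.tau e k' ≤ B.tau e k := by
  have hg := B.lt_gap e hgap hk (hkk'.trans hk')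
  have h := tau_spec hV e i₀ hg
  refine Nat.sInf_le ⟨by omega, le_trans (threshold_anti hV e i₀ ?_ ?_ ?_) (h.2 _ le_rfl)⟩
  · linarith
  · linarith [B.gap_mono e (by omega) hkk' hk']
  · linarith [B.gap_le_one e k', mul_pos B.γ_pos B.pV_pos]

lemma burnIn_anti (hV : Nontrivial V) (e : Fin E) (i₀ : Fin N) (hgap : B.γ * B.pV < B.gap e 2)
    {k k' : ℕ} (hk : 2 ≤ k) (hkk' : k ≤ k') (hk' : k' ≤ N) : B.burnIn e k' ≤ B.burnIn e k := by
  have h := tau_anti hV e i₀ hgap hk hkk' hk'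
  unfold burnIn
  rw [if_neg (by omega), if_neg (by omega)]
  exact max_le_max le_rfl h

/-! ### The single-episode bound -/

/-- The form in which the bound arises: the increment from the `(m-1)`-st to the `m`-th gap is lost
in each of the first `Tₘ` rounds. -/
lemma regretBound_eq (e : Fin E) (hN : 2 ≤ N) :
    B.regretBound e = Real.pi ^ 2 / 3 * ∑ k ∈ Finset.Icc 2 N, B.gap e k +
      ∑ m ∈ Finset.Icc 2 N, (B.gap e m - B.gap e (m - 1)) * B.burnIn e m := by
  rw [sum_sub_mul_eq (B.gap e) (fun m => (B.burnIn e m : ℝ)) hN, B.gap_one e (by omega),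
    regretBound]
  ring

lemma gap_sub_nonneg (e : Fin E) {m : ℕ} (hm : m ∈ Finset.Icc 2 N) :
    0 ≤ B.gap e m - B.gap e (m - 1) := by
  rw [Finset.mem_Icc] at hm
  exact sub_nonneg.2 (B.gap_mono e (by omega) (by omega) hm.2)

lemma sum_gap_sub (e : Fin E) {n : ℕ} (hn : 2 ≤ n) (hN : 0 < N) :
    ∑ m ∈ Finset.Icc 2 n, (B.gap e m - B.gap e (m - 1)) = B.gap e n := by
  have h := sum_sub_mul_eq (B.gap e) (fun _ => 1) hn
  simp only [mul_one, one_mul, sub_self, zero_mul, Finset.sum_const_zero, add_zero,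
    B.gap_one e hN, sub_zero] at h
  exact h

variable (B) in
-- The slack in the constant: it pays for the tail, for an additional burn-in round, and for the
-- case of very many experts.
lemma three_mul_sum_gap_le (e : Fin E) :
    3 * ∑ k ∈ Finset.Icc 2 N, B.gap e k ≤
      Real.pi ^ 2 / 3 * ∑ k ∈ Finset.Icc 2 N, B.gap e k := by
  refine mul_le_mul_of_nonneg_right ?_ (Finset.sum_nonneg fun k _ => B.gap_nonneg e k)
  have := Real.pi_gt_three
  nlinarith

lemma three_mul_sum_gap_le_regretBound (e : Fin E) (hN : 2 ≤ N) :
    3 * ∑ k ∈ Finset.Icc 2 N, B.gap e k ≤ B.regretBound e := by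
  rw [regretBound_eq e hN]
  have h1 := B.three_mul_sum_gap_le e
  have h2 : 0 ≤ ∑ m ∈ Finset.Icc 2 N, (B.gap e m - B.gap e (m - 1)) * B.burnIn e m :=
    Finset.sum_nonneg fun m hm => mul_nonneg (gap_sub_nonneg e hm) (Nat.cast_nonneg _)
  linarith

lemma regretBound_nonneg (e : Fin E) (hN : 2 ≤ N) : 0 ≤ B.regretBound e :=
  le_trans (mul_nonneg (by norm_num) (Finset.sum_nonneg fun k _ => B.gap_nonneg e k))
    (three_mul_sum_gap_le_regretBound e hN)

lemma regretBound_le (hV : Nontrivial V) (e : Fin E) (i₀ : Fin N) (hN : 2 ≤ N)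
    (hgap : B.γ * B.pV < B.gap e 2) :
    B.regretBound e ≤ Real.pi ^ 2 / 3 * N + B.burnIn e 2 := by
  rw [regretBound_eq e hN]
  have h1 : ∑ k ∈ Finset.Icc 2 N, B.gap e k ≤ N := by
    refine (Finset.sum_le_sum fun k _ => B.gap_le_one e k).trans ?_
    rw [Finset.sum_const, Nat.card_Icc, nsmul_eq_mul, mul_one]
    exact_mod_cast (by omega : N + 1 - 2 ≤ N)
  have h2 : ∑ m ∈ Finset.Icc 2 N, (B.gap e m - B.gap e (m - 1)) * B.burnIn e m ≤
      ∑ m ∈ Finset.Icc 2 N, (B.gap e m - B.gap e (m - 1)) * B.burnIn e 2 := by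
    refine Finset.sum_le_sum fun m hm => mul_le_mul_of_nonneg_left ?_ (gap_sub_nonneg e hm)
    rw [Finset.mem_Icc] at hm
    exact_mod_cast burnIn_anti hV e i₀ hgap le_rfl hm.1 hm.2
  rw [← Finset.sum_mul, sum_gap_sub e hN (by omega)] at h2
  have h3 : B.gap e N * B.burnIn e 2 ≤ 1 * B.burnIn e 2 := by
    gcongr
    exact B.gap_le_one e N
  have h4 : Real.pi ^ 2 / 3 * ∑ k ∈ Finset.Icc 2 N, B.gap e k ≤ Real.pi ^ 2 / 3 * N := by gcongr
  linarith

/-- The regret of the burn-in phase, one round longer than in `regretBound`, and of the rare plays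
of suboptimal experts after it. -/
lemma sum_burnIn_add_tail_le (e : Fin E) (hN : 2 ≤ N) (T : ℕ) :
    ∑ t ∈ Finset.range T, ((∑ m ∈ Finset.Icc 2 N, (B.gap e m - B.gap e (m - 1)) *
        (if t ≤ B.burnIn e m then (1 : ℝ) else 0)) +
      (∑ i, B.expertGap e i) * (if 3 ≤ t then 2 * ((t : ℝ) ^ 32)⁻¹ else 0)) ≤
      B.regretBound e := by
  rw [Finset.sum_add_distrib, Finset.sum_comm, ← Finset.mul_sum, regretBound_eq e hN,
    sum_expertGap B e hN]
  have h1 : ∀ m, ∑ t ∈ Finset.range T, (if t ≤ B.burnIn e m then (1 : ℝ) else 0) ≤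
      B.burnIn e m + 1 := by
    intro m
    rw [Finset.sum_boole]
    have : (Finset.filter (fun t => t ≤ B.burnIn e m) (Finset.range T)).card ≤
        B.burnIn e m + 1 := by
      rw [← Finset.card_range (B.burnIn e m + 1)]
      refine Finset.card_le_card fun t ht => ?_
      simp only [Finset.mem_filter, Finset.mem_range] at ht ⊢
      omega
    exact_mod_cast this
  have h2 : ∑ m ∈ Finset.Icc 2 N, ∑ t ∈ Finset.range T, (B.gap e m - B.gap e (m - 1)) *
      (if t ≤ B.burnIn e m then (1 : ℝ) else 0) ≤
      ∑ m ∈ Finset.Icc 2 N, ((B.gap e m - B.gap e (m - 1)) * B.burnIn e m +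
        (B.gap e m - B.gap e (m - 1))) := by
    refine Finset.sum_le_sum fun m hm => ?_
    rw [← Finset.mul_sum]
    have := mul_le_mul_of_nonneg_left (h1 m) (gap_sub_nonneg (B := B) e hm)
    linarith
  rw [Finset.sum_add_distrib, sum_gap_sub (B := B) e hN (by omega)] at h2
  -- The additional round costs the sum of all increments, which is the largest gap.
  have h3 : B.gap e N ≤ ∑ k ∈ Finset.Icc 2 N, B.gap e k :=
    Finset.single_le_sum (f := B.gap e) (fun k _ => B.gap_nonneg e k)
      (Finset.mem_Icc.2 ⟨hN, le_rfl⟩)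
  have h4 := mul_le_mul_of_nonneg_left (sum_tail_le_one T)
    (Finset.sum_nonneg fun k (_ : k ∈ Finset.Icc 2 N) => B.gap_nonneg e k)
  have h5 := B.three_mul_sum_gap_le e
  have h6 : 0 ≤ ∑ k ∈ Finset.Icc 2 N, B.gap e k := Finset.sum_nonneg fun k _ => B.gap_nonneg e k
  linarith

end EpisodicBandit

/-! ### Empirical policies and decomposition over finitely many values. -/

open Classical in
lemma isPolicyFamily_empirical {X V : Type*} [Fintype V] {N A : ℕ} {sx : Fin N → Fin A → X}
    {sv : Fin N → Fin A → V} (h : ∀ i x, ∃ a, sx i a = x) :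
    IsPolicyFamily (empirical sx sv) := by
  intro i x
  refine ⟨fun v => by unfold empirical; positivity, ?_⟩
  unfold empirical
  have hne : ((Finset.univ.filter fun a => sx i a = x).card : ℝ) ≠ 0 := by
    obtain ⟨a, ha⟩ := h i x
    exact Nat.cast_ne_zero.2
      (Finset.card_ne_zero_of_mem (Finset.mem_filter.2 ⟨Finset.mem_univ a, ha⟩))
  rw [← Finset.sum_div, div_eq_one_iff_eq hne, ← Nat.cast_sum,
    Finset.card_eq_sum_card_fiberwise (f := sv i) (t := Finset.univ)
      fun _ _ => Finset.mem_coe.2 (Finset.mem_univ _)]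
  simp only [Finset.filter_filter]

section Fibers

variable {Ω : Type*} [MeasurableSpace Ω] {P : Measure Ω} [IsProbabilityMeasure P]
  {ι : Type*} [Fintype ι] {f : Ω → ι}

lemma sum_measureReal_inter_fiber (hf : ∀ i, MeasurableSet {ω | f ω = i}) (S : Set Ω) :
    ∑ i, P.real (S ∩ {ω | f ω = i}) = P.real S := by
  have h := sum_measureReal_preimage_singleton (μ := P.restrict S) Finset.univ (f := f)
    fun i _ => hf i
  rw [Finset.coe_univ, Set.preimage_univ, measureReal_restrict_apply_univ] at h
  rw [← h]
  refine Finset.sum_congr rfl fun i _ => ?_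
  rw [Set.inter_comm]
  exact (measureReal_restrict_apply (hf i)).symm

lemma integral_comp_of_fintype (hf : ∀ i, MeasurableSet {ω | f ω = i}) (g : ι → ℝ) :
    Integrable (fun ω => g (f ω)) P ∧ ∫ ω, g (f ω) ∂P = ∑ i, g i * P.real {ω | f ω = i} := by
  have h : (fun ω => g (f ω)) =
      fun ω => ∑ i, Set.indicator {ω | f ω = i} (fun _ => g i) ω := by
    classical
    funext ω
    simp [Set.indicator_apply]
  have hi : ∀ i, Integrable (Set.indicator {ω | f ω = i} fun _ => g i) P := fun i =>
    (integrable_const (g i)).indicator (hf i)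
  rw [h]
  refine ⟨integrable_finsetSum _ fun i _ => hi i, ?_⟩
  rw [integral_finsetSum _ fun i _ => hi i]
  refine Finset.sum_congr rfl fun i _ => ?_
  rw [integral_indicator_const _ (hf i), smul_eq_mul, mul_comm]

end Fibers

/-! ### Regret of an episode and of the whole run. -/

namespace EpisodicBandit

variable {X V : Type*} [Fintype X] [Fintype V] {N E : ℕ} {B : EpisodicBandit X V N E}

lemma tau_le_burnIn (e : Fin E) {k : ℕ} (hk : 2 ≤ k) : B.tau e k ≤ B.burnIn e k := by
  rw [burnIn, if_neg (by omega)]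
  exact le_max_right _ _

lemma Tclip_le_burnIn (e : Fin E) {k : ℕ} (hk : 2 ≤ k) : B.Tclip ≤ B.burnIn e k := by
  rw [burnIn, if_neg (by omega)]
  exact (le_max_right _ _).trans (le_max_left _ _)

/-- `230400 / D² ≤ T / log T ≤ T`, so `D` is of order at least `T^(-1/2)`. The bound leaves room for
the error `16 θ ≤ 1 / T` of the ratios. -/
lemma one_div_lt_gap_sub (hV : Nontrivial V) (e : Fin E) (i₀ : Fin N) {k T : ℕ}
    (hgap : B.γ * B.pV < B.gap e k) (hT : B.tau e k ≤ T) :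
    1 / (T : ℝ) < B.gap e k - B.γ * B.pV := by
  obtain ⟨h1, h2⟩ := tau_spec hV e i₀ hgap
  have hT' : (500000 : ℝ) ≤ T := by exact_mod_cast h1.trans hT
  have hD : 0 < B.gap e k - B.γ * B.pV := by linarith
  have hD1 : B.gap e k - B.γ * B.pV ≤ 1 := by
    linarith [B.gap_le_one e k, mul_pos B.γ_pos B.pV_pos]
  have h3 := (le_threshold hV e i₀ hD hD1).trans (h2 T hT)
  have hlog : 1 ≤ Real.log T := by
    rw [Real.le_log_iff_exp_le (by linarith)]
    linarith [Real.exp_one_lt_d9]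
  have h4 := h3.trans (div_le_self (by linarith) hlog)
  rw [div_le_iff₀ (by positivity)] at h4
  by_contra hcon
  rw [not_lt, le_div_iff₀ (by linarith)] at hcon
  nlinarith

end EpisodicBandit

namespace BootstrappedRun

variable {X V : Type*} [Fintype X] [Fintype V] {N E : ℕ} {B : EpisodicBandit X V N E} {T : ℕ}
  {Ω : Type*} [mΩ : MeasurableSpace Ω] {P : Measure Ω} (r : BootstrappedRun B T P)

open EpisodicBandit

lemma measurableSet_expert_eq (e : Fin E) (t : ℕ) (j : Fin N) :
    MeasurableSet {ω | r.expert e t ω = j} :=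
  r.measurable_expert e t (show MeasurableSet[⊤] {j} from trivial)

lemma measurableSet_bootEvent_ambient (e : Fin E)
    (z : (Fin N → Fin (B.numSamples T) → X) × (Fin N → Fin (B.numSamples T) → V)) :
    MeasurableSet (r.bootEvent z) :=
  r.past_le e 0 _ (r.measurableSet_bootEvent e 0 z)

lemma bootEvent_eq_fiber
    (z : (Fin N → Fin (B.numSamples T) → X) × (Fin N → Fin (B.numSamples T) → V)) :
    r.bootEvent z = {ω | ((fun i a => r.bootCtx i a ω, fun i a => r.bootAct i a ω) :
      (Fin N → Fin (B.numSamples T) → X) × (Fin N → Fin (B.numSamples T) → V)) = z} := by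
  ext ω
  simp only [bootEvent, Set.mem_ofPred_eq, Prod.ext_iff, funext_iff]
  exact ⟨fun h => ⟨fun i a => (h i a).1, fun i a => (h i a).2⟩,
    fun h i a => ⟨h.1 i a, h.2 i a⟩⟩

variable [IsProbabilityMeasure P]

/-- The regret of an episode on an event of accurate estimates. -/
lemma sum_gap_mul_measure_inter_le (hV : Nontrivial V) (hq : B.toParams.Admissible) (hN : 2 ≤ N)
    (e : Fin E) (hgap : B.γ * B.pV < B.gap e 2) {F : Set Ω}
    (hF : ∀ t, MeasurableSet[r.past e t] F) {est : Fin N → X → V → ℝ} {κ θ : ℝ}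
    (h : B.Accurate est κ θ) (hθ : 16 * θ ≤ 1 / (T : ℝ))
    (hest : ∀ ω ∈ F, empirical (fun i a => r.bootCtx i a ω) (fun i a => r.bootAct i a ω) = est)
    (hkept : ∀ t, B.Tclip + 1 ≤ t → 9 ≤ t → t ≤ T →
      ∀ (k : ℕ → Fin N) (i j : Fin N) (x : X) (v : V),
        Kept B.toParams est (eps B.toParams est k i t) i j x v) :
    ∑ t ∈ Finset.range T, ∑ i, B.expertGap e i * P.real (F ∩ {ω | r.expert e (t + 1) ω = i}) ≤
      P.real F * B.regretBound e := by
  obtain ⟨i', hi'⟩ := B.exists_mean_eq_bestMean e (by omega)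
  refine le_trans ?_ (mul_le_mul_of_nonneg_left (sum_burnIn_add_tail_le (B := B) e hN T)
    measureReal_nonneg)
  rw [Finset.mul_sum]
  refine Finset.sum_le_sum fun t ht => ?_
  rw [Finset.mem_range] at ht
  set D : ℝ := ∑ m ∈ Finset.Icc 2 N, (B.gap e m - B.gap e (m - 1)) *
        (if t ≤ B.burnIn e m then (1 : ℝ) else 0) with hD
  set q : ℝ := if 3 ≤ t then 2 * ((t : ℝ) ^ 32)⁻¹ else 0 with hq'
  have hq0 : 0 ≤ q := by rw [hq']; positivity
  have hterm : ∀ m ∈ Finset.Icc 2 N, 0 ≤ (B.gap e m - B.gap e (m - 1)) *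
        (if t ≤ B.burnIn e m then (1 : ℝ) else 0) := fun m hm =>
    mul_nonneg (gap_sub_nonneg e hm) (by positivity)
  have hD0 : 0 ≤ D := Finset.sum_nonneg hterm
  have hPF : 0 ≤ P.real F := measureReal_nonneg
  -- An expert of rank `k` still in its burn-in is also within those of all ranks `m ≤ k`, so its
  -- gap, a sum of increments, is at most `D`. After its burn-in the tail bound applies.
  have key : ∀ i, B.expertGap e i * P.real (F ∩ {ω | r.expert e (t + 1) ω = i}) ≤
      D * P.real (F ∩ {ω | r.expert e (t + 1) ω = i}) + B.expertGap e i * (P.real F * q) := by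
    intro i
    have hgi := B.expertGap_nonneg e i
    have hP : 0 ≤ P.real (F ∩ {ω | r.expert e (t + 1) ω = i}) := measureReal_nonneg
    have htriv : B.expertGap e i ≤ D →
        B.expertGap e i * P.real (F ∩ {ω | r.expert e (t + 1) ω = i}) ≤
      D * P.real (F ∩ {ω | r.expert e (t + 1) ω = i}) + B.expertGap e i * (P.real F * q) :=
      fun h => (mul_le_mul_of_nonneg_right h hP).trans
        (le_add_of_nonneg_right (by positivity))
    have hr := B.rank_mem e i
    rcases hr.1.eq_or_lt with h1 | h1
    · refine htriv ?_
      rwa [← B.gap_rank e i, ← h1, B.gap_one e (by omega)]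
    have hk : 2 ≤ B.rank e i := h1
    by_cases htb : t ≤ B.burnIn e (B.rank e i)
    · refine htriv ?_
      rw [← B.gap_rank e i, ← sum_gap_sub e hk (by omega)]
      calc _ = ∑ m ∈ Finset.Icc 2 (B.rank e i), (B.gap e m - B.gap e (m - 1)) *
            (if t ≤ B.burnIn e m then (1 : ℝ) else 0) := by
            refine Finset.sum_congr rfl fun m hm => ?_
            rw [Finset.mem_Icc] at hm
            rw [if_pos (htb.trans (burnIn_anti hV e i hgap hm.1 hm.2 hr.2)), mul_one]
        _ ≤ D := Finset.sum_le_sum_of_subset_of_nonneg (Finset.Icc_subset_Icc_right hr.2)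
            fun m hm _ => hterm m hm
    · have hgk := B.lt_gap e hgap hk hr.2
      have htau := tau_spec hV e i hgk
      have h2 := tau_le_burnIn (B := B) e hk
      have h3 := Tclip_le_burnIn (B := B) e hk
      have h4 := one_div_lt_gap_sub hV e i hgk (h2.trans (by omega : B.burnIn e _ ≤ T))
      have h5 := r.measure_play_suboptimal_le hV hq e hF h hest i i' (t := t) (by omega) ht
        (hkept t (by omega) (by omega) ht.le) (D := B.gap e (B.rank e i) - B.γ * B.pV)
        (by rw [gap_rank, expertGap, hi']) (by linarith) (htau.2 t (by omega)) (by linarith)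
      have h6 : P.real (F ∩ {ω | r.expert e (t + 1) ω = i}) ≤ P.real F * q := by
        rw [hq', if_pos (by omega)]
        have h7 := ENNReal.toReal_mono (ENNReal.mul_ne_top (measure_ne_top P F)
          ENNReal.ofReal_ne_top) h5
        rwa [ENNReal.toReal_mul, ENNReal.toReal_ofReal (by positivity)] at h7
      have := mul_le_mul_of_nonneg_left h6 hgi
      have := mul_nonneg hD0 hP
      linarith
  refine (Finset.sum_le_sum fun i _ => key i).trans (le_of_eq ?_)
  rw [Finset.sum_add_distrib, ← Finset.mul_sum, ← Finset.sum_mul,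
    sum_measureReal_inter_fiber (fun i => r.measurableSet_expert_eq e (t + 1) i)]
  ring

/-- The regret of an episode on an arbitrary event. -/
lemma sum_gap_mul_measure_inter_le_mul (e : Fin E) (F : Set Ω) :
    ∑ t ∈ Finset.range T, ∑ i, B.expertGap e i * P.real (F ∩ {ω | r.expert e (t + 1) ω = i}) ≤
      T * P.real F := by
  have h : ∀ t ∈ Finset.range T,
      ∑ i, B.expertGap e i * P.real (F ∩ {ω | r.expert e (t + 1) ω = i}) ≤ P.real F := by
    intro t _
    rw [← sum_measureReal_inter_fiber (fun i => r.measurableSet_expert_eq e (t + 1) i) F]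
    exact Finset.sum_le_sum fun i _ =>
      mul_le_of_le_one_left measureReal_nonneg (B.expertGap_le_one e i)
  refine (Finset.sum_le_sum h).trans (le_of_eq ?_)
  rw [Finset.sum_const, Finset.card_range, nsmul_eq_mul]

open Classical in
lemma sum_measureReal_inter_bootEvent (e : Fin E) (S : Set Ω) :
    ∑ z, P.real (r.bootEvent z ∩ S) = P.real S := by
  have h := sum_measureReal_inter_fiber (P := P) (f := fun ω =>
    ((fun i a => r.bootCtx i a ω, fun i a => r.bootAct i a ω) :
      (Fin N → Fin (B.numSamples T) → X) × (Fin N → Fin (B.numSamples T) → V)))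
    (fun z => by rw [← r.bootEvent_eq_fiber]; exact r.measurableSet_bootEvent_ambient e z) S
  rw [← h]
  refine Finset.sum_congr rfl fun z _ => ?_
  rw [Set.inter_comm, r.bootEvent_eq_fiber]

/-- The regret of one episode. -/
lemma sum_gap_mul_measure_le (hN : 2 ≤ N) (e : Fin E) (hgap : B.γ * B.pV < B.gap e 2)
    (hT : B.burnIn e 2 ≤ T) :
    ∑ t ∈ Finset.range T, ∑ i, B.expertGap e i * P.real {ω | r.expert e (t + 1) ω = i} ≤
      B.regretBound e + 1 := by
  classical
  have hV := B.nontrivial_of_gap e hN hgap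
  set i₀ : Fin N := ⟨0, by omega⟩
  have hq := B.admissible hV e i₀
  have hτ : B.tau e 2 ≤ T := (tau_le_burnIn e le_rfl).trans hT
  have hT5 : 500000 ≤ T := (tau_spec hV e i₀ hgap).1.trans hτ
  have hT5' : (500000 : ℝ) ≤ T := by exact_mod_cast hT5
  have hR := regretBound_nonneg (B := B) e hN
  -- With more than `T²` experts of gap at least `1 / T`, the trivial regret bound `T` is already
  -- below the sum of the gaps.
  by_cases hNT : T ^ 2 < N
  · have h1 := r.sum_gap_mul_measure_inter_le_mul e Set.univ
    simp only [Set.univ_inter, probReal_univ, mul_one] at h1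
    have h2 := three_mul_sum_gap_le_regretBound (B := B) e hN
    have h3 : (N - 1 : ℝ) * B.gap e 2 ≤ ∑ k ∈ Finset.Icc 2 N, B.gap e k := by
      have : ∑ k ∈ Finset.Icc 2 N, B.gap e 2 ≤ ∑ k ∈ Finset.Icc 2 N, B.gap e k :=
        Finset.sum_le_sum fun k hk => by
          rw [Finset.mem_Icc] at hk
          exact B.gap_mono e (by omega) hk.1 hk.2
      rw [Finset.sum_const, Nat.card_Icc, nsmul_eq_mul,
        show N + 1 - 2 = N - 1 by omega, Nat.cast_sub (by omega), Nat.cast_one] at this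
      exact this
    have h4 := one_div_lt_gap_sub hV e i₀ hgap hτ
    have h5 : (T : ℝ) ^ 2 + 1 ≤ N := by exact_mod_cast hNT
    have h6 : 1 / (T : ℝ) ≤ B.gap e 2 := by linarith [mul_pos B.γ_pos B.pV_pos]
    have h7 : (T : ℝ) ^ 2 * (1 / T) ≤ (N - 1) * B.gap e 2 := by
      refine mul_le_mul (by linarith) h6 (by positivity) ?_
      linarith [sq_nonneg (T : ℝ)]
    have h8 : (T : ℝ) ^ 2 * (1 / T) = T := by field_simp
    linarith
  obtain ⟨K, hK, hKξ, hKp, hKd⟩ := exists_accuracy_level B hV hq e i₀ hT5 (not_lt.1 hNT)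
  have hKξ0 : 0 ≤ K * B.ξ := mul_nonneg (by linarith) hq.ξ_pos.le
  have hpV1 : B.pV ≤ 1 := by
    obtain ⟨x⟩ := B.nonempty_ctx
    obtain ⟨v⟩ := hV.to_nonempty
    rw [← B.policy_sum i₀ x]
    exact (B.pV_le i₀ x v).trans (Finset.single_le_sum (fun v _ => (B.policy_pos i₀ x v).le)
      (Finset.mem_univ v))
  have hbad := r.sum_measure_bad_le hKξ0 (by nlinarith)
  set bad := Finset.univ.filter (fun z : (Fin N → Fin (B.numSamples T) → X) ×
        (Fin N → Fin (B.numSamples T) → V) =>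
        ∃ i x v, K * B.ξ < |B.policy i x v - empirical z.1 z.2 i x v|) with hbaddef
  have hbad' : ∑ z ∈ bad, P.real (r.bootEvent z) ≤ 1 / T := by
    refine le_trans ?_ hKp
    have h1 := ENNReal.toReal_mono ENNReal.ofReal_ne_top hbad
    rwa [ENNReal.toReal_sum fun z _ => measure_ne_top P _, ENNReal.toReal_ofReal
      (by positivity)] at h1
  have hz : ∀ z, ∑ t ∈ Finset.range T, ∑ i, B.expertGap e i *
      P.real (r.bootEvent z ∩ {ω | r.expert e (t + 1) ω = i}) ≤
      P.real (r.bootEvent z) * B.regretBound e + if z ∈ bad then T * P.real (r.bootEvent z) else 0 := by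
    intro z
    split_ifs with hzb
    · exact (r.sum_gap_mul_measure_inter_le_mul e _).trans
        (le_add_of_nonneg_left (mul_nonneg measureReal_nonneg hR))
    · rw [add_zero]
      have hacc : ∀ i x v, |B.policy i x v - empirical z.1 z.2 i x v| ≤ K * B.ξ := by
        simpa [hbaddef] using hzb
      have hpol : IsPolicyFamily (empirical z.1 z.2) := by
        refine isPolicyFamily_empirical fun i x => ?_
        -- For an unseen context the empirical frequencies are `0`, off by at least `pV > K ξ`.
        by_contra! hcon
        obtain ⟨v⟩ := hV.to_nonempty
        have h1 : empirical z.1 z.2 i x v = 0 := by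
          unfold empirical
          rw [Finset.filter_false_of_mem (p := fun a => z.1 i a = x) fun a _ => hcon a]
          simp
        have h2 := hacc i x v
        rw [h1, sub_zero, abs_of_pos (B.policy_pos i x v)] at h2
        linarith [B.pV_le i x v, B.pV_pos]
      obtain ⟨κ, θ, hA, hθ, hkept⟩ := exists_accurate_of_level hV hq e i₀ hT5 hK hKξ hKd hpol hacc
      exact r.sum_gap_mul_measure_inter_le hV hq hN e hgap
        (fun t => r.measurableSet_bootEvent e t z) hA hθ
        (fun ω hω => r.empirical_eq_of_mem hω) hkept
  calc _ = ∑ z, ∑ t ∈ Finset.range T, ∑ i, B.expertGap e i *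
      P.real (r.bootEvent z ∩ {ω | r.expert e (t + 1) ω = i}) := by
        rw [Finset.sum_comm (s := Finset.univ) (t := Finset.range T)]
        refine Finset.sum_congr rfl fun t _ => ?_
        rw [Finset.sum_comm]
        refine Finset.sum_congr rfl fun i _ => ?_
        rw [← Finset.mul_sum, r.sum_measureReal_inter_bootEvent e]
    _ ≤ _ := Finset.sum_le_sum fun z _ => hz z
    _ = B.regretBound e + T * ∑ z ∈ bad, P.real (r.bootEvent z) := by
        have h1 := r.sum_measureReal_inter_bootEvent e Set.univ
        simp only [Set.inter_univ, probReal_univ] at h1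
        rw [Finset.sum_add_distrib, ← Finset.sum_mul, h1, one_mul, Finset.sum_ite_mem,
          Finset.univ_inter, Finset.mul_sum]
    _ ≤ _ := by
        -- Inaccurate estimates cost at most `T · (1 / T) = 1`.
        have h1 := mul_le_mul_of_nonneg_left hbad' (show (0 : ℝ) ≤ T by linarith)
        rw [mul_one_div_cancel (by linarith)] at h1
        linarith

lemma expectedRegret_eq :
    r.expectedRegret = ∑ e, ∑ t ∈ Finset.range T, ∑ i,
      B.expertGap e i * P.real {ω | r.expert e (t + 1) ω = i} := by
  have h : ∀ e t, Integrable (fun ω => B.bestMean e - B.mean e (r.expert e t ω)) P ∧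
      ∫ ω, B.bestMean e - B.mean e (r.expert e t ω) ∂P =
        ∑ i, B.expertGap e i * P.real {ω | r.expert e t ω = i} := fun e t =>
    integral_comp_of_fintype (fun i => r.measurableSet_expert_eq e t i) (B.expertGap e)
  rw [expectedRegret, integral_finsetSum _ fun e _ => integrable_finsetSum _ fun t _ => (h e t).1]
  refine Finset.sum_congr rfl fun e _ => ?_
  rw [integral_finsetSum _ fun t _ => (h e t).1]
  rw [Finset.range_eq_Ico, Finset.sum_Ico_add' (fun t => ∑ i,
    B.expertGap e i * P.real {ω | r.expert e t ω = i}) 0 T 1]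
  exact Finset.sum_congr rfl fun t _ => (h e t).2

end BootstrappedRun

/-! ### The order of the bound and the conclusion. -/

lemma add_mul_one_add_le {E N T c S : ℝ} (hE : 1 ≤ E) (hN : 1 ≤ N) (hT : 1 ≤ T) (hc : 0 ≤ c)
    (hS : S ≤ E * (Real.pi ^ 2 / 3 * N + c)) :
    Real.sqrt E + E + S * (1 + 1 / (T ^ 2 * Real.sqrt E)) ≤
      (2 + Real.pi ^ 2 / 3 + c) * (E * (N + 1) + N * Real.sqrt E / T ^ 2) := by
  obtain ⟨s, hs, rfl⟩ : ∃ s : ℝ, 1 ≤ s ∧ E = s ^ 2 :=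
    ⟨Real.sqrt E, Real.one_le_sqrt.2 hE, (Real.sq_sqrt (by linarith)).symm⟩
  obtain ⟨u, hu⟩ : ∃ u : ℝ, u = 1 / T ^ 2 := ⟨_, rfl⟩
  have hu0 : 0 ≤ u := by rw [hu]; positivity
  have hu1 : u ≤ 1 := by
    rw [hu, div_le_one (by positivity)]
    exact one_le_pow₀ hT
  have h1 : 1 / (T ^ 2 * s) = u / s := by rw [hu]; field_simp
  have h2 : N * s / T ^ 2 = N * s * u := by rw [hu]; ring
  rw [Real.sqrt_sq (by linarith), h1, h2]
  have h3 : S * (1 + u / s) ≤ s ^ 2 * (Real.pi ^ 2 / 3 * N + c) * (1 + u / s) := by gcongr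
  have h4 : s ^ 2 * (Real.pi ^ 2 / 3 * N + c) * (1 + u / s) =
      (Real.pi ^ 2 / 3 * N + c) * (s ^ 2 + s * u) := by field_simp
  have h5 : s ≤ s ^ 2 := by nlinarith
  have h6 : c * (s * u) ≤ c * (s ^ 2 * N) := by
    refine mul_le_mul_of_nonneg_left ?_ hc
    calc s * u ≤ s * 1 := by gcongr
      _ ≤ s ^ 2 * 1 := by linarith
      _ ≤ s ^ 2 * N := by gcongr
  have h7 : 0 ≤ (2 + c) * (N * s * u) + 2 * (s ^ 2 * N) + Real.pi ^ 2 / 3 * s ^ 2 := by positivity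
  rw [h4] at h3
  linarith

end EDUCB

theorem theorem3 {X V : Type*} [Fintype X] [Fintype V] {N E T : ℕ} (hN : 2 ≤ N)
    (B : EDUCB.EpisodicBandit X V N E)
    (hgap : ∀ e, B.γ * B.pV < B.gap e 2)
    (hT : ∀ e, B.burnIn e 2 ≤ T)
    {Ω : Type*} [MeasurableSpace Ω] (P : MeasureTheory.Measure Ω)
    [MeasureTheory.IsProbabilityMeasure P]
    (r : EDUCB.BootstrappedRun B T P) :
    r.expectedRegret ≤ Real.sqrt E + E +
        (∑ e, B.regretBound e) * (1 + 1 / ((T : ℝ) ^ 2 * Real.sqrt E)) ∧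
    ∀ c : ℝ, (∀ e, (B.burnIn e 2 : ℝ) ≤ c) →
      Real.sqrt E + E + (∑ e, B.regretBound e) * (1 + 1 / ((T : ℝ) ^ 2 * Real.sqrt E)) ≤
        (2 + Real.pi ^ 2 / 3 + c) *
          ((E : ℝ) * (N + 1) + N * Real.sqrt E / (T : ℝ) ^ 2) := by
  have hR : 0 ≤ ∑ e, B.regretBound e :=
    Finset.sum_nonneg fun e _ => EDUCB.EpisodicBandit.regretBound_nonneg e hN
  refine ⟨?_, fun c hc => ?_⟩
  · have h1 : r.expectedRegret ≤ ∑ e : Fin E, (B.regretBound e + 1) := by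
      rw [r.expectedRegret_eq]
      exact Finset.sum_le_sum fun e _ => r.sum_gap_mul_measure_le hN e (hgap e) (hT e)
    rw [Finset.sum_add_distrib, Finset.sum_const, Finset.card_univ, Fintype.card_fin,
      nsmul_eq_mul, mul_one] at h1
    have h2 : ∑ e, B.regretBound e ≤
        (∑ e, B.regretBound e) * (1 + 1 / ((T : ℝ) ^ 2 * Real.sqrt E)) :=
      le_mul_of_one_le_right hR (le_add_of_nonneg_right (by positivity))
    linarith [Real.sqrt_nonneg E]
  -- Without episodes nothing is known about `c` or `T`, but both sides vanish.
  · rcases Nat.eq_zero_or_pos E with rfl | hE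
    · simp
    set e₀ : Fin E := ⟨0, hE⟩
    have hV := B.nontrivial_of_gap e₀ hN (hgap e₀)
    have h1 := ((EDUCB.EpisodicBandit.tau_spec hV e₀ ⟨0, by omega⟩ (hgap e₀)).1.trans
      (EDUCB.EpisodicBandit.tau_le_burnIn e₀ le_rfl)).trans (hT e₀)
    refine EDUCB.add_mul_one_add_le (by exact_mod_cast hE) (by exact_mod_cast (by omega : 1 ≤ N))
      (by exact_mod_cast (by omega : 1 ≤ T)) ((Nat.cast_nonneg _).trans (hc e₀)) ?_
    calc ∑ e, B.regretBound e ≤ ∑ _e : Fin E, (Real.pi ^ 2 / 3 * N + c) :=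
          Finset.sum_le_sum fun e _ => (EDUCB.EpisodicBandit.regretBound_le hV e ⟨0, by omega⟩ hN
            (hgap e)).trans (by linarith [hc e])
      _ = _ := by
          rw [Finset.sum_const, Finset.card_univ, Fintype.card_fin, nsmul_eq_mul]
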